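/- **Notation.** A finite permutation $\tau\in\mathfrak S_n$ has size $|\tau|=n$. For a permutation $\tau$ and a finite set of indices $I=\{i_1<\dots<i_r\}$, the pattern $\mathrm{pat}_I(\tau)\in\mathfrak S_r$ is the permutation $\sigma$ with $\sigma(j)<\sigma(k)\iff\tau(i_j)<\tau(i_k)$; for $\tau\in\mathfrak S_n$, $\mathrm{occ}_\pi(\tau)$ is the number of subsets $I\subseteq[n]$ with $\mathrm{pat}_I(\tau)=\pi$, and $\mathrm{inv}(\tau)$ is the number of inversions. The direct sum $\pi_1\oplus\pi_2$ juxtaposes $\pi_1$ and $\pi_2$, with the values of $\pi_2$ shifted by $|\pi_1|$. A *block* is a non-empty permutation that is not the direct sum of two non-empty permutations; every non-empty finite permutation is uniquely a direct sum $\pi=\pi_1\oplus\dots\oplus\pi_d$ of blocks, and $d$ is its number of blocks. For $q\in(0,1)$, the infinite Mallows($q$) permutation $\Sigma$ is the random bijection of $\mathbb N^*$ whose right-inversion counts $r_i(\Sigma)=\#\{j>i:\Sigma(j)<\Sigma(i)\}$, $i\ge1$, are independent with $\mathbb P(r_i(\Sigma)=k)=(1-q)q^k$ for $k\ge0$. Almost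 surely $\Sigma=B_1\oplus B_2\oplus\cdots$ for a sequence of blocks; $B$ denotes a random block with the law of $B_1$, that is, of the pattern induced by $\Sigma$ on $[M]$, where $M\ge1$ is least with $\Sigma([M])=[M]$. For a pattern $\pi=\pi_1\oplus\dots\oplus\pi_d$ with $d$ blocks put $$e_{\pi,q}=\prod_{j=1}^d\frac{\mathbb E[\mathrm{occ}_{\pi_j}(B)]}{\mathbb E|B|},$$ and for two patterns $\pi,\rho$ with $d$ blocks put $$\begin{aligned}\Gamma^{(d)}_{\pi,\rho}=\mathbb E|B|\,e_{\pi,q}\,e_{\rho,q}\Bigg(&\frac1{(2d-1)!}\sum_{1\le i,j\le d}\binom{i+j-2}{i-1}\binom{2d-i-j}{d-i}\frac{\mathrm{Cov}(\mathrm{occ}_{\pi_j}(B),\mathrm{occ}_{\rho_i}(B))}{\mathbb E[\mathrm{occ}_{\pi_j}(B)]\,\mathbb E[\mathrm{occ}_{\rho_i}(B)]}\\&-\frac1{(d-1)!\,d!}\sum_{i=1}^d\left(\frac{\mathrm{Cov}(|B|,\mathrm{occ}_{\rho_i}(B))}{\mathbb E|B|\,\mathbb E[\mathrm{occ}_{\rho_i}(B)]}+\frac{\mathrm{Cov}(|B|,\mathrm{occ}_{\pi_i}(B))}{\mathbb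 E|B|\,\mathbb E[\mathrm{occ}_{\pi_i}(B)]}\right)+\frac1{(d-1)!^2}\frac{\mathrm{Var}|B|}{(\mathbb E|B|)^2}\Bigg).\end{aligned}$$ **Theorem.** Fix $d\ge1$ and $q\in(0,1)$. Let $\Sigma$ be an infinite Mallows($q$) permutation and $\tau_n=\mathrm{pat}_{[n]}(\Sigma)$ for each $n$. Then $|B|$ and $\mathrm{occ}_\beta(B)$, for every block $\beta$, have finite second moments and positive expectations, so that $e_{\pi,q}$ and $\Gamma^{(d)}$ are well defined; $\tau_n$ has the Mallows$(n,q)$ law, $\mathbb P(\tau_n=\sigma)=q^{\mathrm{inv}(\sigma)}/\sum_{\rho\in\mathfrak S_n}q^{\mathrm{inv}(\rho)}$ for $\sigma\in\mathfrak S_n$; and: 1. For every pattern $\pi$ with $d$ blocks, almost surely $\dfrac{\mathrm{occ}_\pi(\tau_n)}{n^d}\to\dfrac{e_{\pi,q}}{d!}$ as $n\to\infty$. 2. The infinite matrix $\Gamma^{(d)}$, indexed by all patterns with $d$ blocks, is symmetric positive semidefinite, and, in the sense of finite-dimensional convergence in distribution, as $n\to\infty$, $$\left(\frac{\mathrm{occ}_\pi(\tau_n)-\binom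 nd e_{\pi,q}}{n^{d-1/2}}\right)_{\pi=\pi_1\oplus\dots\oplus\pi_d}\longrightarrow\mathcal N(0,\Gamma^{(d)}).$$ 3. All joint moments converge as well: for every finite family of patterns with $d$ blocks and all exponents in $\mathbb N$, the corresponding joint moments of these normalized variables are finite and converge to those of $\mathcal N(0,\Gamma^{(d)})$, which are finite too. -/

import Mathlib

open MeasureTheory ProbabilityTheory Filter Topology

noncomputable section

/-! ### Finite permutations, patterns, blocks -/

/-- A finite permutation: a size `n` together with a permutation of `Fin n`, that is, of
`{0, …, n - 1}` (positions and values are numbered from `0`). -/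
abbrev FinPerm : Type := Σ n : ℕ, Equiv.Perm (Fin n)

/-- The discrete σ-algebra on the countable set of finite permutations. -/
instance FinPerm.instMeasurableSpace : MeasurableSpace FinPerm := ⊤

instance FinPerm.instDiscreteMeasurableSpace : DiscreteMeasurableSpace FinPerm :=
  ⟨fun _ => MeasurableSpace.measurableSet_top⟩

/-- The pattern induced by the permutation `σ` on the finite set `I = {i₀ < i₁ < …}`: the
permutation of `{0, …, |I| - 1}` whose values are in the same relative order as
`σ i₀, σ i₁, …`. Here `Tuple.sort` sends a rank to the index of the value that has this rank,
and its inverse sends an index to the rank of its value. -/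
def pat {α : Type*} [LinearOrder α] (I : Finset α) (σ : Equiv.Perm α) : FinPerm :=
  ⟨I.card, (Tuple.sort fun k : Fin I.card => σ (I.orderEmbOfFin rfl k)).symm⟩

theorem pat_lt_iff {α : Type*} [LinearOrder α] (I : Finset α) (σ : Equiv.Perm α)
    (k l : Fin I.card) :
    (pat I σ).2 k < (pat I σ).2 l ↔ σ (I.orderEmbOfFin rfl k) < σ (I.orderEmbOfFin rfl l) := by
  set f : Fin I.card → α := fun k => σ (I.orderEmbOfFin rfl k) with hf
  have hinj : Function.Injective f := σ.injective.comp (I.orderEmbOfFin rfl).injective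
  have hmono : StrictMono (f ∘ Tuple.sort f) :=
    (Tuple.monotone_sort f).strictMono_of_injective (hinj.comp (Tuple.sort f).injective)
  have h := hmono.lt_iff_lt (a := (Tuple.sort f).symm k) (b := (Tuple.sort f).symm l)
  simp only [Function.comp_apply, Equiv.apply_symm_apply] at h
  exact h.symm

/-- The number of occurrences of `π` as a (classical) pattern in the finite permutation `τ`. -/
def occ (π τ : FinPerm) : ℕ :=
  (Finset.univ.filter fun I : Finset (Fin τ.1) => pat I τ.2 = π).card

/-- The number of inversions. -/
def inv {n : ℕ} (σ : Equiv.Perm (Fin n)) : ℕ :=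
  (Finset.univ.filter fun p : Fin n × Fin n => p.1 < p.2 ∧ σ p.2 < σ p.1).card

/-- A block: a non-empty permutation that is indecomposable, i.e. maps no proper non-empty
initial segment `{0, …, k - 1}` to itself. -/
def IsBlock (β : FinPerm) : Prop :=
  0 < β.1 ∧ ∀ k : ℕ, 0 < k → k < β.1 → ¬ ∀ i : Fin β.1, (i : ℕ) < k → (β.2 i : ℕ) < k

/-- The set of blocks. -/
abbrev Block : Type := {β : FinPerm // IsBlock β}

/-- The direct sum `π₁ ⊕ ⋯ ⊕ π_d`; the equivalence `finSigmaFinEquiv` is the concatenation of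
the intervals of lengths `|π₁|, …, |π_d|`. -/
def directSum {d : ℕ} (π : Fin d → FinPerm) : FinPerm :=
  ⟨∑ j, (π j).1, finSigmaFinEquiv.permCongr (Equiv.sigmaCongrRight fun j => (π j).2)⟩

/-- A pattern with exactly `d` blocks, given by its sequence of blocks. -/
abbrev BlockPattern (d : ℕ) : Type := Fin d → Block

/-- The permutation `π₁ ⊕ ⋯ ⊕ π_d`. -/
def BlockPattern.toPerm {d : ℕ} (π : BlockPattern d) : FinPerm :=
  directSum fun j => (π j).1

/-! ### The infinite Mallows permutation -/

/-- The σ-algebra on the permutations of `ℕ` that is generated by the evaluations. -/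
instance permNatMeasurableSpace : MeasurableSpace (Equiv.Perm ℕ) :=
  MeasurableSpace.comap (fun σ => (σ : ℕ → ℕ)) inferInstance

/-- Right-inversion counts of a permutation of `ℕ`. -/
def rightInversionCount (σ : Equiv.Perm ℕ) (i : ℕ) : ℕ :=
  {j : ℕ | i < j ∧ σ j < σ i}.ncard

/-- The insertion procedure: `insertion r k` is the `(r k + 1)`-st lowest natural number that
is not among `insertion r 0, …, insertion r (k - 1)`. -/
def insertion (r : ℕ → ℕ) (k : ℕ) : ℕ :=
  Nat.nth (fun m => ∀ j : Fin k, insertion r j ≠ m) (r k)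
termination_by k
decreasing_by exact j.2

open Classical in
/-- The permutation of `ℕ` with right-inversion counts `r` (see
`rightInversionCount_permOfCounts`); it exists as soon as infinitely many of the counts are
zero (see `insertion_bijective`). For other sequences `r`, which form a null set for the law of
interest, the value is irrelevant. -/
def permOfCounts (r : ℕ → ℕ) : Equiv.Perm ℕ :=
  if h : Function.Bijective (insertion r) then Equiv.ofBijective (insertion r) h else 1

theorem insertion_free_infinite (r : ℕ → ℕ) (k : ℕ) :
    (Set.ofPred fun m => ∀ j : Fin k, insertion r j ≠ m).Infinite := by
  have : (Set.range fun j : Fin k => insertion r j).Finite := Set.finite_range _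
  refine this.infinite_compl.mono fun m hm => ?_
  intro j hj
  exact hm ⟨j, hj⟩

theorem insertion_ne (r : ℕ → ℕ) {j k : ℕ} (h : j < k) : insertion r j ≠ insertion r k := by
  have := Nat.nth_mem_of_infinite (insertion_free_infinite r k) (r k)
  rw [← insertion.eq_1 r k] at this
  exact this ⟨j, h⟩

theorem insertion_injective (r : ℕ → ℕ) : Function.Injective (insertion r) := by
  intro j k h
  rcases lt_trichotomy j k with hjk | hjk | hjk
  · exact absurd h (insertion_ne r hjk)
  · exact hjk
  · exact absurd h.symm (insertion_ne r hjk)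

/-- If infinitely many counts are zero, then the insertion procedure builds a permutation. -/
theorem insertion_bijective (r : ℕ → ℕ) (hr : ∃ᶠ i in atTop, r i = 0) :
    Function.Bijective (insertion r) := by
  refine ⟨insertion_injective r, fun m => ?_⟩
  induction m using Nat.strong_induction_on with
  | _ m ih =>
    choose! g hg using ih
    obtain ⟨k, hk0, hk⟩ := (hr.and_eventually
      (eventually_gt_atTop ((Finset.range m).sup g))).exists
    by_cases hm : ∃ j < k, insertion r j = m
    · exact hm.imp fun j h => h.2
    · refine ⟨k, ?_⟩
      rw [insertion.eq_1, hk0]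
      push Not at hm
      refine le_antisymm ?_ ?_
      · rw [Nat.nth_zero]
        exact Nat.sInf_le fun j => hm j j.2
      · by_contra! hlt
        have h1 := Nat.nth_mem_of_infinite (insertion_free_infinite r k) 0
        have h2 : g (Nat.nth (fun m => ∀ j : Fin k, insertion r j ≠ m) 0) < k :=
          lt_of_le_of_lt (Finset.le_sup (f := g) (Finset.mem_range.2 hlt)) hk
        exact h1 ⟨_, h2⟩ (hg _ hlt)

/-- `permOfCounts r` has right-inversion counts `r`. -/
theorem rightInversionCount_permOfCounts (r : ℕ → ℕ) (h : Function.Bijective (insertion r))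
    (i : ℕ) : rightInversionCount (permOfCounts r) i = r i := by
  classical
  have hinf := insertion_free_infinite r i
  have hcount := Nat.count_nth_of_infinite hinf (r i)
  rw [← insertion.eq_1 r i, Nat.count_eq_card_filter_range] at hcount
  rw [rightInversionCount, permOfCounts, dif_pos h, ← hcount,
    ← Set.ncard_image_of_injective _ h.1, ← Set.ncard_coe_finset]
  congr 1
  ext m
  simp only [Equiv.ofBijective_apply, Set.mem_image, Set.mem_ofPred_eq, Finset.coe_filter,
    Finset.mem_range]
  constructor
  · rintro ⟨j, ⟨hij, hlt⟩, rfl⟩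
    exact ⟨hlt, fun l => insertion_ne r (l.2.trans hij)⟩
  · rintro ⟨hlt, hm⟩
    obtain ⟨j, rfl⟩ := h.2 m
    refine ⟨j, ⟨?_, hlt⟩, rfl⟩
    rcases lt_trichotomy i j with hij | hij | hij
    · exact hij
    · subst hij; exact absurd hlt (lt_irrefl _)
    · exact absurd rfl (hm ⟨j, hij⟩)

theorem measurable_insertion (k : ℕ) : Measurable fun r : ℕ → ℕ => insertion r k := by
  induction k using Nat.strong_induction_on with
  | _ k ih =>
    have h1 : Measurable fun r : ℕ → ℕ => ((fun j : Fin k => insertion r j), r k) :=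
      (measurable_pi_lambda _ fun j : Fin k => ih j j.2).prodMk (measurable_pi_apply k)
    have h2 : Measurable fun p : (Fin k → ℕ) × ℕ =>
        Nat.nth (fun m => ∀ j : Fin k, p.1 j ≠ m) p.2 := .of_discrete
    have h3 := h2.comp h1
    convert h3 using 2 with r
    rw [insertion.eq_1]; rfl

theorem measurable_permOfCounts : Measurable permOfCounts := by
  have hset : MeasurableSet {r : ℕ → ℕ | Function.Bijective (insertion r)} := by
    have : {r : ℕ → ℕ | Function.Bijective (insertion r)} =
        ⋂ m : ℕ, ⋃ k : ℕ, {r | insertion r k = m} := by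
      ext r
      simp only [Set.mem_ofPred_eq, Set.mem_iInter, Set.mem_iUnion]
      exact ⟨fun h => h.2, fun h => ⟨insertion_injective r, h⟩⟩
    rw [this]
    exact .iInter fun m => .iUnion fun k => measurable_insertion k (measurableSet_singleton m)
  rw [measurable_comap_iff]
  refine measurable_pi_lambda _ fun k => ?_
  classical
  have : (fun r => ((fun σ : Equiv.Perm ℕ => (σ : ℕ → ℕ)) ∘ permOfCounts) r k) =
      fun r => if Function.Bijective (insertion r) then insertion r k else k := by
    funext r
    by_cases h : Function.Bijective (insertion r) <;> simp [permOfCounts, h]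
  rw [this]
  exact Measurable.ite hset (measurable_insertion k) measurable_const

/-- The law of the infinite Mallows permutation with parameter `q`: the random permutation of
`ℕ` whose right-inversion counts are independent, with `P(count = k) = (1 - q) * q ^ k` for
every natural number `k`. -/
def mallowsInfinite (q : unitInterval) : Measure (Equiv.Perm ℕ) :=
  (Measure.infinitePi fun _ : ℕ => geometricMeasure (unitInterval.symm q)).map permOfCounts

/-- The size of the first block `B₁` in `σ = B₁ ⊕ B₂ ⊕ ⋯`: the least `m ≥ 1` such that `σ` maps
`{0, …, m - 1}` to itself. -/
def firstBlockSize (σ : Equiv.Perm ℕ) : ℕ :=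
  sInf {m : ℕ | 0 < m ∧ ∀ i < m, σ i < m}

/-- The first block `B₁` in `σ = B₁ ⊕ B₂ ⊕ ⋯`. -/
def firstBlock (σ : Equiv.Perm ℕ) : FinPerm :=
  pat (Finset.range (firstBlockSize σ)) σ

theorem measurable_perm_apply (i : ℕ) : Measurable fun σ : Equiv.Perm ℕ => σ i :=
  (measurable_pi_apply i).comp (comap_measurable _)

theorem measurable_pat (I : Finset ℕ) : Measurable fun σ : Equiv.Perm ℕ => pat I σ := by
  have h1 : Measurable fun σ : Equiv.Perm ℕ =>
      fun k : Fin I.card => σ (I.orderEmbOfFin rfl k) :=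
    measurable_pi_lambda _ fun k => measurable_perm_apply _
  have h2 : Measurable fun f : Fin I.card → ℕ =>
      (⟨I.card, (Tuple.sort f).symm⟩ : FinPerm) := .of_discrete
  exact h2.comp h1

theorem measurable_firstBlockSize : Measurable firstBlockSize := by
  have hP : ∀ m : ℕ, MeasurableSet {σ : Equiv.Perm ℕ | 0 < m ∧ ∀ i < m, σ i < m} := by
    intro m
    refine (MeasurableSet.const _).inter ?_
    have : {σ : Equiv.Perm ℕ | ∀ i < m, σ i < m} =
        ⋂ i : Fin m, (fun σ : Equiv.Perm ℕ => σ i) ⁻¹' Set.Iio m := by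
      ext σ
      simp only [Set.mem_ofPred_eq, Set.mem_iInter, Set.mem_preimage, Set.mem_Iio]
      exact ⟨fun h i => h i i.2, fun h i hi => h ⟨i, hi⟩⟩
    change MeasurableSet {σ : Equiv.Perm ℕ | ∀ i < m, σ i < m}
    rw [this]
    exact .iInter fun i => measurable_perm_apply _ measurableSet_Iio
  have hI : ∀ m : ℕ, MeasurableSet {σ : Equiv.Perm ℕ | firstBlockSize σ ≤ m} := by
    intro m
    have : {σ : Equiv.Perm ℕ | firstBlockSize σ ≤ m} =
        (⋃ k : Fin (m + 1), {σ : Equiv.Perm ℕ | 0 < (k : ℕ) ∧ ∀ i < (k : ℕ), σ i < (k : ℕ)}) ∪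
          ⋂ k : ℕ, {σ : Equiv.Perm ℕ | 0 < k ∧ ∀ i < k, σ i < k}ᶜ := by
      ext σ
      simp only [Set.mem_union, Set.mem_iUnion, Set.mem_iInter, Set.mem_compl_iff,
        Set.mem_ofPred_eq]
      constructor
      · intro h
        by_cases hne : {m : ℕ | 0 < m ∧ ∀ i < m, σ i < m}.Nonempty
        · exact Or.inl ⟨⟨firstBlockSize σ, Nat.lt_succ_of_le h⟩, Nat.sInf_mem hne⟩
        · exact Or.inr fun k hk => hne ⟨k, hk⟩
      · rintro (⟨k, hk⟩ | h)
        · exact (Nat.sInf_le hk).trans (Nat.lt_succ_iff.1 k.2)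
        · have : {m : ℕ | 0 < m ∧ ∀ i < m, σ i < m} = ∅ :=
            Set.eq_empty_of_forall_notMem fun k hk => h k hk
          rw [firstBlockSize, this, Nat.sInf_empty]
          exact Nat.zero_le _
    rw [this]
    exact (MeasurableSet.iUnion fun k : Fin (m + 1) => hP k).union (.iInter fun k => (hP k).compl)
  exact measurable_of_Iic hI

theorem measurable_firstBlock : Measurable firstBlock := by
  refine measurable_to_countable' fun β => ?_
  have : firstBlock ⁻¹' {β} = ⋃ m : ℕ, (firstBlockSize ⁻¹' {m}) ∩
      ((fun σ => pat (Finset.range m) σ) ⁻¹' {β}) := by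
    ext σ
    simp [firstBlock]
  rw [this]
  exact .iUnion fun m => (measurable_firstBlockSize (measurableSet_singleton m)).inter
    (measurable_pat _ (measurableSet_singleton β))

/-- The law of a Mallows block `B` with parameter `q`: the law of the first block of the
infinite Mallows permutation. -/
def mallowsBlock (q : unitInterval) : Measure FinPerm :=
  (mallowsInfinite q).map firstBlock

/-! ### The constants -/

/-- `E|B|`. -/
def meanSize (q : unitInterval) : ℝ := ∫ B, (B.1 : ℝ) ∂(mallowsBlock q)

/-- `E[occ_π(B)]`. -/
def meanOcc (q : unitInterval) (π : FinPerm) : ℝ := ∫ B, (occ π B : ℝ) ∂(mallowsBlock q)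

/-- `e_{π,q} = ∏_j E[occ_{π_j}(B)] / E|B|`. -/
def eConst (q : unitInterval) {d : ℕ} (π : BlockPattern d) : ℝ :=
  ∏ j, meanOcc q (π j).1 / meanSize q

/-- The infinite matrix `Γ^{(d)}`, indexed by the patterns with `d` blocks. The blocks are
numbered from `0`, so `i` and `j` stand for `i - 1` and `j - 1` in the usual numbering. -/
def Gam (q : unitInterval) (d : ℕ) : Matrix (BlockPattern d) (BlockPattern d) ℝ := fun π ρ =>
  meanSize q * eConst q π * eConst q ρ *
    (1 / ((2 * d - 1).factorial : ℝ) *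
        (∑ i : Fin d, ∑ j : Fin d,
          (((i : ℕ) + j).choose i : ℝ) * ((2 * d - 2 - i - j).choose (d - 1 - i) : ℝ) *
            (cov[fun B : FinPerm => (occ (π j).1 B : ℝ), fun B : FinPerm => (occ (ρ i).1 B : ℝ);
                mallowsBlock q] /
              (meanOcc q (π j).1 * meanOcc q (ρ i).1)))
      - 1 / (((d - 1).factorial : ℝ) * (d.factorial : ℝ)) *
        (∑ i : Fin d,
          (cov[fun B : FinPerm => (B.1 : ℝ), fun B : FinPerm => (occ (ρ i).1 B : ℝ);
                mallowsBlock q] / (meanSize q * meanOcc q (ρ i).1)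
            + cov[fun B : FinPerm => (B.1 : ℝ), fun B : FinPerm => (occ (π i).1 B : ℝ);
                mallowsBlock q] / (meanSize q * meanOcc q (π i).1)))
      + 1 / ((d - 1).factorial : ℝ) ^ 2 *
        (Var[fun B : FinPerm => (B.1 : ℝ); mallowsBlock q] / meanSize q ^ 2))

/-- The normalized fluctuation
`(occ_π(τ) - binom(n,d) e_{π,q}) / n^(d - 1/2)` for `τ` of size `n`. -/
def fluct (q : unitInterval) {d : ℕ} (n : ℕ) (τ : FinPerm) (π : BlockPattern d) : ℝ :=
  ((occ π.toPerm τ : ℝ) - (n.choose d : ℝ) * eConst q π) / (n : ℝ) ^ ((d : ℝ) - 1 / 2)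

end

noncomputable section

/-! ### Patterns on subsets -/

/-! Renewal structure. The right-inversion counts `r` are independent, and `n` is a cut of the
permutation exactly when `i + r i < n` for all `i < n` (`isCut_iff`). Beyond a cut the permutation
is rebuilt from the shifted counts, so cuts are renewal times and the successive blocks are i.i.d.
copies of `B` (`map_blockSeq`). Decomposing according to the last cut gives a renewal recursion for
the probability of having no cut in `(0, n]`, which therefore decays geometrically
(`exists_geometric_tail`). Hence `|B|` and all `occ β B` have moments of every order.

Combinatorics. An occurrence of a block cannot straddle a cut (`IsCut.block_side`). An occurrence of
`π₁ ⊕ ⋯ ⊕ π_d` therefore selects blocks of the permutation with indices `i₁ ≤ ⋯ ≤ i_d` and an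
occurrence of `π_j` in the `i_j`-th of them; conversely, strictly increasing indices always produce
an occurrence. So the pattern count lies between a strict and a weak iterated sum of i.i.d. terms
(`GoodCounts.occ_bounds`). Their difference is of lower order, because a coincidence of indices
costs one summation.

Size of the fluctuations. All errors are controlled in every `L^p` at once (`LpBigO`). Square-root
cancellation comes from `lpBigO_martingale`, an elementary Burkholder-type bound. Let `N` be the
number of complete blocks before position `n`. Subtracting from the last factor the multiple of
`|B|` that makes its mean vanish turns the sum over `N` blocks into a martingale plus a sum over
positions (`centredSum_succ`); by induction on the number of blocks of the pattern, the fluctuations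
have order `n^(d - 1/2)` in every `L^p`. Fourth moments are then summable after division by `n^d`,
which is the law of large numbers.

Limit law. The strict sum is replaced by its linear part, the sum of its projections onto single
blocks; this error is smaller by half a power (`lpBigO_devSum_sub_linSum`). The random index `N` is
replaced by the integer part of `n / E|B|`, where `N - n / E|B|` is itself linear in the block sizes
up to a small error. All errors together are smaller than the normalization by a factor `n^(-1/8)`
(`lpBigO_centredSum_sub_linApprox`). What remains is a sum of independent centred variables with
deterministic coefficients, whose characteristic function converges (`tendsto_integral_cexp_sum`);
sums of products of binomial coefficients identify the limiting covariance with `Gam`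
(`Gam_eq_sum`). The quadratic form of `Gam` is a limit of sums of variances, hence nonnegative.
Finally, the `L^p` bounds upgrade weak convergence to convergence of moments
(`tendsto_integral_of_sq_bounded`). -/

theorem perm_ext_of_lt_iff {n : ℕ} {s t : Equiv.Perm (Fin n)}
    (h : ∀ k l, s k < s l ↔ t k < t l) : s = t := by
  have hmono : StrictMono (t ∘ s.symm) := fun a b hab => by
    simpa using (h (s.symm a) (s.symm b)).1 (by simpa using hab)
  -- `t ∘ s⁻¹` is an order automorphism of a finite linear order, and the identity is the only one.
  have hid : (OrderIso.refl (Fin n) : Fin n → Fin n) =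
      (StrictMono.orderIsoOfSurjective _ hmono (t.surjective.comp s.symm.surjective)) := by
    rw [Subsingleton.elim (OrderIso.refl (Fin n))
      (StrictMono.orderIsoOfSurjective _ hmono (t.surjective.comp s.symm.surjective))]
  ext k
  have := congrFun hid (s k)
  simp at this
  rw [this]

/-- This trades the sorting permutation in the definition of `pat` for an increasing enumeration of
`I`. Later pattern identities are proved by composing or gluing such enumerations. -/
theorem pat_eq_mk_iff {α : Type*} [LinearOrder α] (I : Finset α) (σ : Equiv.Perm α)
    {n : ℕ} (s : Equiv.Perm (Fin n)) :
    pat I σ = ⟨n, s⟩ ↔ ∃ f : Fin n ↪o α, Finset.univ.map f.toEmbedding = I ∧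
      ∀ k l, s k < s l ↔ σ (f k) < σ (f l) := by
  constructor
  · intro h
    have hc : I.card = n := congrArg Sigma.fst h
    subst hc
    have hs : (pat I σ).2 = s := eq_of_heq (Sigma.ext_iff.1 h).2
    exact ⟨I.orderEmbOfFin rfl, Finset.map_orderEmbOfFin_univ I rfl, fun k l => by
      rw [← hs]; exact pat_lt_iff I σ k l⟩
  · rintro ⟨f, hf, hs⟩
    have hc : I.card = n := by rw [← hf]; simp
    subst hc
    have hfe : f = I.orderEmbOfFin rfl :=
      Finset.orderEmbOfFin_unique' rfl fun x => by
        have : f x ∈ Finset.univ.map f.toEmbedding := by simp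
        rwa [hf] at this
    refine Sigma.ext rfl (heq_of_eq (perm_ext_of_lt_iff fun k l => ?_))
    refine (pat_lt_iff I σ k l).trans ?_
    rw [← hfe]
    exact (hs k l).symm

theorem pat_eq_iff {α : Type*} [LinearOrder α] (I : Finset α) (σ : Equiv.Perm α)
    (ρ : FinPerm) :
    pat I σ = ρ ↔ ∃ f : Fin ρ.1 ↪o α, Finset.univ.map f.toEmbedding = I ∧
      ∀ k l, ρ.2 k < ρ.2 l ↔ σ (f k) < σ (f l) :=
  pat_eq_mk_iff I σ ρ.2

theorem card_of_pat_eq {α : Type*} [LinearOrder α] {I : Finset α} {σ : Equiv.Perm α}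
    {ρ : FinPerm} (h : pat I σ = ρ) : I.card = ρ.1 := by rw [← h]; rfl

theorem pat_pat {α : Type*} [LinearOrder α] (I : Finset α) (σ : Equiv.Perm α)
    (K : Finset (Fin I.card)) :
    pat (α := Fin I.card) K (pat I σ).2 = pat (K.map (I.orderEmbOfFin rfl).toEmbedding) σ := by
  symm
  obtain ⟨f, hf, hs⟩ := (pat_eq_iff (α := Fin I.card) K (pat I σ).2 _).1 rfl
  refine (pat_eq_iff _ _ _).2 ⟨f.trans (I.orderEmbOfFin rfl), ?_, fun k l => ?_⟩
  · conv_rhs => rw [← hf]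
    rw [Finset.map_map]; rfl
  · exact (hs k l).trans (pat_lt_iff I σ _ _)

/-- The number of subsets of `I` on which `σ` induces the pattern `π`. -/
def occOn {α : Type*} [LinearOrder α] (π : FinPerm) (I : Finset α) (σ : Equiv.Perm α) : ℕ :=
  (I.powerset.filter fun J => pat J σ = π).card

/-- The increasing enumeration of `I` matches sets of indices with subsets of `I`, so all counting
can take place inside one ambient permutation. -/
theorem occ_pat {α : Type*} [LinearOrder α] (π : FinPerm) (I : Finset α) (σ : Equiv.Perm α) :
    occ π (pat I σ) = occOn π I σ := by
  unfold occ occOn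
  refine Finset.card_bij (fun (K : Finset (Fin I.card)) _ => K.map (I.orderEmbOfFin rfl).toEmbedding)
    ?_ ?_ ?_
  · intro K hK
    have hK' : pat (α := Fin I.card) K (pat I σ).2 = π := (Finset.mem_filter.1 hK).2
    refine Finset.mem_filter.2 ⟨Finset.mem_powerset.2 fun x hx => ?_, (pat_pat I σ K).symm.trans hK'⟩
    obtain ⟨k, -, rfl⟩ := Finset.mem_map.1 hx
    exact Finset.orderEmbOfFin_mem I rfl k
  · intro K _ L _ h
    exact Finset.map_injective _ h
  · intro J hJ
    simp only [Finset.mem_filter, Finset.mem_powerset] at hJ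
    have hJI : J = (Finset.univ.filter fun k : Fin I.card => I.orderEmbOfFin rfl k ∈ J).map
        (I.orderEmbOfFin rfl).toEmbedding := by
      ext x
      simp only [Finset.mem_map, Finset.mem_filter, Finset.mem_univ, true_and]
      constructor
      · intro hx
        have := hJ.1 hx
        rw [← Finset.map_orderEmbOfFin_univ I rfl] at this
        obtain ⟨k, -, rfl⟩ := Finset.mem_map.1 this
        exact ⟨k, hx, rfl⟩
      · rintro ⟨k, hk, rfl⟩; exact hk
    refine ⟨_, Finset.mem_filter.2 ⟨Finset.mem_univ _, ?_⟩, hJI.symm⟩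
    exact (pat_pat I σ _).trans (by rw [← hJI]; exact hJ.2)

theorem occOn_mono {α : Type*} [LinearOrder α] (π : FinPerm) {I J : Finset α} (h : I ⊆ J)
    (σ : Equiv.Perm α) : occOn π I σ ≤ occOn π J σ :=
  Finset.card_le_card (Finset.filter_subset_filter _ (Finset.powerset_mono.2 h))

/-! ### Binary direct sums -/

/-- The direct sum of two permutations. -/
def addPerm {a b : ℕ} (s : Equiv.Perm (Fin a)) (t : Equiv.Perm (Fin b)) :
    Equiv.Perm (Fin (a + b)) :=
  finSumFinEquiv.permCongr (Equiv.sumCongr s t)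

theorem addPerm_castAdd {a b : ℕ} (s : Equiv.Perm (Fin a)) (t : Equiv.Perm (Fin b)) (k : Fin a) :
    addPerm s t (Fin.castAdd b k) = Fin.castAdd b (s k) := by
  simp [addPerm, Equiv.permCongr_apply]

theorem addPerm_natAdd {a b : ℕ} (s : Equiv.Perm (Fin a)) (t : Equiv.Perm (Fin b)) (k : Fin b) :
    addPerm s t (Fin.natAdd a k) = Fin.natAdd a (t k) := by
  simp [addPerm, Equiv.permCongr_apply]

/-- The direct sum of two finite permutations. -/
def FinPerm.add (ρ β : FinPerm) : FinPerm := ⟨ρ.1 + β.1, addPerm ρ.2 β.2⟩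

theorem finPerm_mk_ext {m n : ℕ} {s : Equiv.Perm (Fin m)} {t : Equiv.Perm (Fin n)} (h : m = n)
    (hv : ∀ k : Fin m, (s k : ℕ) = t (Fin.cast h k)) : (⟨m, s⟩ : FinPerm) = ⟨n, t⟩ := by
  subst h
  refine Sigma.ext rfl (heq_of_eq ?_)
  ext k
  exact hv k

/-- The last block is split off because `strictSum` and `weakSum` are defined by the same recursion;
concatenation on dependent sums then reduces to binary concatenation. -/
theorem directSum_succ {d : ℕ} (π : Fin (d + 1) → FinPerm) :
    directSum π = (directSum (Fin.init π)).add (π (Fin.last d)) := by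
  have hsz : ∑ j, (π j).1 = ∑ j : Fin d, (Fin.init π j).1 + (π (Fin.last d)).1 :=
    Fin.sum_univ_castSucc _
  refine finPerm_mk_ext hsz fun k => ?_
  obtain ⟨⟨j, x⟩, rfl⟩ := (finSigmaFinEquiv (n := fun i => (π i).1)).surjective k
  simp only [Equiv.permCongr_apply, Equiv.symm_apply_apply, Equiv.sigmaCongrRight_apply]
  induction j using Fin.lastCases with
  | last =>
    have : Fin.cast hsz (finSigmaFinEquiv ⟨Fin.last d, x⟩) = Fin.natAdd _ x := by
      apply Fin.ext
      simp only [Fin.val_cast, Fin.val_natAdd]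
      rw [finSigmaFinEquiv_apply]
      rfl
    refine Eq.trans ?_ (congrArg
      (fun z => (addPerm (directSum (Fin.init π)).2 (π (Fin.last d)).2 z : ℕ)) this).symm
    refine Eq.trans ?_ (congrArg Fin.val (addPerm_natAdd (directSum (Fin.init π)).2
      (π (Fin.last d)).2 x).symm)
    rw [finSigmaFinEquiv_apply]
    rfl
  | cast j =>
    have : Fin.cast hsz (finSigmaFinEquiv ⟨j.castSucc, x⟩) =
        Fin.castAdd _ (finSigmaFinEquiv (n := fun i => (Fin.init π i).1) ⟨j, x⟩) := by
      apply Fin.ext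
      simp only [Fin.val_cast, Fin.val_castAdd]
      rw [finSigmaFinEquiv_apply, finSigmaFinEquiv_apply]
      rfl
    refine Eq.trans ?_ (congrArg
      (fun z => (addPerm (directSum (Fin.init π)).2 (π (Fin.last d)).2 z : ℕ)) this).symm
    refine Eq.trans ?_ (congrArg Fin.val (addPerm_castAdd (directSum (Fin.init π)).2
      (π (Fin.last d)).2 _).symm)
    have h4 : (finSigmaFinEquiv.permCongr
        (Equiv.sigmaCongrRight fun j : Fin d => (Fin.init π j).2)) (finSigmaFinEquiv ⟨j, x⟩) =
        finSigmaFinEquiv ⟨j, (Fin.init π j).2 x⟩ := by simp [Equiv.permCongr_apply]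
    refine Eq.trans ?_ (congrArg Fin.val h4).symm
    rw [finSigmaFinEquiv_apply, finSigmaFinEquiv_apply]
    rfl

/-- `I` lies to the left of and below `J` in the diagram of `σ`. -/
def Precedes {α : Type*} [LinearOrder α] (σ : Equiv.Perm α) (I J : Finset α) : Prop :=
  ∀ i ∈ I, ∀ j ∈ J, i < j ∧ σ i < σ j

/-- Since `I` precedes `J` in position and in value, appending the two enumerations gives an
increasing enumeration of the union, and the values compare as in a direct sum. -/
theorem pat_union {α : Type*} [LinearOrder α] {σ : Equiv.Perm α} {I J : Finset α}
    {ρ β : FinPerm} (hI : pat I σ = ρ) (hJ : pat J σ = β) (h : Precedes σ I J) :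
    pat (I ∪ J) σ = ρ.add β := by
  obtain ⟨a, s⟩ := ρ
  obtain ⟨b, t⟩ := β
  obtain ⟨f, rfl, hfs⟩ := (pat_eq_mk_iff _ _ _).1 hI
  obtain ⟨g, rfl, hgs⟩ := (pat_eq_mk_iff _ _ _).1 hJ
  have h' : ∀ k l, f k < g l ∧ σ (f k) < σ (g l) := fun k l => h _ (by simp) _ (by simp)
  have hmono : StrictMono (Fin.append f g) := by
    intro x y hab
    induction x using Fin.addCases with
    | left x =>
      induction y using Fin.addCases with
      | left y => simpa using (show x < y from hab)
      | right y => simpa using (h' x y).1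
    | right x =>
      induction y using Fin.addCases with
      | left y => exfalso; simp [Fin.lt_def] at hab; omega
      | right y => simpa using (Fin.natAdd_lt_natAdd_iff a).1 hab
  refine (pat_eq_mk_iff _ _ (addPerm s t)).2 ⟨OrderEmbedding.ofStrictMono _ hmono, ?_, fun k l => ?_⟩
  · ext x
    simp only [Finset.mem_map, Finset.mem_univ, true_and, Finset.mem_union]
    constructor
    · rintro ⟨k, rfl⟩
      induction k using Fin.addCases with
      | left k => exact Or.inl ⟨k, by simp⟩
      | right k => exact Or.inr ⟨k, by simp⟩
    · rintro (⟨k, rfl⟩ | ⟨k, rfl⟩)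
      · exact ⟨Fin.castAdd _ k, by simp⟩
      · exact ⟨Fin.natAdd _ k, by simp⟩
  · simp only [OrderEmbedding.coe_ofStrictMono]
    induction k using Fin.addCases with
    | left k =>
      induction l using Fin.addCases with
      | left l =>
        rw [addPerm_castAdd, addPerm_castAdd, Fin.append_left, Fin.append_left, ← hfs]
        exact Iff.rfl
      | right l =>
        rw [addPerm_castAdd, addPerm_natAdd, Fin.append_left, Fin.append_right]
        exact iff_of_true (Fin.lt_def.2 (by simp; omega)) (h' k l).2
    | right k =>
      induction l using Fin.addCases with
      | left l =>
        rw [addPerm_castAdd, addPerm_natAdd, Fin.append_left, Fin.append_right]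
        exact iff_of_false (by simp [Fin.lt_def]; omega) (not_lt.2 (h' l k).2.le)
      | right l =>
        rw [addPerm_natAdd, addPerm_natAdd, Fin.append_right, Fin.append_right, ← hgs]
        exact Fin.natAdd_lt_natAdd_iff a

theorem exists_of_pat_eq_add {α : Type*} [LinearOrder α] {σ : Equiv.Perm α} {K : Finset α}
    {ρ β : FinPerm} (hK : pat K σ = ρ.add β) :
    ∃ I J, K = I ∪ J ∧ pat I σ = ρ ∧ pat J σ = β ∧ Precedes σ I J := by
  obtain ⟨a, s⟩ := ρ
  obtain ⟨b, t⟩ := β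
  obtain ⟨f, rfl, hs⟩ := (pat_eq_mk_iff _ _ (addPerm s t)).1 hK
  refine ⟨Finset.univ.map ((Fin.castAddOrderEmb b).trans f).toEmbedding,
    Finset.univ.map ((Fin.natAddOrderEmb a).trans f).toEmbedding, ?_,
    (pat_eq_mk_iff _ _ _).2 ⟨_, rfl, fun k l => ?_⟩,
    (pat_eq_mk_iff _ _ _).2 ⟨_, rfl, fun k l => ?_⟩, ?_⟩
  · ext x
    simp only [Finset.mem_map, Finset.mem_univ, true_and, Finset.mem_union]
    constructor
    · rintro ⟨k, rfl⟩
      induction k using Fin.addCases with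
      | left k => exact Or.inl ⟨k, rfl⟩
      | right k => exact Or.inr ⟨k, rfl⟩
    · rintro (⟨k, rfl⟩ | ⟨k, rfl⟩)
      exacts [⟨_, rfl⟩, ⟨_, rfl⟩]
  · have := hs (Fin.castAdd b k) (Fin.castAdd b l)
    rw [addPerm_castAdd, addPerm_castAdd] at this
    exact this
  · have := hs (Fin.natAdd a k) (Fin.natAdd a l)
    rw [addPerm_natAdd, addPerm_natAdd, Fin.natAdd_lt_natAdd_iff] at this
    exact this
  · intro i hi j hj
    obtain ⟨k, -, rfl⟩ := Finset.mem_map.1 hi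
    obtain ⟨l, -, rfl⟩ := Finset.mem_map.1 hj
    have h0 : ∀ (x : Fin a) (y : Fin b), Fin.castAdd b x < Fin.natAdd a y := fun x y => by
      simp [Fin.lt_def]; omega
    refine ⟨f.lt_iff_lt.2 (h0 k l), ?_⟩
    have := hs (Fin.castAdd b k) (Fin.natAdd a l)
    rw [addPerm_castAdd, addPerm_natAdd] at this
    exact this.1 (h0 _ _)

/-! ### Cuts -/

/-- `c` is a cut of `σ` if `σ` maps `{0, …, c - 1}` to itself. -/
def IsCut (σ : Equiv.Perm ℕ) (c : ℕ) : Prop := ∀ i < c, σ i < c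

/-- An injective self-map of the finite set of positions below `c` is onto, so no later position can
take a value below `c`. -/
theorem IsCut.lt_iff {σ : Equiv.Perm ℕ} {c : ℕ} (h : IsCut σ c) (i : ℕ) : σ i < c ↔ i < c := by
  refine ⟨fun hi => ?_, h i⟩
  have hinj : Set.InjOn σ (Finset.range c) := σ.injective.injOn
  have hmaps : Set.MapsTo σ (Finset.range c) (Finset.range c) := fun x hx => by
    simpa using h x (by simpa using hx)
  have := Finset.surjOn_of_injOn_of_card_le σ hmaps hinj le_rfl
  obtain ⟨j, hj, hji⟩ := this (by simpa using hi : σ i ∈ (Finset.range c : Set ℕ))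
  rw [← σ.injective hji]
  simpa using hj

theorem IsCut.precedes {σ : Equiv.Perm ℕ} {c : ℕ} (h : IsCut σ c) {I J : Finset ℕ}
    (hI : ∀ i ∈ I, i < c) (hJ : ∀ j ∈ J, c ≤ j) : Precedes σ I J := fun i hi j hj =>
  ⟨(hI i hi).trans_le (hJ j hj), (h i (hI i hi)).trans_le
    (not_lt.1 fun hlt => absurd ((h.lt_iff j).1 hlt) (not_lt.2 (hJ j hj)))⟩

/-- If `J` had points on both sides of the cut, the indices of its points before `c` would form a
proper non-empty initial segment. Their values are also the smallest ones, because `σ` preserves the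
cut; `β` would then preserve this segment, against indecomposability. -/
theorem IsCut.block_side {σ : Equiv.Perm ℕ} {c : ℕ} (h : IsCut σ c) {J : Finset ℕ}
    {β : FinPerm} (hβ : IsBlock β) (hJ : pat J σ = β) :
    (∀ j ∈ J, j < c) ∨ ∀ j ∈ J, c ≤ j := by
  obtain ⟨f, rfl, hs⟩ := (pat_eq_iff _ _ _).1 hJ
  set A : Finset (Fin β.1) := Finset.univ.filter fun x => f x < c with hA
  by_contra! hcon
  obtain ⟨⟨j1, hj1, hj1c⟩, ⟨j2, hj2, hj2c⟩⟩ := hcon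
  obtain ⟨x1, -, rfl⟩ := Finset.mem_map.1 hj1
  obtain ⟨x2, -, rfl⟩ := Finset.mem_map.1 hj2
  have hx2 : x2 ∈ A := by simpa [hA] using hj2c
  have hx1 : x1 ∉ A := by simpa [hA] using hj1c
  have h0 : 0 < A.card := Finset.card_pos.2 ⟨x2, hx2⟩
  have hlt : A.card < β.1 := by
    have := Finset.card_lt_card (Finset.ssubset_univ_iff.2
      fun e : A = Finset.univ => hx1 (by rw [e]; exact Finset.mem_univ x1))
    simpa using this
  have hlow : ∀ x y : Fin β.1, y ∈ A → x < y → x ∈ A := by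
    intro x y hy hxy
    simp only [hA, Finset.mem_filter, Finset.mem_univ, true_and] at hy ⊢
    exact (f.lt_iff_lt.2 hxy).trans hy
  refine hβ.2 _ h0 hlt fun i hi => ?_
  have hiA : i ∈ A := by
    by_contra hiA
    have hsub : A ⊆ Finset.Iio i := fun y hy => by
      rw [Finset.mem_Iio]
      by_contra hle
      rcases (not_lt.1 hle).lt_or_eq with hl | hl
      · exact hiA (hlow _ _ hy hl)
      · exact hiA (hl ▸ hy)
    have := Finset.card_le_card hsub
    simp at this
    omega
  -- Every index whose value is at most `β i` lies in `A`. Counting them gives `β i + 1 ≤ |A|`.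
  have hsub : (Finset.Iic (β.2 i)).map β.2.symm.toEmbedding ⊆ A := by
    intro y hy
    obtain ⟨v, hv, rfl⟩ := Finset.mem_map.1 hy
    simp only [Finset.mem_Iic] at hv
    simp only [hA, Finset.mem_filter, Finset.mem_univ, true_and] at hiA ⊢
    rcases hv.lt_or_eq with hl | rfl
    · have h1 := (hs (β.2.symm v) i).1 (by simpa using hl)
      exact (h.lt_iff _).1 (h1.trans (h _ hiA))
    · simpa using hiA
  have := Finset.card_le_card hsub
  simp at this
  omega

/-- A point `x` of `I` outside `I'` would lie in `J'`, hence to the right of all of `I'`; then `I'`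
would be contained in `I` without `x`, which is too small. -/
theorem union_injective {σ : Equiv.Perm ℕ} {I I' J J' : Finset ℕ} (hc : I.card = I'.card)
    (h : Precedes σ I J) (h' : Precedes σ I' J') (hu : I ∪ J = I' ∪ J') : I = I' ∧ J = J' := by
  have key : I ⊆ I' := by
    intro x hx
    by_contra hx'
    have hxJ : x ∈ J' := by
      have : x ∈ I' ∪ J' := hu ▸ Finset.mem_union_left _ hx
      exact (Finset.mem_union.1 this).resolve_left hx'
    have hsub : I' ⊆ I.erase x := by
      intro y hy
      have hyx := (h' y hy x hxJ).1
      refine Finset.mem_erase.2 ⟨hyx.ne, ?_⟩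
      have : y ∈ I ∪ J := hu ▸ Finset.mem_union_left _ hy
      refine (Finset.mem_union.1 this).resolve_right fun hyJ => ?_
      exact absurd (h x hx y hyJ).1 (not_lt.2 hyx.le)
    have := Finset.card_le_card hsub
    rw [Finset.card_erase_of_mem hx] at this
    have := Finset.card_pos.2 ⟨x, hx⟩
    omega
  have hI : I = I' := Finset.eq_of_subset_of_card_le key hc.ge
  subst hI
  refine ⟨rfl, ?_⟩
  have hd : ∀ K, Precedes σ I K → Disjoint I K := fun K hK =>
    Finset.disjoint_left.2 fun x hx hx' => lt_irrefl _ (hK x hx x hx').1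
  rw [← Finset.union_sdiff_cancel_left (hd J h), hu, Finset.union_sdiff_cancel_left (hd J' h')]

section cutSequence

variable {σ : Equiv.Perm ℕ} {T : ℕ → ℕ}

theorem exists_between_cuts (h0 : T 0 = 0) {m j : ℕ} (hj : j < T m) :
    ∃ k < m, T k ≤ j ∧ j < T (k + 1) := by
  induction m with
  | zero => omega
  | succ m ih =>
    rcases lt_or_ge j (T m) with h | h
    · obtain ⟨k, hk, hk'⟩ := ih h
      exact ⟨k, by omega, hk'⟩
    · exact ⟨m, by omega, h, hj⟩

/-- One point of `J` determines the interval; `IsCut.block_side` at its two ends forces the other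
points into it. -/
theorem block_mem_interval (h0 : T 0 = 0) (hc : ∀ k, IsCut σ (T k))
    {β : FinPerm} (hβ : IsBlock β) {J : Finset ℕ} (hJ : pat J σ = β) {m : ℕ}
    (hJm : J ⊆ Finset.range (T m)) :
    ∃ k < m, J ⊆ Finset.Ico (T k) (T (k + 1)) := by
  have hne : J.Nonempty := Finset.card_pos.1 (by rw [card_of_pat_eq hJ]; exact hβ.1)
  obtain ⟨j, hj⟩ := hne
  obtain ⟨k, hk, h1, h2⟩ := exists_between_cuts h0 (by simpa using hJm hj)
  refine ⟨k, hk, fun x hx => Finset.mem_Ico.2 ⟨?_, ?_⟩⟩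
  · rcases (hc k).block_side hβ hJ with h | h
    · exact absurd (h j hj) (not_lt.2 h1)
    · exact h x hx
  · rcases (hc (k + 1)).block_side hβ hJ with h | h
    · exact h x hx
    · exact absurd (h j hj) (not_le.2 h2)

/-- The last block of an occurrence sits in one interval, and everything else lies to its left,
hence before the end of that interval. This only bounds from above: two sets in a common interval
need not precede one another. -/
theorem occOn_add_le (h0 : T 0 = 0) (hc : ∀ k, IsCut σ (T k))
    {β : FinPerm} (hβ : IsBlock β) (ρ : FinPerm) (m : ℕ) :
    occOn (ρ.add β) (Finset.range (T m)) σ ≤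
      ∑ k ∈ Finset.range m, occOn β (Finset.Ico (T k) (T (k + 1))) σ *
        occOn ρ (Finset.range (T (k + 1))) σ := by
  classical
  let S : ℕ → Finset (Finset ℕ × Finset ℕ) := fun k =>
    ((Finset.Ico (T k) (T (k + 1))).powerset.filter fun J => pat J σ = β) ×ˢ
      ((Finset.range (T (k + 1))).powerset.filter fun J => pat J σ = ρ)
  have hsub : (Finset.range (T m)).powerset.filter (fun J => pat J σ = ρ.add β) ⊆
      ((Finset.range m).biUnion S).image fun p => p.2 ∪ p.1 := by
    intro K hK
    simp only [Finset.mem_filter, Finset.mem_powerset] at hK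
    obtain ⟨I, J, rfl, hI, hJ, hp⟩ := exists_of_pat_eq_add hK.2
    obtain ⟨k, hk, hkJ⟩ := block_mem_interval h0 hc hβ hJ
      (Finset.union_subset_right hK.1)
    have hne : J.Nonempty := Finset.card_pos.1 (by rw [card_of_pat_eq hJ]; exact hβ.1)
    obtain ⟨j, hj⟩ := hne
    refine Finset.mem_image.2 ⟨(J, I), Finset.mem_biUnion.2 ⟨k, Finset.mem_range.2 hk, ?_⟩, rfl⟩
    simp only [S, Finset.mem_product, Finset.mem_filter, Finset.mem_powerset]
    refine ⟨⟨hkJ, hJ⟩, fun x hx => ?_, hI⟩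
    exact Finset.mem_range.2 ((hp x hx j hj).1.trans (Finset.mem_Ico.1 (hkJ hj)).2)
  calc occOn (ρ.add β) (Finset.range (T m)) σ ≤ _ := Finset.card_le_card hsub
    _ ≤ ((Finset.range m).biUnion S).card := Finset.card_image_le
    _ ≤ ∑ k ∈ Finset.range m, (S k).card := Finset.card_biUnion_le
    _ = _ := Finset.sum_congr rfl fun k _ => by simp only [S, Finset.card_product]; rfl

/-- An occurrence of `ρ` before a cut and one of `β` after it always combine. Different pairs have
different unions by `union_injective`, and the interval is recovered from the occurrence of `β`. -/
theorem le_occOn_add (hT : StrictMono T) (hc : ∀ k, IsCut σ (T k))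
    {β : FinPerm} (hβ : IsBlock β) (ρ : FinPerm) (m : ℕ) :
    ∑ k ∈ Finset.range m, occOn β (Finset.Ico (T k) (T (k + 1))) σ *
        occOn ρ (Finset.range (T k)) σ ≤ occOn (ρ.add β) (Finset.range (T m)) σ := by
  classical
  let S : ℕ → Finset (Finset ℕ × Finset ℕ) := fun k =>
    ((Finset.Ico (T k) (T (k + 1))).powerset.filter fun J => pat J σ = β) ×ˢ
      ((Finset.range (T k)).powerset.filter fun J => pat J σ = ρ)
  have hmem : ∀ {k p}, p ∈ S k → (p.1 ⊆ Finset.Ico (T k) (T (k + 1)) ∧ pat p.1 σ = β) ∧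
      p.2 ⊆ Finset.range (T k) ∧ pat p.2 σ = ρ := fun {k p} hp => by
    simpa only [S, Finset.mem_product, Finset.mem_filter, Finset.mem_powerset] using hp
  have hprec : ∀ {k p}, p ∈ S k → Precedes σ p.2 p.1 := fun {k p} hp =>
    (hc k).precedes (fun i hi => Finset.mem_range.1 ((hmem hp).2.1 hi))
      fun j hj => (Finset.mem_Ico.1 ((hmem hp).1.1 hj)).1
  have hcard : ∑ k ∈ Finset.range m, (S k).card = ((Finset.range m).biUnion S).card := by
    refine (Finset.card_biUnion fun k _ l _ hkl => ?_).symm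
    refine Finset.disjoint_left.2 fun p hp hp' => hkl ?_
    have hne : p.1.Nonempty :=
      Finset.card_pos.1 (by rw [card_of_pat_eq (hmem hp).1.2]; exact hβ.1)
    obtain ⟨j, hj⟩ := hne
    have h1 := Finset.mem_Ico.1 ((hmem hp).1.1 hj)
    have h2 := Finset.mem_Ico.1 ((hmem hp').1.1 hj)
    have h3 := hT.lt_iff_lt.1 (h1.1.trans_lt h2.2)
    have h4 := hT.lt_iff_lt.1 (h2.1.trans_lt h1.2)
    omega
  calc _ = ∑ k ∈ Finset.range m, (S k).card :=
        Finset.sum_congr rfl fun k _ => by simp only [S, Finset.card_product]; rfl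
    _ = ((Finset.range m).biUnion S).card := hcard
    _ ≤ _ := by
      refine Finset.card_le_card_of_injOn (fun p => p.2 ∪ p.1) ?_ ?_
      · intro p hp
        obtain ⟨k, hk, hp⟩ := Finset.mem_biUnion.1 hp
        refine Finset.mem_coe.2 (Finset.mem_filter.2 ⟨Finset.mem_powerset.2 ?_, ?_⟩)
        · have hk' := Finset.mem_range.1 hk
          refine Finset.union_subset (fun x hx => ?_) fun x hx => ?_
          · exact Finset.mem_range.2 ((Finset.mem_range.1 ((hmem hp).2.1 hx)).trans_le
              (hT.monotone hk'.le))
          · exact Finset.mem_range.2 ((Finset.mem_Ico.1 ((hmem hp).1.1 hx)).2.trans_le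
              (hT.monotone hk'))
        · exact pat_union (hmem hp).2.2 (hmem hp).1.2 (hprec hp)
      · intro p hp p' hp' h
        obtain ⟨k, -, hp⟩ := Finset.mem_biUnion.1 hp
        obtain ⟨k', -, hp'⟩ := Finset.mem_biUnion.1 hp'
        have := union_injective (by rw [card_of_pat_eq (hmem hp).2.2, card_of_pat_eq (hmem hp').2.2])
          (hprec hp) (hprec hp') h
        exact Prod.ext this.2 this.1

end cutSequence

/-! ### Iterated sums over blocks -/

/-- `∑ f₁(b_{i₁}) ⋯ f_d(b_{i_d})` over `i₁ < ⋯ < i_d < m`. -/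
def strictSum {X : Type*} : {d : ℕ} → (Fin d → X → ℝ) → (ℕ → X) → ℕ → ℝ
  | 0, _, _, _ => 1
  | d + 1, f, b, m => ∑ i ∈ Finset.range m, f (Fin.last d) (b i) * strictSum (Fin.init f) b i

/-- `∑ f₁(b_{i₁}) ⋯ f_d(b_{i_d})` over `i₁ ≤ ⋯ ≤ i_d < m`. -/
def weakSum {X : Type*} : {d : ℕ} → (Fin d → X → ℝ) → (ℕ → X) → ℕ → ℝ
  | 0, _, _, _ => 1
  | d + 1, f, b, m => ∑ i ∈ Finset.range m, f (Fin.last d) (b i) * weakSum (Fin.init f) b (i + 1)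

/-- The numbers of occurrences of the blocks of a pattern, as functions. -/
def occFun {d : ℕ} (π : BlockPattern d) : Fin d → FinPerm → ℝ := fun j B => occ (π j).1 B

theorem occOn_zero_pattern (π : BlockPattern 0) (I : Finset ℕ) (σ : Equiv.Perm ℕ) :
    occOn π.toPerm I σ = 1 := by
  rw [occOn, Finset.card_eq_one]
  refine ⟨∅, ?_⟩
  ext J
  simp only [Finset.mem_filter, Finset.mem_powerset, Finset.mem_singleton]
  constructor
  · rintro ⟨-, hJ⟩
    have := card_of_pat_eq hJ
    exact Finset.card_eq_zero.1 (this.trans (by simp [BlockPattern.toPerm, directSum]))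
  · rintro rfl
    refine ⟨Finset.empty_subset _, ?_⟩
    have h : (∅ : Finset ℕ).card = ∑ j : Fin 0, (π j).1.1 := by simp
    exact finPerm_mk_ext h fun k => k.elim0

theorem strictSum_le_occOn {σ : Equiv.Perm ℕ} {T : ℕ → ℕ} (hT : StrictMono T)
    (hc : ∀ k, IsCut σ (T k)) {b : ℕ → FinPerm}
    (hb : ∀ k, b k = pat (Finset.Ico (T k) (T (k + 1))) σ) {d : ℕ} (π : BlockPattern d) (m : ℕ) :
    strictSum (occFun π) b m ≤ occOn π.toPerm (Finset.range (T m)) σ := by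
  induction d generalizing m with
  | zero => simp [strictSum, occOn_zero_pattern]
  | succ d ih =>
    have h1 := le_occOn_add hT hc (π (Fin.last d)).2 (directSum fun j : Fin d => (π j.castSucc).1) m
    have h2 : π.toPerm = (directSum fun j : Fin d => (π j.castSucc).1).add (π (Fin.last d)).1 :=
      directSum_succ _
    rw [h2]
    refine le_trans ?_ (Nat.cast_le.2 h1)
    rw [strictSum]
    push_cast
    refine Finset.sum_le_sum fun k _ => ?_
    rw [← occ_pat, ← hb]
    exact mul_le_mul_of_nonneg_left (ih (Fin.init π) k) (Nat.cast_nonneg _)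

theorem occOn_le_weakSum {σ : Equiv.Perm ℕ} {T : ℕ → ℕ} (h0 : T 0 = 0)
    (hc : ∀ k, IsCut σ (T k)) {b : ℕ → FinPerm}
    (hb : ∀ k, b k = pat (Finset.Ico (T k) (T (k + 1))) σ) {d : ℕ} (π : BlockPattern d) (m : ℕ) :
    occOn π.toPerm (Finset.range (T m)) σ ≤ weakSum (occFun π) b m := by
  induction d generalizing m with
  | zero => simp [weakSum, occOn_zero_pattern]
  | succ d ih =>
    have h1 := occOn_add_le h0 hc (π (Fin.last d)).2
      (directSum fun j : Fin d => (π j.castSucc).1) m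
    have h2 : π.toPerm = (directSum fun j : Fin d => (π j.castSucc).1).add (π (Fin.last d)).1 :=
      directSum_succ _
    rw [h2]
    refine le_trans (Nat.cast_le.2 h1) ?_
    rw [weakSum]
    push_cast
    refine Finset.sum_le_sum fun k _ => ?_
    rw [← occ_pat, ← hb]
    exact mul_le_mul_of_nonneg_left (ih (Fin.init π) (k + 1)) (Nat.cast_nonneg _)

/-! ### Permutations of `ℕ` and their right-inversion counts -/

/-- Among the values below `n`, those still free and those already used add up to `n`. -/
theorem count_avoid (v : ℕ → ℕ) (hv : Function.Injective v) (k n : ℕ)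
    [DecidablePred fun m => ∀ j : Fin k, v j ≠ m] :
    Nat.count (fun m => ∀ j : Fin k, v j ≠ m) n + ((Finset.range k).filter fun j => v j < n).card
      = n := by
  classical
  rw [Nat.count_eq_card_filter_range]
  have h : ((Finset.range k).filter fun j => v j < n).card =
      ((Finset.range n).filter fun m => ¬ ∀ j : Fin k, v j ≠ m).card := by
    rw [← Finset.card_image_of_injective _ hv]
    congr 1
    ext m
    simp only [Finset.mem_image, Finset.mem_filter, Finset.mem_range, not_forall, not_not]
    constructor
    · rintro ⟨j, ⟨hj, hjn⟩, rfl⟩; exact ⟨hjn, ⟨j, hj⟩, rfl⟩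
    · rintro ⟨hm, ⟨j, hj⟩, rfl⟩; exact ⟨j, ⟨hj, hm⟩, rfl⟩
  rw [h, Finset.card_filter_add_card_filter_not, Finset.card_range]

theorem count_avoid_self (v : ℕ → ℕ) (hv : Function.Injective v) (k : ℕ)
    [DecidablePred fun m => ∀ j : Fin k, v j ≠ m] :
    Nat.count (fun m => ∀ j : Fin k, v j ≠ m) (v k) +
      ((Finset.range k).filter fun j => v j < v k).card = v k :=
  count_avoid v hv k (v k)

theorem insertion_congr {r r' : ℕ → ℕ} {n : ℕ} (h : ∀ i < n, r i = r' i) {k : ℕ} (hk : k < n) :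
    insertion r k = insertion r' k := by
  induction k using Nat.strong_induction_on with
  | _ k ih =>
    rw [insertion.eq_1, insertion.eq_1 r', h k hk]
    congr 1
    funext m
    exact propext (forall_congr' fun j => by rw [ih j j.2 (j.2.trans hk)])

open Classical in
theorem count_insertion (r : ℕ → ℕ) (k : ℕ) :
    Nat.count (fun m => ∀ j : Fin k, insertion r j ≠ m) (insertion r k) = r k := by
  conv_lhs => rw [insertion.eq_1 r k]
  exact Nat.count_nth_of_infinite (insertion_free_infinite r k) (r k)

open Classical in
-- `Nat.nth` undoes `Nat.count` at a free value. So an injective sequence is recovered from the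
-- ranks of its terms among the values left free by the earlier terms.
theorem insertion_eq_of_counts (r v : ℕ → ℕ) (hv : Function.Injective v) (n : ℕ)
    (h : ∀ i < n, r i = Nat.count (fun m => ∀ j : Fin i, v j ≠ m) (v i)) :
    ∀ i < n, insertion r i = v i := by
  intro i
  induction i using Nat.strong_induction_on with
  | _ i ih =>
    intro hi
    rw [insertion.eq_1, h i hi]
    have : (fun m => ∀ j : Fin i, insertion r j ≠ m) = fun m => ∀ j : Fin i, v j ≠ m := by
      funext m
      exact propext (forall_congr' fun j => by rw [ih j j.2 (j.2.trans hi)])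
    rw [this]
    exact Nat.nth_count fun j => hv.ne j.2.ne

open Classical in
theorem insertion_eq_iff (r v : ℕ → ℕ) (hv : Function.Injective v) (n : ℕ) :
    (∀ i < n, insertion r i = v i) ↔
      ∀ i < n, r i = Nat.count (fun m => ∀ j : Fin i, v j ≠ m) (v i) := by
  refine ⟨fun h i hi => ?_, insertion_eq_of_counts r v hv n⟩
  rw [← count_insertion r i, h i hi]
  congr 1
  funext m
  exact propext (forall_congr' fun j => by rw [h j (j.2.trans hi)])

/-- A value smaller than `σ i` is unused before `i` exactly when it is taken at a later position, so
the right-inversion count is the rank among free values used by the insertion. -/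
theorem insertion_rightInversionCount (σ : Equiv.Perm ℕ) :
    insertion (rightInversionCount σ) = σ := by
  classical
  funext k
  refine insertion_eq_of_counts _ σ σ.injective (k + 1) (fun i _ => ?_) k (Nat.lt_succ_self k)
  rw [rightInversionCount, Nat.count_eq_card_filter_range,
    ← Set.ncard_image_of_injective _ σ.injective, ← Set.ncard_coe_finset]
  congr 1
  ext m
  simp only [Set.mem_image, Set.mem_ofPred_eq, Finset.coe_filter, Finset.mem_range]
  constructor
  · rintro ⟨j, ⟨hij, hlt⟩, rfl⟩
    exact ⟨hlt, fun l => σ.injective.ne (l.2.trans hij).ne⟩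
  · rintro ⟨hlt, hm⟩
    refine ⟨σ.symm m, ⟨?_, by simpa using hlt⟩, by simp⟩
    rcases lt_trichotomy i (σ.symm m) with hij | hij | hij
    · exact hij
    · rw [hij] at hlt; simp at hlt
    · exact absurd (by simp) (hm ⟨_, hij⟩)

theorem permOfCounts_rightInversionCount (σ : Equiv.Perm ℕ) :
    permOfCounts (rightInversionCount σ) = σ := by
  have h := insertion_rightInversionCount σ
  have hb : Function.Bijective (insertion (rightInversionCount σ)) := h ▸ σ.bijective
  rw [permOfCounts, dif_pos hb]
  ext k
  exact congrFun h k

theorem permOfCounts_apply {r : ℕ → ℕ} (hr : ∃ᶠ i in atTop, r i = 0) (k : ℕ) :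
    permOfCounts r k = insertion r k := by
  rw [permOfCounts, dif_pos (insertion_bijective r hr)]
  rfl

/-- The condition on the counts that makes `n` a cut. -/
def CountCut (r : ℕ → ℕ) (n : ℕ) : Prop := ∀ i < n, i + r i < n

/-- When `i` is processed, at most `i` values below `n` are used, so at least `n - i > r i` of them
are still free. -/
theorem insertion_lt_of_countCut {r : ℕ → ℕ} {n : ℕ} (h : CountCut r n) {i : ℕ} (hi : i < n) :
    insertion r i < n := by
  classical
  induction i using Nat.strong_induction_on with
  | _ i ih =>
    rw [insertion.eq_1]
    apply Nat.nth_lt_of_lt_count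
    have h1 := count_avoid (insertion r) (insertion_injective r) i n
    have h2 : ((Finset.range i).filter fun j => insertion r j < n).card ≤ i := by
      simpa using Finset.card_filter_le (Finset.range i) fun j => insertion r j < n
    have := h i hi
    omega

/-- This makes being a cut an intersection of conditions on separate counts, hence a product event.
For the direct implication, the right inversions of `i < n` must occupy positions strictly between
`i` and `n`. -/
theorem isCut_iff {r : ℕ → ℕ} (hr : ∃ᶠ i in atTop, r i = 0) (n : ℕ) :
    IsCut (permOfCounts r) n ↔ CountCut r n := by
  constructor
  · intro h i hi
    have h1 := rightInversionCount_permOfCounts r (insertion_bijective r hr) i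
    have h2 : rightInversionCount (permOfCounts r) i ≤ (Finset.Ioo i n).card := by
      rw [rightInversionCount, ← Set.ncard_coe_finset]
      refine Set.ncard_le_ncard (fun j hj => ?_) (Finset.finite_toSet _)
      simp only [Finset.coe_Ioo, Set.mem_Ioo]
      exact ⟨hj.1, (h.lt_iff j).1 (hj.2.trans (h i hi))⟩
    rw [Nat.card_Ioo] at h2
    omega
  · intro h i hi
    rw [permOfCounts_apply hr]
    exact insertion_lt_of_countCut h hi

/-- The shift of a sequence. -/
def shiftSeq {X : Type*} (n : ℕ) (r : ℕ → X) : ℕ → X := fun i => r (n + i)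

theorem shiftSeq_shiftSeq {X : Type*} (m n : ℕ) (r : ℕ → X) :
    shiftSeq m (shiftSeq n r) = shiftSeq (n + m) r := by
  funext i; simp [shiftSeq, add_assoc]

theorem CountCut.shift_iff {r : ℕ → ℕ} {n : ℕ} (h : CountCut r n) (m : ℕ) :
    CountCut (shiftSeq n r) m ↔ CountCut r (n + m) := by
  constructor
  · intro h' i hi
    rcases lt_or_ge i n with hin | hin
    · have := h i hin; omega
    · have h1 := h' (i - n) (by omega)
      simp only [shiftSeq, Nat.add_sub_cancel' hin] at h1
      omega
  · intro h' i hi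
    have h1 := h' (n + i) (by omega)
    simp only [shiftSeq]
    omega

theorem frequently_shiftSeq {r : ℕ → ℕ} (hr : ∃ᶠ i in atTop, r i = 0) (n : ℕ) :
    ∃ᶠ i in atTop, shiftSeq n r i = 0 := by
  rw [frequently_atTop] at hr ⊢
  intro a
  obtain ⟨b, hb, hb0⟩ := hr (n + a)
  exact ⟨b - n, by omega, by simp only [shiftSeq]; rwa [Nat.add_sub_cancel' (by omega)]⟩

/-- The part of a permutation above a cut. -/
def IsCut.tail {σ : Equiv.Perm ℕ} {n : ℕ} (h : IsCut σ n) : Equiv.Perm ℕ where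
  toFun i := σ (n + i) - n
  invFun i := σ.symm (n + i) - n
  left_inv i := by
    have h1 : n ≤ σ (n + i) := not_lt.1 fun hlt => by have := (h.lt_iff _).1 hlt; omega
    simp [Nat.add_sub_cancel' h1]
  right_inv i := by
    have h1 : n ≤ σ.symm (n + i) := not_lt.1 fun hlt => by
      have := (h.lt_iff _).2 hlt; simp at this
    simp [Nat.add_sub_cancel' h1]

theorem IsCut.add_tail {σ : Equiv.Perm ℕ} {n : ℕ} (h : IsCut σ n) (i : ℕ) :
    σ (n + i) = n + h.tail i := by
  have h1 : n ≤ σ (n + i) := not_lt.1 fun hlt => by have := (h.lt_iff _).1 hlt; omega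
  simp only [IsCut.tail, Equiv.coe_fn_mk]
  omega

theorem IsCut.rightInversionCount_tail {σ : Equiv.Perm ℕ} {n : ℕ} (h : IsCut σ n) (i : ℕ) :
    rightInversionCount h.tail i = rightInversionCount σ (n + i) := by
  rw [rightInversionCount, rightInversionCount,
    ← Set.ncard_image_of_injective _ (add_right_injective n)]
  congr 1
  ext j
  simp only [Set.mem_image, Set.mem_ofPred_eq]
  constructor
  · rintro ⟨l, ⟨h1, h2⟩, rfl⟩
    rw [h.add_tail, h.add_tail]
    omega
  · rintro ⟨h1, h2⟩
    refine ⟨j - n, ⟨by omega, ?_⟩, Nat.add_sub_cancel' (by omega)⟩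
    have h3 : j = n + (j - n) := by omega
    rw [h3, h.add_tail, h.add_tail] at h2
    omega

/-- The tail above a cut is a permutation with the shifted counts, and the counts determine a
permutation. -/
theorem permOfCounts_add {r : ℕ → ℕ} (hr : ∃ᶠ i in atTop, r i = 0) {n : ℕ} (h : CountCut r n)
    (i : ℕ) : permOfCounts r (n + i) = n + permOfCounts (shiftSeq n r) i := by
  have hc := (isCut_iff hr n).2 h
  have h1 : rightInversionCount hc.tail = shiftSeq n r := by
    funext j
    rw [hc.rightInversionCount_tail,
      rightInversionCount_permOfCounts r (insertion_bijective r hr)]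
    rfl
  rw [← h1, permOfCounts_rightInversionCount, hc.add_tail]

theorem pat_map_add {σ σ' : Equiv.Perm ℕ} {n : ℕ} (h : ∀ i, σ (n + i) = n + σ' i)
    (I : Finset ℕ) : pat (I.map (addLeftEmbedding n)) σ = pat I σ' := by
  obtain ⟨f, hf, hs⟩ := (pat_eq_iff I σ' _).1 rfl
  refine (pat_eq_iff _ _ _).2 ⟨f.trans (OrderEmbedding.addLeft n), ?_, fun k l => ?_⟩
  · conv_rhs => rw [← hf]
    rw [Finset.map_map]; rfl
  · rw [hs]
    simp [h]

theorem pat_range_congr {σ σ' : Equiv.Perm ℕ} {n : ℕ} (h : ∀ i < n, σ i = σ' i) :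
    pat (Finset.range n) σ = pat (Finset.range n) σ' := by
  obtain ⟨f, hf, hs⟩ := (pat_eq_iff (Finset.range n) σ' _).1 rfl
  refine (pat_eq_iff _ _ _).2 ⟨f, hf, fun k l => ?_⟩
  have hmem : ∀ k, f k < n := fun k => by
    have : f k ∈ Finset.univ.map f.toEmbedding := by simp
    rw [hf] at this
    simpa using this
  rw [hs, h _ (hmem k), h _ (hmem l)]

theorem pat_range_eq_mk_iff (σ : Equiv.Perm ℕ) {n : ℕ} (s : Equiv.Perm (Fin n)) :
    pat (Finset.range n) σ = ⟨n, s⟩ ↔ ∀ k l : Fin n, s k < s l ↔ σ k < σ l := by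
  rw [pat_eq_mk_iff]
  constructor
  · rintro ⟨f, hf, hs⟩
    have h1 : f = (Fin.valOrderEmb n) := by
      have e1 := Finset.orderEmbOfFin_unique' (s := Finset.range n) (k := n) (by simp) (f := f)
        fun x => by
          have : f x ∈ Finset.univ.map f.toEmbedding := by simp
          rwa [hf] at this
      have e2 := Finset.orderEmbOfFin_unique' (s := Finset.range n) (k := n) (by simp)
        (f := Fin.valOrderEmb n) fun x => by simp
      rw [e1, e2]
    rw [h1] at hs
    exact hs
  · intro hs
    refine ⟨Fin.valOrderEmb n, ?_, hs⟩
    ext x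
    simp only [Finset.mem_map, Finset.mem_univ, true_and, Finset.mem_range]
    exact ⟨fun ⟨k, hk⟩ => hk ▸ k.2, fun h => ⟨⟨x, h⟩, rfl⟩⟩

/-! ### The sequence of blocks -/

/-- The size of the first block, as a function of the counts. -/
def blockSize (r : ℕ → ℕ) : ℕ := firstBlockSize (permOfCounts r)

/-- The first block, as a function of the counts. -/
def blockOf (r : ℕ → ℕ) : FinPerm := firstBlock (permOfCounts r)

/-- The counts after the first block. -/
def restOf (r : ℕ → ℕ) : ℕ → ℕ := shiftSeq (blockSize r) r

/-- The sequence of blocks, as a function of the counts. -/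
def blockSeq (r : ℕ → ℕ) (k : ℕ) : FinPerm := blockOf (restOf^[k] r)

/-- The counts describe a permutation with infinitely many cuts. -/
def GoodCounts (r : ℕ → ℕ) : Prop :=
  (∃ᶠ i in atTop, r i = 0) ∧ ∃ᶠ n in atTop, CountCut r n

theorem GoodCounts.shift {r : ℕ → ℕ} (hr : GoodCounts r) {n : ℕ} (h : CountCut r n) :
    GoodCounts (shiftSeq n r) := by
  refine ⟨frequently_shiftSeq hr.1 n, ?_⟩
  have h2 := hr.2
  rw [frequently_atTop] at h2 ⊢
  intro a
  obtain ⟨b, hb, hb0⟩ := h2 (n + a)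
  refine ⟨b - n, by omega, (h.shift_iff _).2 ?_⟩
  rwa [Nat.add_sub_cancel' (by omega)]

theorem GoodCounts.blockSize_spec {r : ℕ → ℕ} (hr : GoodCounts r) :
    0 < blockSize r ∧ CountCut r (blockSize r) := by
  have hne : {m : ℕ | 0 < m ∧ ∀ i < m, permOfCounts r i < m}.Nonempty := by
    obtain ⟨n, hn, hc⟩ := frequently_atTop.1 hr.2 1
    exact ⟨n, hn, (isCut_iff hr.1 n).2 hc⟩
  have := Nat.sInf_mem hne
  exact ⟨this.1, (isCut_iff hr.1 _).1 this.2⟩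

theorem GoodCounts.blockSize_le {r : ℕ → ℕ} (hr : GoodCounts r) {n : ℕ} (h0 : 0 < n)
    (h : CountCut r n) : blockSize r ≤ n :=
  Nat.sInf_le ⟨h0, (isCut_iff hr.1 n).2 h⟩

theorem GoodCounts.blockSize_eq_iff {r : ℕ → ℕ} (hr : GoodCounts r) (n : ℕ) :
    blockSize r = n ↔ 0 < n ∧ CountCut r n ∧ ∀ k, 0 < k → k < n → ¬ CountCut r k := by
  constructor
  · rintro rfl
    exact ⟨hr.blockSize_spec.1, hr.blockSize_spec.2, fun k h0 hk h =>
      absurd (hr.blockSize_le h0 h) (not_le.2 hk)⟩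
  · rintro ⟨h0, hc, hmin⟩
    refine le_antisymm (hr.blockSize_le h0 hc) (not_lt.1 fun hlt => ?_)
    exact hmin _ hr.blockSize_spec.1 hlt hr.blockSize_spec.2

theorem blockOf_fst (r : ℕ → ℕ) : (blockOf r).1 = blockSize r := by
  simp [blockOf, firstBlock, pat, blockSize]

theorem GoodCounts.iterate {r : ℕ → ℕ} (hr : GoodCounts r) (k : ℕ) :
    GoodCounts (restOf^[k] r) := by
  induction k with
  | zero => exact hr
  | succ k ih =>
    rw [Function.iterate_succ_apply']
    exact ih.shift ih.blockSize_spec.2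

/-- The partial sums of the sizes of the first blocks. -/
def cutSeq (b : ℕ → FinPerm) (k : ℕ) : ℕ := ∑ i ∈ Finset.range k, (b i).1

theorem GoodCounts.iterate_eq {r : ℕ → ℕ} (hr : GoodCounts r) (k : ℕ) :
    restOf^[k] r = shiftSeq (cutSeq (blockSeq r) k) r ∧ CountCut r (cutSeq (blockSeq r) k) := by
  induction k with
  | zero => exact ⟨by funext i; simp [shiftSeq, cutSeq], by simp [cutSeq, CountCut]⟩
  | succ k ih =>
    have h1 : cutSeq (blockSeq r) (k + 1) =
        cutSeq (blockSeq r) k + blockSize (restOf^[k] r) := by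
      rw [cutSeq, Finset.sum_range_succ, ← blockOf_fst]; rfl
    rw [h1, Function.iterate_succ_apply', restOf]
    constructor
    · conv_lhs => rw [ih.1]
      rw [shiftSeq_shiftSeq, ih.1]
    · have h2 := (hr.iterate k).blockSize_spec.2
      generalize blockSize (restOf^[k] r) = s at h2 ⊢
      rw [ih.1] at h2
      exact (ih.2.shift_iff _).1 h2

theorem GoodCounts.isCut_cutSeq {r : ℕ → ℕ} (hr : GoodCounts r) (k : ℕ) :
    IsCut (permOfCounts r) (cutSeq (blockSeq r) k) :=
  (isCut_iff hr.1 _).2 (hr.iterate_eq k).2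

theorem GoodCounts.blockSeq_pos {r : ℕ → ℕ} (hr : GoodCounts r) (k : ℕ) :
    0 < (blockSeq r k).1 := by
  rw [blockSeq, blockOf_fst]
  exact (hr.iterate k).blockSize_spec.1

theorem cutSeq_strictMono {b : ℕ → FinPerm} (hb : ∀ k, 0 < (b k).1) : StrictMono (cutSeq b) :=
  strictMono_nat_of_lt_succ fun k => by
    rw [cutSeq, cutSeq, Finset.sum_range_succ]
    have := hb k
    omega

theorem GoodCounts.blockSeq_eq_pat {r : ℕ → ℕ} (hr : GoodCounts r) (k : ℕ) :
    blockSeq r k = pat (Finset.Ico (cutSeq (blockSeq r) k) (cutSeq (blockSeq r) (k + 1)))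
      (permOfCounts r) := by
  have h1 : cutSeq (blockSeq r) (k + 1) =
      cutSeq (blockSeq r) k + blockSize (restOf^[k] r) := by
    rw [cutSeq, Finset.sum_range_succ, ← blockOf_fst]; rfl
  have h2 : Finset.Ico (cutSeq (blockSeq r) k) (cutSeq (blockSeq r) (k + 1)) =
      (Finset.range (blockSize (restOf^[k] r))).map
        (addLeftEmbedding (cutSeq (blockSeq r) k)) := by
    rw [h1, Finset.range_eq_Ico, Finset.map_add_left_Ico, add_zero]
  rw [h2, pat_map_add (permOfCounts_add hr.1 (hr.iterate_eq k).2), ← (hr.iterate_eq k).1]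
  rfl

theorem GoodCounts.occ_bounds {r : ℕ → ℕ} (hr : GoodCounts r) {d : ℕ} (π : BlockPattern d)
    {m n : ℕ} (h1 : cutSeq (blockSeq r) m ≤ n) (h2 : n ≤ cutSeq (blockSeq r) (m + 1)) :
    strictSum (occFun π) (blockSeq r) m ≤ occ π.toPerm (pat (Finset.range n) (permOfCounts r)) ∧
    (occ π.toPerm (pat (Finset.range n) (permOfCounts r)) : ℝ) ≤
      weakSum (occFun π) (blockSeq r) (m + 1) := by
  rw [occ_pat]
  constructor
  · exact (strictSum_le_occOn (cutSeq_strictMono hr.blockSeq_pos) hr.isCut_cutSeq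
      hr.blockSeq_eq_pat π m).trans
      (Nat.cast_le.2 (occOn_mono _ (Finset.range_subset_range.2 h1) _))
  · exact (Nat.cast_le.2 (occOn_mono _ (Finset.range_subset_range.2 h2) _)).trans
      (occOn_le_weakSum (by simp [cutSeq]) hr.isCut_cutSeq hr.blockSeq_eq_pat π (m + 1))

/-- The counts, replaced by zero from `n` on. -/
def truncCounts (n : ℕ) (r : ℕ → ℕ) : ℕ → ℕ := fun i => if i < n then r i else 0

theorem goodCounts_of_eventually_zero {r : ℕ → ℕ} {n : ℕ} (h : ∀ i, n ≤ i → r i = 0) :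
    GoodCounts r := by
  refine ⟨(eventually_atTop.2 ⟨n, h⟩).frequently, Eventually.frequently ?_⟩
  -- The sum dominates every `i + r i` with `i < n`, so each index beyond this threshold is a cut.
  refine eventually_atTop.2 ⟨n + ∑ i ∈ Finset.range n, (i + r i) + 1, fun m hm i hi => ?_⟩
  rcases lt_or_ge i n with hin | hin
  · have := Finset.single_le_sum (f := fun i => i + r i) (fun _ _ => Nat.zero_le _)
      (Finset.mem_range.2 hin)
    omega
  · rw [h i hin]; omega

theorem goodCounts_truncCounts (n : ℕ) (r : ℕ → ℕ) : GoodCounts (truncCounts n r) :=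
  goodCounts_of_eventually_zero fun i hi => if_neg (not_lt.2 hi)

/-- Whether the first block is `β` is decided by the counts at the first `|β|` positions: they
determine which indices up to `|β|` are cuts, and the values there. This is the stopping-time
property of the first cut. -/
theorem GoodCounts.blockOf_eq_iff_of_agree {r r' : ℕ → ℕ} (hr : GoodCounts r)
    (hr' : GoodCounts r') (β : FinPerm) (h : ∀ i < β.1, r i = r' i) :
    blockOf r = β ↔ blockOf r' = β := by
  suffices H : ∀ {r r' : ℕ → ℕ}, GoodCounts r → GoodCounts r' → (∀ i < β.1, r i = r' i) →
      blockOf r = β → blockOf r' = β from ⟨H hr hr' h, H hr' hr fun i hi => (h i hi).symm⟩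
  intro r r' hr hr' h hb
  have hs : blockSize r = β.1 := by rw [← blockOf_fst, hb]
  have hcut : ∀ k ≤ β.1, CountCut r k ↔ CountCut r' k := fun k hk =>
    forall₂_congr fun _ hi => by rw [h _ (hi.trans_le hk)]
  have hs' : blockSize r' = β.1 := by
    obtain ⟨h0, h1, h2⟩ := (hr.blockSize_eq_iff _).1 hs
    exact (hr'.blockSize_eq_iff _).2 ⟨h0, (hcut _ le_rfl).1 h1, fun k hk0 hk hc =>
      h2 k hk0 hk ((hcut k hk.le).2 hc)⟩
  rw [← hb, blockOf, blockOf, firstBlock, firstBlock]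
  change pat (Finset.range (blockSize r')) _ = pat (Finset.range (blockSize r)) _
  rw [hs, hs']
  refine pat_range_congr fun i hi => ?_
  rw [permOfCounts_apply hr.1, permOfCounts_apply hr'.1]
  exact (insertion_congr h hi).symm

/-- For counts that are not good, `firstBlockSize` may depend on the whole sequence. Truncation
produces an event that truly involves only the first `|β|` counts and agrees with the original one
on good counts. -/
theorem blockOf_eq_iff_trunc {r : ℕ → ℕ} (hr : GoodCounts r) (β : FinPerm) :
    blockOf r = β ↔ blockOf (truncCounts β.1 r) = β :=
  hr.blockOf_eq_iff_of_agree (goodCounts_truncCounts _ _) β fun i hi => (if_pos hi).symm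

/-- The block is extended by the identity; indecomposability says that no cut comes before its end.
-/
theorem exists_counts_blockOf_eq (β : Block) : ∃ r : ℕ → ℕ, GoodCounts r ∧ blockOf r = β.1 := by
  obtain ⟨⟨n, s⟩, hβ⟩ := β
  obtain ⟨σ, hσ1, hσ2⟩ : ∃ σ : Equiv.Perm ℕ, (∀ k : Fin n, σ k = s k) ∧ ∀ i, n ≤ i → σ i = i := by
    refine ⟨s.extendDomain (p := fun i => i < n) (Fin.equivSubtype), fun k => ?_, fun i hi => ?_⟩
    · have := Equiv.Perm.extendDomain_apply_image s (Fin.equivSubtype (n := n)) k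
      exact this
    · exact Equiv.Perm.extendDomain_apply_not_subtype _ _ (not_lt.2 hi)
  have hcut : ∀ m, n ≤ m → IsCut σ m := fun m hm i hi => by
    rcases lt_or_ge i n with h | h
    · rw [hσ1 ⟨i, h⟩]; exact (s ⟨i, h⟩).2.trans_le hm
    · rwa [hσ2 i h]
  have hz : ∀ i, n ≤ i → rightInversionCount σ i = 0 := fun i hi => by
    rw [rightInversionCount]
    have : {j : ℕ | i < j ∧ σ j < σ i} = ∅ := Set.eq_empty_of_forall_notMem fun j hj => by
      have h1 := hj.1
      have h2 := hj.2
      rw [hσ2 i hi, hσ2 j (hi.trans h1.le)] at h2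
      omega
    rw [this, Set.ncard_empty]
  have hg := goodCounts_of_eventually_zero hz
  refine ⟨_, hg, ?_⟩
  have hs : blockSize (rightInversionCount σ) = n := by
    refine (hg.blockSize_eq_iff n).2 ⟨hβ.1, ?_, fun k hk0 hk hc => ?_⟩
    · rw [← isCut_iff hg.1, permOfCounts_rightInversionCount]; exact hcut n le_rfl
    · rw [← isCut_iff hg.1, permOfCounts_rightInversionCount] at hc
      exact hβ.2 k hk0 hk fun i hi => by
        have := hc i hi
        rwa [hσ1 i] at this
  rw [blockOf, firstBlock]
  change pat (Finset.range (blockSize _)) _ = _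
  rw [hs, permOfCounts_rightInversionCount]
  refine (pat_range_eq_mk_iff σ s).2 fun k l => ?_
  rw [hσ1, hσ1]
  rfl

/-! ### Sequences of independent identically distributed variables -/

section iid

variable {X : Type*} [MeasurableSpace X]

theorem measurable_shiftSeq (n : ℕ) : Measurable (shiftSeq n : (ℕ → X) → ℕ → X) :=
  measurable_pi_lambda _ fun _ => measurable_pi_apply _

/-- The sequence that agrees with the first sequence before `n`, and continues with the second. -/
def glueSeq (n : ℕ) (p : (ℕ → X) × (ℕ → X)) : ℕ → X := fun i => if i < n then p.1 i else p.2 (i - n)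

omit [MeasurableSpace X] in
theorem shiftSeq_glueSeq (n : ℕ) (p : (ℕ → X) × (ℕ → X)) : shiftSeq n (glueSeq n p) = p.2 := by
  funext i
  simp [shiftSeq, glueSeq]

theorem measurable_glueSeq (n : ℕ) : Measurable (glueSeq n : (ℕ → X) × (ℕ → X) → ℕ → X) := by
  refine measurable_pi_lambda _ fun i => ?_
  unfold glueSeq
  split_ifs
  · exact (measurable_pi_apply i).comp measurable_fst
  · exact (measurable_pi_apply _).comp measurable_snd

variable (ν : Measure X) [IsProbabilityMeasure ν]

theorem map_shiftSeq (n : ℕ) : (Measure.infinitePi fun _ : ℕ => ν).map (shiftSeq n) =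
    Measure.infinitePi fun _ : ℕ => ν :=
  Measure.map_infinitePi_infinitePi_of_inj (P := fun _ : ℕ => ν) (add_right_injective n)

/-- A cylinder set splits into its constraints before `n` and from `n` on, which fall on the two
independent sequences. -/
theorem map_glueSeq (n : ℕ) :
    ((Measure.infinitePi fun _ : ℕ => ν).prod (Measure.infinitePi fun _ : ℕ => ν)).map (glueSeq n) =
      Measure.infinitePi fun _ : ℕ => ν := by
  refine Measure.eq_infinitePi _ fun s t ht => ?_
  rw [Measure.map_apply (measurable_glueSeq n) (.pi s.countable_toSet fun _ _ => ht _)]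
  have h : glueSeq n ⁻¹' (Set.pi (s : Set ℕ) t) =
      (Set.pi (s.filter (· < n) : Finset ℕ) t) ×ˢ
        (Set.pi ((s.filter fun i => ¬ i < n).image (· - n) : Finset ℕ) fun i => t (n + i)) := by
    ext p
    simp only [Set.mem_preimage, Set.mem_pi, Finset.mem_coe, Set.mem_prod, Finset.mem_filter,
      Finset.mem_image, glueSeq]
    constructor
    · intro h
      refine ⟨fun i hi => by simpa [hi.2] using h i hi.1, ?_⟩
      rintro _ ⟨i, ⟨hi, hin⟩, rfl⟩
      have := h i hi
      rw [if_neg hin] at this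
      rwa [Nat.add_sub_cancel' (not_lt.1 hin)]
    · rintro ⟨h1, h2⟩ i hi
      split_ifs with hin
      · exact h1 i ⟨hi, hin⟩
      · have := h2 _ ⟨i, ⟨hi, hin⟩, rfl⟩
        rwa [Nat.add_sub_cancel' (not_lt.1 hin)] at this
  rw [h, Measure.prod_prod, Measure.infinitePi_pi _ fun i _ => ht i,
    Measure.infinitePi_pi _ fun i _ => ht _, ← Finset.prod_filter_mul_prod_filter_not s (· < n)]
  congr 1
  rw [Finset.prod_image]
  · refine Finset.prod_congr rfl fun i hi => ?_
    rw [Nat.add_sub_cancel' (not_lt.1 (Finset.mem_filter.1 hi).2)]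
  · intro i hi j hj hij
    have h1 := (Finset.mem_filter.1 hi).2
    have h2 := (Finset.mem_filter.1 hj).2
    simp only at hij
    omega

theorem measure_inter_shiftSeq {A B : Set (ℕ → X)} (hA : MeasurableSet A) (hB : MeasurableSet B)
    {n : ℕ} (h : ∀ r r' : ℕ → X, (∀ i < n, r i = r' i) → (r ∈ A ↔ r' ∈ A)) :
    (Measure.infinitePi fun _ : ℕ => ν) (A ∩ shiftSeq n ⁻¹' B) =
      (Measure.infinitePi fun _ : ℕ => ν) A * (Measure.infinitePi fun _ : ℕ => ν) B := by
  conv_lhs => rw [← map_glueSeq ν n]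
  rw [Measure.map_apply (measurable_glueSeq n) (hA.inter (measurable_shiftSeq n hB)),
    ← Measure.prod_prod]
  congr 1
  ext p
  simp only [Set.mem_preimage, Set.mem_inter_iff, Set.mem_prod, shiftSeq_glueSeq]
  rw [h (glueSeq n p) p.1 fun i hi => by simp [glueSeq, hi]]

/-- If one step outputs a variable of law `ν` and an independent new state with the old law, the
outputs along the iteration are i.i.d.; this is checked on cylinders by removing the first
coordinate. -/
theorem map_iterate_eq_infinitePi {S : Type*} [MeasurableSpace S] (μ : Measure S)
    [IsProbabilityMeasure μ] {f : S → X} {g : S → S} (hf : Measurable f) (hg : Measurable g)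
    (h : μ.map (fun s => (f s, g s)) = ν.prod μ) :
    μ.map (fun s k => f (g^[k] s)) = Measure.infinitePi fun _ : ℕ => ν := by
  have hm : Measurable fun s k => f (g^[k] s) :=
    measurable_pi_lambda _ fun k => hf.comp (hg.iterate k)
  have key : ∀ (n : ℕ) (t : ℕ → Set X), (∀ i, MeasurableSet (t i)) →
      μ {s | ∀ k < n, f (g^[k] s) ∈ t k} = ∏ k ∈ Finset.range n, ν (t k) := by
    intro n
    induction n with
    | zero => intro t _; simp
    | succ n ih =>
      intro t ht
      have hset : MeasurableSet {s | ∀ k < n, f (g^[k] s) ∈ t (k + 1)} := by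
        have : {s | ∀ k < n, f (g^[k] s) ∈ t (k + 1)} =
            ⋂ k : Fin n, (fun s => f (g^[k] s)) ⁻¹' (t (k + 1)) := by
          ext s
          simp only [Set.mem_ofPred_eq, Set.mem_iInter, Set.mem_preimage]
          exact ⟨fun h k => h k k.2, fun h k hk => h ⟨k, hk⟩⟩
        rw [this]
        exact .iInter fun k => (hf.comp (hg.iterate k)) (ht _)
      have hpre : {s | ∀ k < n + 1, f (g^[k] s) ∈ t k} = (fun s => (f s, g s)) ⁻¹'
          (t 0 ×ˢ {s | ∀ k < n, f (g^[k] s) ∈ t (k + 1)}) := by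
        ext s
        simp only [Set.mem_ofPred_eq, Set.mem_preimage, Set.mem_prod]
        constructor
        · intro h
          exact ⟨h 0 (Nat.succ_pos n), fun k hk => h (k + 1) (by omega)⟩
        · rintro ⟨h0, h1⟩ k hk
          cases k with
          | zero => exact h0
          | succ k => exact h1 k (by omega)
      rw [hpre, ← Measure.map_apply (hf.prodMk hg) ((ht 0).prod hset), h, Measure.prod_prod,
        ih (fun k => t (k + 1)) fun i => ht _, Finset.prod_range_succ']
      exact mul_comm _ _
  refine Measure.eq_infinitePi _ fun s t ht => ?_
  classical
  rw [Measure.map_apply hm (.pi s.countable_toSet fun _ _ => ht _)]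
  obtain ⟨n, hn⟩ := s.exists_nat_subset_range
  -- A cylinder on an arbitrary finite set of coordinates becomes one on an initial segment by
  -- leaving the missing coordinates unconstrained.
  have h2 := key n (fun k => if k ∈ s then t k else Set.univ) fun i => by
    split_ifs
    exacts [ht i, .univ]
  have h3 : (fun s k => f (g^[k] s)) ⁻¹' (Set.pi (s : Set ℕ) t) =
      {x | ∀ k < n, f (g^[k] x) ∈ if k ∈ s then t k else Set.univ} := by
    ext x
    simp only [Set.mem_preimage, Set.mem_pi, Finset.mem_coe, Set.mem_ofPred_eq]
    constructor
    · intro h k _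
      split_ifs with hk
      · exact h k hk
      · trivial
    · intro h k hk
      simpa [hk] using h k (Finset.mem_range.1 (hn hk))
  rw [h3, h2]
  rw [← Finset.prod_subset hn]
  · exact Finset.prod_congr rfl fun k hk => by rw [if_pos hk]
  · intro k _ hk
    simp [hk]

end iid

/-! ### The law of the counts -/

/-- The law of the sequence of right-inversion counts. -/
def countsMeasure (q : unitInterval) : Measure (ℕ → ℕ) :=
  Measure.infinitePi fun _ : ℕ => geometricMeasure (unitInterval.symm q)

instance (q : unitInterval) : IsProbabilityMeasure (countsMeasure q) := by
  unfold countsMeasure; infer_instance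

theorem measurable_blockOf : Measurable blockOf := measurable_firstBlock.comp measurable_permOfCounts

theorem measurable_blockSize : Measurable blockSize :=
  measurable_firstBlockSize.comp measurable_permOfCounts

theorem measurable_restOf : Measurable restOf := by
  refine measurable_pi_lambda _ fun i => ?_
  have h : Measurable fun p : ℕ × (ℕ → ℕ) => p.2 (p.1 + i) :=
    measurable_from_prod_countable_right fun n => measurable_pi_apply (n + i)
  exact h.comp (measurable_blockSize.prodMk measurable_id)

theorem map_blockOf (q : unitInterval) : (countsMeasure q).map blockOf = mallowsBlock q := by
  rw [mallowsBlock, mallowsInfinite, Measure.map_map measurable_firstBlock measurable_permOfCounts]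
  rfl

instance (q : unitInterval) : IsProbabilityMeasure (mallowsBlock q) := by
  rw [← map_blockOf]
  exact Measure.isProbabilityMeasure_map measurable_blockOf.aemeasurable

variable {q : unitInterval}

theorem geometric_singleton (hq1 : q < 1) (n : ℕ) :
    geometricMeasure (unitInterval.symm q) {n} = ENNReal.ofReal ((1 - q) * (q : ℝ) ^ n) := by
  rw [geometricMeasure_singleton]
  · rw [unitInterval.coe_symm_eq, sub_sub_cancel, mul_comm]
  · intro h
    rw [unitInterval.symm_eq_zero] at h
    exact hq1.ne h

theorem geometric_Iio (hq1 : q < 1) (n : ℕ) :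
    geometricMeasure (unitInterval.symm q) (Set.Iio n) = ENNReal.ofReal (1 - (q : ℝ) ^ n) := by
  have h : (Set.Iio n : Set ℕ) = (Finset.range n : Set ℕ) := by ext; simp
  rw [h, ← sum_measure_singleton]
  simp_rw [geometric_singleton hq1]
  rw [← ENNReal.ofReal_sum_of_nonneg fun i _ =>
    mul_nonneg (sub_nonneg.2 q.2.2) (pow_nonneg q.2.1 _), ← Finset.mul_sum]
  congr 1
  exact mul_neg_geom_sum _ _

/-- Having no zero among `N` consecutive counts has probability `q ^ N`. -/
theorem ae_frequently_zero (hq1 : q < 1) :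
    ∀ᵐ r ∂(countsMeasure q), ∃ᶠ i in atTop, r i = 0 := by
  simp_rw [frequently_atTop]
  rw [ae_all_iff]
  intro n
  rw [ae_iff]
  have hle : ∀ N : ℕ, countsMeasure q {r | ¬ ∃ b ≥ n, r b = 0} ≤ ENNReal.ofReal (q : ℝ) ^ N := by
    intro N
    calc countsMeasure q {r | ¬ ∃ b ≥ n, r b = 0}
        ≤ countsMeasure q (Set.pi (Finset.Ico n (n + N) : Finset ℕ) fun _ => {0}ᶜ) := by
          refine measure_mono fun r hr i hi => ?_
          simp only [Set.mem_ofPred_eq, not_exists, not_and] at hr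
          exact hr i (Finset.mem_Ico.1 hi).1
      _ = ENNReal.ofReal (q : ℝ) ^ N := by
          rw [countsMeasure, Measure.infinitePi_pi _ fun _ _ => .of_discrete]
          have : geometricMeasure (unitInterval.symm q) {0}ᶜ = ENNReal.ofReal (q : ℝ) := by
            rw [prob_compl_eq_one_sub .of_discrete, geometric_singleton hq1, pow_zero, mul_one,
              ← ENNReal.ofReal_one, ← ENNReal.ofReal_sub _ (sub_nonneg.2 q.2.2), sub_sub_cancel]
          simp [this]
  have hq : ENNReal.ofReal (q : ℝ) < 1 := by
    rw [← ENNReal.ofReal_one]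
    exact (ENNReal.ofReal_lt_ofReal_iff one_pos).2 hq1
  exact le_antisymm (ge_of_tendsto' (ENNReal.tendsto_pow_atTop_nhds_zero_of_lt_one hq) hle)
    zero_le

/-! ### The size of a block -/

theorem measurableSet_countCut (n : ℕ) : MeasurableSet {r | CountCut r n} := by
  have : {r | CountCut r n} = Set.pi (Finset.range n : Finset ℕ) fun i => Set.Iio (n - i) := by
    ext r
    simp only [CountCut, Set.mem_ofPred_eq, Set.mem_pi, Finset.mem_coe, Finset.mem_range,
      Set.mem_Iio]
    exact forall₂_congr fun i hi => by omega
  rw [this]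
  exact .pi (Finset.countable_toSet _) fun _ _ => .of_discrete

/-- The probability that `n` is a cut. -/
def cutProb (q : unitInterval) (n : ℕ) : ℝ := ∏ j ∈ Finset.range n, (1 - (q : ℝ) ^ (j + 1))

/-- The cut condition asks independently that the `i`-th count be less than `n - i`; reversing the
product gives `cutProb`. -/
theorem measure_countCut (hq1 : q < 1) (n : ℕ) :
    (countsMeasure q).real {r | CountCut r n} = cutProb q n := by
  have : {r | CountCut r n} = Set.pi (Finset.range n : Finset ℕ) fun i => Set.Iio (n - i) := by
    ext r
    simp only [CountCut, Set.mem_ofPred_eq, Set.mem_pi, Finset.mem_coe, Finset.mem_range,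
      Set.mem_Iio]
    exact forall₂_congr fun i hi => by omega
  rw [this, measureReal_def, countsMeasure, Measure.infinitePi_pi _ fun _ _ => .of_discrete,
    ENNReal.toReal_prod, cutProb, ← Finset.prod_range_reflect]
  refine Finset.prod_congr rfl fun i hi => ?_
  have := Finset.mem_range.1 hi
  rw [geometric_Iio hq1, ENNReal.toReal_ofReal (sub_nonneg.2 (pow_le_one₀ q.2.1 q.2.2))]
  congr 2
  omega

/-- The event that there is no cut in `(0, n]`. -/
def noCut (n : ℕ) : Set (ℕ → ℕ) := {r | ∀ m, 0 < m → m ≤ n → ¬ CountCut r m}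

theorem measurableSet_noCut (n : ℕ) : MeasurableSet (noCut n) := by
  have : noCut n = ⋂ m : ℕ, ⋂ _ : 0 < m, ⋂ _ : m ≤ n, {r | CountCut r m}ᶜ := by
    ext r; simp [noCut]
  rw [this]
  exact .iInter fun m => .iInter fun _ => .iInter fun _ => (measurableSet_countCut m).compl

/-- The space is partitioned by the last cut `k ≤ n`. Given a cut at `k`, the absence of a cut in
`(k, n]` concerns only the shifted counts, which are independent of those before `k`. -/
theorem sum_cutProb_mul_noCut (hq1 : q < 1) (n : ℕ) :
    ∑ k ∈ Finset.range (n + 1), cutProb q k * (countsMeasure q).real (noCut (n - k)) = 1 := by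
  have h1 : ∀ k, cutProb q k * (countsMeasure q).real (noCut (n - k)) =
      (countsMeasure q).real ({r | CountCut r k} ∩ shiftSeq k ⁻¹' noCut (n - k)) := by
    intro k
    rw [← measure_countCut hq1, measureReal_def, measureReal_def, measureReal_def, countsMeasure,
      measure_inter_shiftSeq _ (measurableSet_countCut k) (measurableSet_noCut _),
      ENNReal.toReal_mul]
    intro r r' h
    exact forall₂_congr fun i hi => by rw [h i hi]
  simp_rw [h1]
  have hmem : ∀ k ≤ n, ∀ r, r ∈ {r | CountCut r k} ∩ shiftSeq k ⁻¹' noCut (n - k) ↔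
      CountCut r k ∧ ∀ m, k < m → m ≤ n → ¬ CountCut r m := by
    intro k hk r
    simp only [Set.mem_inter_iff, Set.mem_ofPred_eq, Set.mem_preimage, noCut]
    refine and_congr_right fun hc => ⟨fun h m hm hmn => ?_, fun h m hm hmn => ?_⟩
    · have := h (m - k) (by omega) (by omega)
      rwa [hc.shift_iff, Nat.add_sub_cancel' hm.le] at this
    · rw [hc.shift_iff]
      exact h _ (by omega) (by omega)
  rw [← measureReal_biUnion_finset]
  · convert probReal_univ (μ := countsMeasure q)
    refine Set.eq_univ_of_forall fun r => ?_
    classical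
    simp only [Set.mem_iUnion]
    let s := (Finset.range (n + 1)).filter fun k => CountCut r k
    -- The index `0` is vacuously a cut, so a last cut always exists.
    have hs : s.Nonempty := ⟨0, Finset.mem_filter.2 ⟨by simp, fun i hi => absurd hi (Nat.not_lt_zero i)⟩⟩
    have hmax := Finset.max'_mem s hs
    have h2 := Finset.mem_filter.1 hmax
    have h3 := Finset.mem_range.1 h2.1
    refine ⟨s.max' hs, h2.1, (hmem _ (by omega) r).2 ⟨h2.2, fun m hm hmn hc => ?_⟩⟩
    exact absurd (Finset.le_max' s m (Finset.mem_filter.2 ⟨Finset.mem_range.2 (by omega), hc⟩))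
      (not_le.2 hm)
  · intro k hk l hl hkl
    refine Set.disjoint_left.2 fun r hr hr' => ?_
    have hk' : k ≤ n := by have := Finset.mem_range.1 hk; omega
    have hl' : l ≤ n := by have := Finset.mem_range.1 hl; omega
    rw [hmem k hk'] at hr
    rw [hmem l hl'] at hr'
    rcases lt_or_gt_of_ne hkl with h | h
    · exact hr.2 l h hl' hr'.1
    · exact hr'.2 k h hk' hr.1
  · intro k _
    exact (measurableSet_countCut k).inter (measurable_shiftSeq k (measurableSet_noCut _))

/-- This is the difference of the last-cut identities for `n + 1` and `n`, since `cutProb` decreases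
by `cutProb q k * q ^ (k + 1)` from `k` to `k + 1`. The kernel obtained has total mass less than
one. -/
theorem noCut_recursion (hq1 : q < 1) (n : ℕ) :
    (countsMeasure q).real (noCut (n + 1)) =
      ∑ k ∈ Finset.range (n + 1), cutProb q k * (q : ℝ) ^ (k + 1) *
        (countsMeasure q).real (noCut (n - k)) := by
  have h1 := sum_cutProb_mul_noCut hq1 (n + 1)
  have h2 := sum_cutProb_mul_noCut hq1 n
  rw [Finset.sum_range_succ'] at h1
  have h3 : ∀ k, cutProb q (k + 1) = cutProb q k - cutProb q k * (q : ℝ) ^ (k + 1) := fun k => by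
    rw [cutProb, Finset.prod_range_succ, cutProb]; ring
  simp only [h3, Nat.add_sub_add_right, sub_mul, Finset.sum_sub_distrib, h2] at h1
  simp only [cutProb, Finset.range_zero, Finset.prod_empty, one_mul, Nat.sub_zero] at h1 ⊢
  linarith

theorem exists_cutProb_lower (hq1 : q < 1) : ∃ c > 0, ∀ n, c ≤ cutProb q n := by
  have hq : (q : ℝ) < 1 := hq1
  have hq0 : (0 : ℝ) ≤ q := q.2.1
  have hpos : ∀ j : ℕ, 0 < 1 - (q : ℝ) ^ (j + 1) := fun j =>
    sub_pos.2 (pow_lt_one₀ hq0 hq (Nat.succ_ne_zero j))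
  have hanti : Antitone (cutProb q) := antitone_nat_of_succ_le fun n => by
    rw [cutProb, cutProb, Finset.prod_range_succ]
    refine mul_le_of_le_one_right (Finset.prod_nonneg fun j _ => (hpos j).le) ?_
    linarith [pow_nonneg hq0 (n + 1)]
  -- With this `N`, the tail of the geometric series from exponent `N + 1` on is at most `1/2`, so
  -- the remaining factors lose at most half of `cutProb q N`.
  obtain ⟨N, hN⟩ := exists_pow_lt_of_lt_one (show (0 : ℝ) < (1 - q) / 2 by linarith) hq
  have hstep : ∀ m, cutProb q N * (1 - ∑ j ∈ Finset.range m, (q : ℝ) ^ (N + j + 1)) ≤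
      cutProb q (N + m) := by
    intro m
    induction m with
    | zero => simp
    | succ m ih =>
      rw [Finset.sum_range_succ, ← add_assoc, cutProb, cutProb, Finset.prod_range_succ]
      rw [cutProb, cutProb] at ih
      have h1 : ∏ j ∈ Finset.range (N + m), (1 - (q : ℝ) ^ (j + 1)) ≤
          ∏ j ∈ Finset.range N, (1 - (q : ℝ) ^ (j + 1)) := hanti (Nat.le_add_right N m)
      have h2 := mul_le_mul_of_nonneg_right h1 (pow_nonneg hq0 (N + m + 1))
      linarith
  have hsum : ∀ m, ∑ j ∈ Finset.range m, (q : ℝ) ^ (N + j + 1) ≤ 1 / 2 := by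
    intro m
    have h1 : ∑ j ∈ Finset.range m, (q : ℝ) ^ (N + j + 1) =
        (q : ℝ) ^ N * q * ∑ j ∈ Finset.range m, (q : ℝ) ^ j := by
      rw [Finset.mul_sum]
      exact Finset.sum_congr rfl fun j _ => by ring
    have h2 : (∑ j ∈ Finset.range m, (q : ℝ) ^ j) * (1 - q) ≤ 1 := by
      have := geom_sum_mul_neg (q : ℝ) m
      rw [this]; linarith [pow_nonneg hq0 m]
    have h4 : 0 ≤ ∑ j ∈ Finset.range m, (q : ℝ) ^ j := Finset.sum_nonneg fun j _ => pow_nonneg hq0 j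
    rw [h1]
    have h3 : (q : ℝ) ^ N * q ≤ (1 - q) / 2 := by nlinarith [pow_nonneg hq0 N]
    nlinarith
  have hNpos : 0 < cutProb q N := Finset.prod_pos fun j _ => hpos j
  refine ⟨cutProb q N / 2, by positivity, fun n => ?_⟩
  have h1 := hstep n
  have h2 := hanti (Nat.le_add_left n N)
  have h3 := hsum n
  nlinarith

/-- The kernel of `noCut_recursion` has mass at most `1 - c`. Weighting its terms by `x ^ (k + 1)`,
with `x > 1` close to `1`, keeps the mass at most one, and induction then bounds the solution by
`x⁻¹ ^ n`. -/
theorem exists_geometric_tail (hq1 : q < 1) :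
    ∃ θ : ℝ, 0 < θ ∧ θ < 1 ∧ ∀ n, (countsMeasure q).real (noCut n) ≤ θ ^ n := by
  have hq : (q : ℝ) < 1 := hq1
  have hq0 : (0 : ℝ) ≤ q := q.2.1
  obtain ⟨c, hc, hcut⟩ := exists_cutProb_lower hq1
  have hcut1 : ∀ k, cutProb q k ≤ 1 := fun k => Finset.prod_le_one
    (fun j _ => sub_nonneg.2 (pow_le_one₀ hq0 hq.le)) fun j _ => by
      linarith [pow_nonneg hq0 (j + 1)]
  -- This function bounds the mass added by the weights: the difference of the geometric series with
  -- ratios `q * x` and `q`. It vanishes at `x = 1`, so it can be made smaller than `c`.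
  have hcont : Tendsto (fun x : ℝ => q * x / (1 - q * x) - q / (1 - q)) (𝓝[>] 1) (𝓝 0) := by
    have : ContinuousAt (fun x : ℝ => q * x / (1 - q * x) - q / (1 - q)) 1 := by
      refine ContinuousAt.sub (ContinuousAt.div (by fun_prop) (by fun_prop) ?_) continuousAt_const
      simp only [mul_one]; linarith
    have h2 := this.tendsto
    simp only [mul_one, sub_self] at h2
    exact h2.mono_left nhdsWithin_le_nhds
  have hlt : ∀ᶠ x : ℝ in 𝓝[>] 1, q * x < 1 := by
    have h2 : Tendsto (fun x : ℝ => q * x) (𝓝[>] 1) (𝓝 (q * 1)) :=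
      ((continuous_const.mul continuous_id).tendsto 1).mono_left nhdsWithin_le_nhds
    exact h2.eventually_lt_const (by linarith)
  obtain ⟨x, ⟨hx1, hx2⟩, hx3⟩ :=
    (((hcont.eventually_lt_const hc).and hlt).and self_mem_nhdsWithin).exists
  have hx : (1 : ℝ) < x := hx3
  have hsum : ∀ n, ∑ k ∈ Finset.range n, cutProb q k * (q : ℝ) ^ (k + 1) * x ^ (k + 1) ≤ 1 := by
    intro n
    -- The kernel telescopes, being the sequence of decrements of `cutProb`.
    have h1 : ∑ k ∈ Finset.range n, cutProb q k * (q : ℝ) ^ (k + 1) = 1 - cutProb q n := by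
      induction n with
      | zero => simp [cutProb]
      | succ n ih =>
        rw [Finset.sum_range_succ, ih, cutProb, cutProb, Finset.prod_range_succ]; ring
    have h2 : ∑ k ∈ Finset.range n, cutProb q k * (q : ℝ) ^ (k + 1) * x ^ (k + 1) ≤
        ∑ k ∈ Finset.range n, (cutProb q k * (q : ℝ) ^ (k + 1) +
          ((q * x) ^ (k + 1) - (q : ℝ) ^ (k + 1))) := by
      refine Finset.sum_le_sum fun k _ => ?_
      rw [mul_pow]
      have h3 : 0 ≤ (q : ℝ) ^ (k + 1) := pow_nonneg hq0 _
      have h4 : 1 ≤ x ^ (k + 1) := one_le_pow₀ hx.le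
      nlinarith [hcut1 k, mul_nonneg (mul_nonneg (sub_nonneg.2 (hcut1 k)) h3) (sub_nonneg.2 h4)]
    have hts : ∀ y : ℝ, 0 ≤ y → y < 1 → HasSum (fun k : ℕ => y ^ (k + 1)) (y / (1 - y)) := by
      intro y hy0 hy1
      have := (hasSum_geometric_of_lt_one hy0 hy1).mul_left y
      simpa [pow_succ', div_eq_mul_inv] using this
    have h5 := (hts (q * x) (by positivity) hx2).sub (hts q hq0 hq)
    have h6 := sum_le_hasSum (Finset.range n) (fun k _ => sub_nonneg.2
      (pow_le_pow_left₀ hq0 (le_mul_of_one_le_right hq0 hx.le) (k + 1))) h5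
    rw [Finset.sum_add_distrib, h1] at h2
    linarith [hcut n]
  refine ⟨x⁻¹, by positivity, inv_lt_one_of_one_lt₀ hx, fun n => ?_⟩
  induction n using Nat.strong_induction_on with
  | _ n ih =>
    cases n with
    | zero => simp
    | succ n =>
      rw [noCut_recursion hq1]
      calc _ ≤ ∑ k ∈ Finset.range (n + 1), (cutProb q k * (q : ℝ) ^ (k + 1) * x ^ (k + 1)) *
            x⁻¹ ^ (n + 1) := by
            refine Finset.sum_le_sum fun k hk => ?_
            have hk' := Finset.mem_range.1 hk
            have h1 := ih (n - k) (by omega)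
            have h2 : x ^ (k + 1) * x⁻¹ ^ (n + 1) = x⁻¹ ^ (n - k) := by
              have : n + 1 = (n - k) + (k + 1) := by omega
              rw [this, pow_add x⁻¹, mul_comm, mul_assoc, ← mul_pow,
                inv_mul_cancel₀ (by positivity), one_pow, mul_one]
            rw [mul_assoc _ (x ^ (k + 1)), h2]
            exact mul_le_mul_of_nonneg_left h1 (mul_nonneg (hc.le.trans (hcut k))
              (pow_nonneg hq0 _))
        _ ≤ x⁻¹ ^ (n + 1) := by
            rw [← Finset.sum_mul]
            exact mul_le_of_le_one_left (by positivity) (hsum _)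

/-- Almost surely every shift of the counts has a positive cut, because all shifts have the same
law. Starting from any cut, another one is then always found further on. -/
theorem ae_goodCounts (hq1 : q < 1) : ∀ᵐ r ∂(countsMeasure q), GoodCounts r := by
  obtain ⟨θ, h0, h1, hθ⟩ := exists_geometric_tail hq1
  have hz : countsMeasure q {r | ∀ m, 0 < m → ¬ CountCut r m} = 0 := by
    rw [← measureReal_eq_zero_iff]
    refine le_antisymm (ge_of_tendsto' (tendsto_pow_atTop_nhds_zero_of_lt_one h0.le h1) fun n => ?_)
      measureReal_nonneg
    refine le_trans (measureReal_mono fun r hr => ?_) (hθ n)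
    exact fun m hm _ => hr m hm
  have hsh : ∀ n, ∀ᵐ r ∂(countsMeasure q), ∃ m, 0 < m ∧ CountCut (shiftSeq n r) m := by
    intro n
    have h2 : ∀ᵐ r ∂(countsMeasure q), ∃ m, 0 < m ∧ CountCut r m := by
      rw [ae_iff]
      convert hz using 3
      push Not
      rfl
    have h3 : ∀ᵐ r ∂((countsMeasure q).map (shiftSeq n)), ∃ m, 0 < m ∧ CountCut r m := by
      rw [countsMeasure, map_shiftSeq]; exact h2
    exact ae_of_ae_map (measurable_shiftSeq n).aemeasurable h3
  filter_upwards [ae_frequently_zero hq1, ae_all_iff.2 hsh] with r hr1 hr2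
  refine ⟨hr1, frequently_atTop.2 fun a => ?_⟩
  induction a with
  | zero => exact ⟨0, le_rfl, by simp [CountCut]⟩
  | succ a ih =>
    obtain ⟨b, hb, hbc⟩ := ih
    obtain ⟨m, hm, hmc⟩ := hr2 b
    exact ⟨b + m, by omega, (hbc.shift_iff m).1 hmc⟩

variable {q : unitInterval}

/-! ### The blocks are independent -/

/-- Regeneration at the first cut: on the event that the first block is `β`, the remainder is the
shift by the fixed number `|β|`, and the event is decided before `|β|`. It remains to sum over the
countably many `β`. -/
theorem map_blockOf_restOf (hq1 : q < 1) :
    (countsMeasure q).map (fun r => (blockOf r, restOf r)) =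
      (mallowsBlock q).prod (countsMeasure q) := by
  have hgood := ae_goodCounts hq1
  symm
  refine Measure.prod_eq fun s A hs hA => ?_
  have hsingle : ∀ β : FinPerm, countsMeasure q (blockOf ⁻¹' {β} ∩ restOf ⁻¹' A) =
      countsMeasure q (blockOf ⁻¹' {β}) * countsMeasure q A := by
    intro β
    have htr : Measurable (truncCounts β.1) := by
      refine measurable_pi_lambda _ fun i => ?_
      unfold truncCounts
      split_ifs
      · exact measurable_pi_apply i
      · exact measurable_const
    let D : Set (ℕ → ℕ) := truncCounts β.1 ⁻¹' (blockOf ⁻¹' {β})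
    have hD : MeasurableSet D := htr (measurable_blockOf (measurableSet_singleton β))
    have h1 : (blockOf ⁻¹' {β} : Set (ℕ → ℕ)) =ᵐ[countsMeasure q] D := by
      filter_upwards [hgood] with r hr
      exact propext (blockOf_eq_iff_trunc hr β)
    have h2 : (blockOf ⁻¹' {β} ∩ restOf ⁻¹' A : Set (ℕ → ℕ)) =ᵐ[countsMeasure q]
        (D ∩ shiftSeq β.1 ⁻¹' A : Set (ℕ → ℕ)) := by
      filter_upwards [hgood] with r hr
      refine propext (Iff.trans (and_congr_right fun hb => ?_)
        (and_congr_left' (blockOf_eq_iff_trunc hr β)))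
      have hb' : blockOf r = β := hb
      change restOf r ∈ A ↔ shiftSeq β.1 r ∈ A
      rw [restOf, ← blockOf_fst, hb']
    rw [measure_congr h1, measure_congr h2]
    refine measure_inter_shiftSeq _ hD hA fun r r' h => ?_
    have : truncCounts β.1 r = truncCounts β.1 r' := by
      funext i
      unfold truncCounts
      split_ifs with hi
      · exact h i hi
      · rfl
    change blockOf _ = β ↔ blockOf _ = β
    rw [this]
  have hun : ∀ C : Set (ℕ → ℕ), MeasurableSet C → countsMeasure q (blockOf ⁻¹' s ∩ C) =
      ∑' β : s, countsMeasure q (blockOf ⁻¹' {β.1} ∩ C) := by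
    intro C hC
    have : blockOf ⁻¹' s ∩ C = ⋃ β : s, blockOf ⁻¹' {β.1} ∩ C := by
      ext r
      simp
    rw [this, measure_iUnion]
    · intro β β' hne
      refine Set.disjoint_left.2 fun r hr hr' => hne ?_
      exact Subtype.ext (hr.1.symm.trans hr'.1)
    · exact fun β => (measurable_blockOf (measurableSet_singleton _)).inter hC
  rw [Measure.map_apply (measurable_blockOf.prodMk measurable_restOf) (hs.prod hA), ← map_blockOf,
    Measure.map_apply measurable_blockOf hs]
  have h3 : (fun r => (blockOf r, restOf r)) ⁻¹' (s ×ˢ A) = blockOf ⁻¹' s ∩ restOf ⁻¹' A := rfl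
  have h4 := hun Set.univ .univ
  simp only [Set.inter_univ] at h4
  rw [h3, hun _ (measurable_restOf hA), h4, ← ENNReal.tsum_mul_right]
  exact tsum_congr fun β => hsingle β

theorem map_blockSeq (hq1 : q < 1) :
    (countsMeasure q).map blockSeq = Measure.infinitePi fun _ : ℕ => mallowsBlock q :=
  map_iterate_eq_infinitePi (mallowsBlock q) (countsMeasure q) measurable_blockOf measurable_restOf
    (map_blockOf_restOf hq1)

theorem measurable_blockSeq : Measurable blockSeq :=
  measurable_pi_lambda _ fun k => measurable_blockOf.comp (measurable_restOf.iterate k)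

/-! ### Moments -/

theorem summable_pow_mul_geometric {θ : ℝ} (h0 : 0 ≤ θ) (h1 : θ < 1) (p : ℕ) :
    Summable fun n : ℕ => ((n + 1 : ℕ) : ℝ) ^ p * θ ^ n := by
  rcases h0.eq_or_lt with rfl | h0
  · refine summable_of_ne_finset_zero (s := {0}) fun n hn => ?_
    rw [zero_pow (by simpa using hn), mul_zero]
  · have h := (summable_pow_mul_geometric_of_norm_lt_one p (r := θ)
      (by rwa [Real.norm_of_nonneg h0.le]))
    have h2 := ((summable_nat_add_iff 1).2 h).mul_right θ⁻¹
    refine h2.congr fun n => ?_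
    rw [pow_succ]
    field_simp

theorem integrable_pow_of_tail {Ω : Type*} [MeasurableSpace Ω] {μ : Measure Ω}
    [IsProbabilityMeasure μ] {T : Ω → ℕ} (hT : Measurable T) {θ : ℝ} (h0 : 0 ≤ θ) (h1 : θ < 1)
    (h : ∀ n, μ.real {ω | n < T ω} ≤ θ ^ n) (p : ℕ) :
    Integrable (fun ω => (T ω : ℝ) ^ p) μ := by
  have hm : Measurable fun ω => (T ω : ℝ) ^ p := by fun_prop
  refine ⟨hm.aestronglyMeasurable, ?_⟩
  have hle : ∫⁻ ω, ‖(T ω : ℝ) ^ p‖ₑ ∂μ ≤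
      1 + ∑' n : ℕ, ENNReal.ofReal (((n + 1 : ℕ) : ℝ) ^ p * θ ^ n) := by
    -- If `T ω > 0`, the term `n = T ω - 1` alone equals the left side; the constant `1` covers `T ω
    -- = 0`, including the convention `0 ^ 0 = 1`.
    have hpt : ∀ ω, ‖(T ω : ℝ) ^ p‖ₑ ≤ 1 + ∑' n : ℕ, ENNReal.ofReal (((n + 1 : ℕ) : ℝ) ^ p) *
        Set.indicator {ω | n < T ω} 1 ω := by
      intro ω
      rw [Real.enorm_of_nonneg (by positivity)]
      rcases Nat.eq_zero_or_pos (T ω) with hz | hz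
      · refine le_add_right ?_
        rw [← ENNReal.ofReal_one, hz]
        exact ENNReal.ofReal_le_ofReal (by
          rcases p with _ | p <;> simp)
      · refine le_add_left (le_trans ?_ (ENNReal.le_tsum (T ω - 1)))
        have hmem : ω ∈ {ω' | T ω - 1 < T ω'} := by simp only [Set.mem_ofPred_eq]; omega
        rw [Set.indicator_of_mem hmem, Nat.sub_add_cancel hz]
        simp
    refine (lintegral_mono hpt).trans ?_
    rw [lintegral_add_left measurable_const, lintegral_const, measure_univ, one_mul]
    gcongr
    have hms : ∀ n : ℕ, MeasurableSet {ω | n < T ω} := fun n => hT (measurableSet_Ioi (a := n))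
    rw [lintegral_tsum fun n => by
      exact (measurable_const.mul (measurable_one.indicator (hms n))).aemeasurable]
    refine ENNReal.tsum_le_tsum fun n => ?_
    rw [lintegral_const_mul _ (measurable_one.indicator (hms n)), lintegral_indicator_one (hms n),
      ENNReal.ofReal_mul (by positivity)]
    gcongr
    rw [← ENNReal.ofReal_toReal (measure_ne_top μ {ω | n < T ω})]
    exact ENNReal.ofReal_le_ofReal (h n)
  refine lt_of_le_of_lt hle (ENNReal.add_lt_top.2 ⟨ENNReal.one_lt_top, ?_⟩)
  have := (summable_pow_mul_geometric h0 h1 p).tsum_ofReal_ne_top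
  exact this.lt_top

/-- Almost surely `|B| > n` means that there is no cut in `(0, n]`, so the geometric tail applies.
-/
theorem integrable_size_pow (hq1 : q < 1) (p : ℕ) :
    Integrable (fun B : FinPerm => (B.1 : ℝ) ^ p) (mallowsBlock q) := by
  obtain ⟨θ, h0, h1, hθ⟩ := exists_geometric_tail hq1
  rw [← map_blockOf, integrable_map_measure (by exact Measurable.aestronglyMeasurable .of_discrete)
    measurable_blockOf.aemeasurable]
  have : ((fun B : FinPerm => (B.1 : ℝ) ^ p) ∘ blockOf) = fun r => (blockSize r : ℝ) ^ p := by
    funext r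
    simp [blockOf_fst]
  rw [this]
  refine integrable_pow_of_tail measurable_blockSize h0.le h1 (fun n => ?_) p
  refine le_trans (le_of_eq (measureReal_congr ?_)) (hθ n)
  filter_upwards [ae_goodCounts hq1] with r hr
  refine propext ⟨fun h m hm hmn hc => ?_, fun h => ?_⟩
  · exact absurd (hr.blockSize_le hm hc) (not_le.2 (lt_of_le_of_lt hmn h))
  · by_contra hcon
    exact h _ hr.blockSize_spec.1 (not_lt.1 hcon) hr.blockSize_spec.2

theorem memLp_of_le_size_pow (hq1 : q < 1) {f : FinPerm → ℝ} {s : ℕ}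
    (hf : ∀ B, |f B| ≤ (B.1 : ℝ) ^ s) (p : ℕ) : MemLp f p (mallowsBlock q) := by
  rcases Nat.eq_zero_or_pos p with rfl | hp
  · simpa using Measurable.aestronglyMeasurable (.of_discrete)
  · refine (integrable_norm_rpow_iff (μ := mallowsBlock q) (p := (p : ENNReal))
      (Measurable.aestronglyMeasurable (.of_discrete))
      (by simpa using hp.ne') (ENNReal.natCast_ne_top p)).1 ?_
    refine (integrable_size_pow hq1 (s * p)).mono' (Measurable.aestronglyMeasurable (.of_discrete))
      (Eventually.of_forall fun B => ?_)
    simp only [ENNReal.toReal_natCast, Real.rpow_natCast, Real.norm_eq_abs, abs_pow, abs_abs]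
    rw [pow_mul]
    exact pow_le_pow_left₀ (abs_nonneg _) (hf B) p

theorem occ_le_size_pow (β B : FinPerm) : (occ β B : ℝ) ≤ (B.1 : ℝ) ^ β.1 := by
  rw [occ]
  have h : (Finset.univ.filter fun I : Finset (Fin B.1) => pat I B.2 = β) ⊆
      Finset.powersetCard β.1 Finset.univ := fun I hI =>
    Finset.mem_powersetCard.2 ⟨Finset.subset_univ _, card_of_pat_eq (Finset.mem_filter.1 hI).2⟩
  have h2 := (Finset.card_le_card h).trans (le_of_eq (Finset.card_powersetCard _ _))
  rw [Finset.card_univ, Fintype.card_fin] at h2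
  exact_mod_cast h2.trans (Nat.choose_le_pow _ _)

theorem memLp_size (hq1 : q < 1) (p : ℕ) :
    MemLp (fun B : FinPerm => (B.1 : ℝ)) p (mallowsBlock q) :=
  memLp_of_le_size_pow hq1 (s := 1) (fun B => by simp) p

theorem memLp_occ (hq1 : q < 1) (β : FinPerm) (p : ℕ) :
    MemLp (fun B : FinPerm => (occ β B : ℝ)) p (mallowsBlock q) :=
  memLp_of_le_size_pow hq1 (s := β.1) (fun B => by
    rw [abs_of_nonneg (Nat.cast_nonneg _)]; exact occ_le_size_pow β B) p

theorem ae_one_le_size (hq1 : q < 1) : ∀ᵐ B ∂(mallowsBlock q), 1 ≤ B.1 := by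
  rw [← map_blockOf, ae_map_iff measurable_blockOf.aemeasurable .of_discrete]
  filter_upwards [ae_goodCounts hq1] with r hr
  rw [blockOf_fst]
  exact hr.blockSize_spec.1

theorem one_le_meanSize (hq1 : q < 1) : 1 ≤ meanSize q := by
  have h1 : Integrable (fun B : FinPerm => (B.1 : ℝ)) (mallowsBlock q) :=
    (memLp_size hq1 1).integrable (by simp)
  have h2 := integral_mono_ae (integrable_const (1 : ℝ)) h1
    ((ae_one_le_size hq1).mono fun B hB => Nat.one_le_cast.2 hB)
  simpa [meanSize] using h2

/-- Prescribing the first `|β|` counts has positive probability, as every geometric weight is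
positive when `0 < q < 1`, and these counts already force the first block. -/
theorem mallowsBlock_singleton_pos (hq0 : 0 < q) (hq1 : q < 1) (β : Block) :
    0 < mallowsBlock q {β.1} := by
  obtain ⟨c, hc, hcβ⟩ := exists_counts_blockOf_eq β
  rw [← map_blockOf, Measure.map_apply measurable_blockOf (measurableSet_singleton _)]
  have h1 : 0 < countsMeasure q (Set.pi (Finset.range β.1.1 : Finset ℕ) fun i => {c i}) := by
    rw [countsMeasure, Measure.infinitePi_pi _ fun _ _ => .of_discrete]
    refine pos_iff_ne_zero.2 (Finset.prod_ne_zero_iff.2 fun i _ => ?_)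
    rw [geometric_singleton hq1]
    have hq0' : (0 : ℝ) < q := hq0
    have hq1' : (q : ℝ) < 1 := hq1
    have : 0 < (1 - (q : ℝ)) * (q : ℝ) ^ c i := mul_pos (sub_pos.2 hq1') (pow_pos hq0' _)
    exact (ENNReal.ofReal_pos.2 this).ne'
  refine h1.trans_le (measure_mono_ae ?_)
  filter_upwards [ae_goodCounts hq1] with r hr hrc
  refine (hc.blockOf_eq_iff_of_agree hr β.1 fun i hi => ?_).1 hcβ
  exact (hrc i (Finset.mem_coe.2 (Finset.mem_range.2 hi))).symm

theorem occ_self_pos (β : FinPerm) : 0 < occ β β := by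
  refine Finset.card_pos.2 ⟨Finset.univ, Finset.mem_filter.2 ⟨Finset.mem_univ _, ?_⟩⟩
  exact (pat_eq_iff _ _ _).2 ⟨RelEmbedding.refl _, by ext; simp, fun k l => Iff.rfl⟩

theorem meanOcc_pos (hq0 : 0 < q) (hq1 : q < 1) (β : Block) : 0 < meanOcc q β.1 := by
  rw [meanOcc, integral_pos_iff_support_of_nonneg (fun B => Nat.cast_nonneg _)
    ((memLp_occ hq1 β.1 1).integrable (by simp))]
  refine (mallowsBlock_singleton_pos hq0 hq1 β).trans_le (measure_mono ?_)
  rintro B rfl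
  exact (Nat.cast_pos.2 (occ_self_pos β.1)).ne'

/-! ### The law of the initial patterns -/

/-- Each value is its count plus the number of smaller earlier values. Summing counts the
non-inversions, and inversions together with non-inversions make up all pairs of positions. -/
theorem sum_counts_eq {n : ℕ} (s : Equiv.Perm (Fin n)) (A : Fin n ↪o ℕ) (c : Fin n → ℕ)
    (hc : ∀ i, c i + (Finset.univ.filter fun j => j < i ∧ s j < s i).card = A (s i)) :
    ∑ i, c i + (Finset.univ.filter fun p : Fin n × Fin n => p.1 < p.2).card =
      ∑ i, A i + inv s := by
  classical
  have h1 : (Finset.univ.filter fun p : Fin n × Fin n => p.1 < p.2).card =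
      ∑ i, (Finset.univ.filter fun j => j < i ∧ s j < s i).card + inv s := by
    have h2 : ∀ i, (Finset.univ.filter fun j => j < i ∧ s j < s i).card =
        ((Finset.univ.filter fun p : Fin n × Fin n => p.1 < p.2 ∧ ¬ s p.2 < s p.1).filter
          fun p => p.2 = i).card := by
      intro i
      refine Finset.card_bij (fun j _ => (j, i)) (fun j hj => ?_) (fun j _ j' _ h => ?_)
        fun p hp => ?_
      · simp only [Finset.mem_filter, Finset.mem_univ, true_and] at hj ⊢
        exact ⟨⟨hj.1, not_lt.2 hj.2.le⟩, trivial⟩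
      · exact (Prod.ext_iff.1 h).1
      · simp only [Finset.mem_filter, Finset.mem_univ, true_and] at hp
        obtain ⟨⟨h1, h2⟩, rfl⟩ := hp
        refine ⟨p.1, ?_, rfl⟩
        simp only [Finset.mem_filter, Finset.mem_univ, true_and]
        exact ⟨h1, lt_of_le_of_ne (not_lt.1 h2) (s.injective.ne h1.ne)⟩
    simp_rw [h2]
    rw [← Finset.card_eq_sum_card_fiberwise (f := Prod.snd) (t := Finset.univ)
      (fun _ _ => Finset.mem_coe.2 (Finset.mem_univ _)), inv,
      ← Finset.card_filter_add_card_filter_not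
        (s := Finset.univ.filter fun p : Fin n × Fin n => p.1 < p.2) fun p => s p.2 < s p.1,
      Finset.filter_filter, Finset.filter_filter, add_comm]
  have h3 : ∑ i, A i = ∑ i, A (s i) := (Equiv.sum_comp s A).symm
  rw [h1, h3, ← Finset.sum_congr rfl fun i _ => hc i, Finset.sum_add_distrib, add_assoc]

theorem measure_initial_values (hq1 : q < 1) (v : ℕ → ℕ) (hv : Function.Injective v) (n : ℕ) :
    ∃ c : ℕ → ℕ, (∀ i, c i + ((Finset.range i).filter fun j => v j < v i).card = v i) ∧
      countsMeasure q {r | ∀ i < n, permOfCounts r i = v i} =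
        ∏ i ∈ Finset.range n, ENNReal.ofReal ((1 - q) * (q : ℝ) ^ c i) := by
  classical
  refine ⟨fun i => Nat.count (fun m => ∀ j : Fin i, v j ≠ m) (v i), fun i =>
    count_avoid_self v hv i, ?_⟩
  have h1 : ({r | ∀ i < n, permOfCounts r i = v i} : Set (ℕ → ℕ)) =ᵐ[countsMeasure q]
      Set.pi (Finset.range n : Finset ℕ)
        fun i => {Nat.count (fun m => ∀ j : Fin i, v j ≠ m) (v i)} := by
    filter_upwards [ae_frequently_zero hq1] with r hr
    refine propext (Iff.trans ?_ ((insertion_eq_iff r v hv n).trans ?_))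
    · exact forall₂_congr fun i _ => by rw [permOfCounts_apply hr]
    · change _ ↔ ∀ i ∈ (Finset.range n : Set ℕ), _
      simp only [Finset.coe_range, Set.mem_Iio, Set.mem_singleton_iff]
  rw [measure_congr h1, countsMeasure, Measure.infinitePi_pi _ fun _ _ => .of_discrete]
  exact Finset.prod_congr rfl fun i _ => geometric_singleton hq1 _

theorem exists_extension {n : ℕ} (w : Fin n → ℕ) (hw : Function.Injective w) :
    ∃ v : ℕ → ℕ, Function.Injective v ∧ ∀ i : Fin n, v i = w i := by
  refine ⟨fun i => if h : i < n then w ⟨i, h⟩ else (∑ j, w j) + 1 + i, fun i j hij => ?_,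
    fun i => by simp⟩
  have hle : ∀ k, w k ≤ ∑ j, w j := fun k =>
    Finset.single_le_sum (fun _ _ => Nat.zero_le _) (Finset.mem_univ k)
  simp only at hij
  split_ifs at hij with h1 h2 h2
  · simpa using hw hij
  · have := hle ⟨i, h1⟩; omega
  · have := hle ⟨j, h2⟩; omega
  · omega

/-- The probability of given initial values is `(1 - q) ^ n` times `q` to the sum of the counts, and
`sum_counts_eq` separates this into `q ^ inv s` and a factor depending only on the set of values
`A`. -/
theorem measure_initial_perm (hq0 : 0 < q) (hq1 : q < 1) {n : ℕ} (s : Equiv.Perm (Fin n))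
    (A : Fin n ↪o ℕ) :
    countsMeasure q {r | ∀ i : Fin n, permOfCounts r i = A (s i)} =
      ENNReal.ofReal ((q : ℝ) ^ inv s) *
        ENNReal.ofReal ((1 - q) ^ n * (q : ℝ) ^ (∑ i, A i) /
          (q : ℝ) ^ (Finset.univ.filter fun p : Fin n × Fin n => p.1 < p.2).card) := by
  have hq0' : (0 : ℝ) < q := hq0
  have hq1' : (0 : ℝ) ≤ 1 - q := sub_nonneg.2 q.2.2
  obtain ⟨v, hv, hvw⟩ := exists_extension (fun i => A (s i)) (A.injective.comp s.injective)
  obtain ⟨c, hc, hm⟩ := measure_initial_values hq1 v hv n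
  have hset : {r | ∀ i : Fin n, permOfCounts r i = A (s i)} =
      {r | ∀ i < n, permOfCounts r i = v i} := by
    ext r
    exact ⟨fun h i hi => (h ⟨i, hi⟩).trans (hvw ⟨i, hi⟩).symm, fun h i => (h i i.2).trans (hvw i)⟩
  have hsum := sum_counts_eq s A (fun i => c i) fun i => by
    rw [← hvw i, ← hc i]
    congr 1
    refine Finset.card_bij (fun j _ => (j : ℕ)) (fun j hj => ?_) (fun j _ j' _ h => Fin.ext h)
      fun j hj => ?_
    · simp only [Finset.mem_filter, Finset.mem_univ, true_and, Finset.mem_range] at hj ⊢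
      exact ⟨hj.1, by rw [hvw, hvw]; exact A.lt_iff_lt.2 hj.2⟩
    · simp only [Finset.mem_filter, Finset.mem_range] at hj
      refine ⟨⟨j, hj.1.trans i.2⟩, ?_, rfl⟩
      simp only [Finset.mem_filter, Finset.mem_univ, true_and]
      have h2 := hj.2
      rw [hvw, show v j = v ((⟨j, hj.1.trans i.2⟩ : Fin n) : ℕ) from rfl, hvw] at h2
      exact ⟨hj.1, A.lt_iff_lt.1 h2⟩
  rw [hset, hm, ← ENNReal.ofReal_prod_of_nonneg fun i _ => mul_nonneg hq1' (pow_nonneg hq0'.le _),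
    ← ENNReal.ofReal_mul (pow_nonneg hq0'.le _)]
  congr 1
  rw [Finset.prod_mul_distrib, Finset.prod_const, Finset.card_range, Finset.prod_pow_eq_pow_sum,
    Finset.sum_range]
  rw [← mul_div_assoc, eq_div_iff (pow_pos hq0' _).ne', mul_assoc, ← pow_add, hsum, pow_add]
  ring

theorem measurableSet_initial (n : ℕ) (w : Fin n → ℕ) :
    MeasurableSet {r : ℕ → ℕ | ∀ i : Fin n, permOfCounts r i = w i} := by
  have : {r : ℕ → ℕ | ∀ i : Fin n, permOfCounts r i = w i} =
      ⋂ i : Fin n, (fun r => permOfCounts r i) ⁻¹' {w i} := by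
    ext r; simp
  rw [this]
  exact .iInter fun i => ((measurable_perm_apply i).comp measurable_permOfCounts)
    (measurableSet_singleton _)

/-- Summing over the increasing enumerations `A` of all possible value sets leaves `q ^ inv s` times
a factor independent of `s`. -/
theorem measure_pat_range (hq0 : 0 < q) (hq1 : q < 1) (n : ℕ) (s : Equiv.Perm (Fin n)) :
    (countsMeasure q).real {r | pat (Finset.range n) (permOfCounts r) = ⟨n, s⟩} =
      (q : ℝ) ^ inv s / ∑ ρ : Equiv.Perm (Fin n), (q : ℝ) ^ inv ρ := by
  have hq0' : (0 : ℝ) < q := hq0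
  have : Countable (Fin n ↪o ℕ) := DFunLike.coe_injective.countable
  set K : ENNReal := ∑' A : Fin n ↪o ℕ, ENNReal.ofReal ((1 - q) ^ n * (q : ℝ) ^ (∑ i, A i) /
    (q : ℝ) ^ (Finset.univ.filter fun p : Fin n × Fin n => p.1 < p.2).card)
  have hK : ∀ s : Equiv.Perm (Fin n),
      countsMeasure q {r | pat (Finset.range n) (permOfCounts r) = ⟨n, s⟩} =
        ENNReal.ofReal ((q : ℝ) ^ inv s) * K := by
    intro s
    have hset : {r | pat (Finset.range n) (permOfCounts r) = ⟨n, s⟩} =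
        ⋃ A : Fin n ↪o ℕ, {r | ∀ i : Fin n, permOfCounts r i = A (s i)} := by
      ext r
      simp only [Set.mem_ofPred_eq, Set.mem_iUnion]
      rw [pat_range_eq_mk_iff]
      constructor
      · intro h
        have hmono : StrictMono fun i : Fin n => permOfCounts r (s.symm i) :=
          fun i j hij => (h _ _).1 (by simpa using hij)
        refine ⟨OrderEmbedding.ofStrictMono _ hmono, fun i => ?_⟩
        change permOfCounts r i = permOfCounts r (s.symm (s i))
        rw [Equiv.symm_apply_apply]
      · rintro ⟨A, hA⟩ k l
        rw [hA, hA, A.lt_iff_lt]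
    rw [hset, measure_iUnion, ← ENNReal.tsum_mul_left]
    · exact tsum_congr fun A => measure_initial_perm hq0 hq1 s A
    · intro A A' hne
      refine Set.disjoint_left.2 fun r hr hr' => hne ?_
      ext i
      have h1 := hr (s.symm i)
      have h2 := hr' (s.symm i)
      rw [h1] at h2
      simpa using h2
    · exact fun A => measurableSet_initial n _
  have hpm : Measurable fun r => pat (Finset.range n) (permOfCounts r) :=
    (measurable_pat _).comp measurable_permOfCounts
  -- The common factor need not be computed; total mass one identifies it.
  have htot : (∑ ρ : Equiv.Perm (Fin n), (q : ℝ) ^ inv ρ) * K.toReal = 1 := by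
    have h1 : ∑ s : Equiv.Perm (Fin n),
        (countsMeasure q).real {r | pat (Finset.range n) (permOfCounts r) = ⟨n, s⟩} = 1 := by
      rw [← probReal_univ (μ := countsMeasure q), ← measureReal_biUnion_finset]
      · congr 1
        ext r
        simp only [Finset.mem_univ, Set.iUnion_true, Set.mem_iUnion, Set.mem_ofPred_eq,
          Set.mem_univ, iff_true]
        have hc : (Finset.range n).card = n := Finset.card_range n
        have hex : ∀ ρ : FinPerm, ρ.1 = n → ∃ s, ρ = ⟨n, s⟩ := by
          rintro ⟨m, t⟩ rfl
          exact ⟨t, rfl⟩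
        exact hex _ hc
      · intro s _ s' _ hne
        refine Set.disjoint_left.2 fun r hr hr' => hne ?_
        have := Eq.trans (Eq.symm hr) hr'
        exact eq_of_heq (Sigma.ext_iff.1 this).2
      · exact fun s _ => hpm (measurableSet_singleton _)
    simp_rw [measureReal_def, hK, ENNReal.toReal_mul,
      ENNReal.toReal_ofReal (pow_nonneg hq0'.le _), ← Finset.sum_mul] at h1
    exact h1
  have hZ : (∑ ρ : Equiv.Perm (Fin n), (q : ℝ) ^ inv ρ) ≠ 0 := left_ne_zero_of_mul_eq_one htot
  rw [measureReal_def, hK, ENNReal.toReal_mul, ENNReal.toReal_ofReal (pow_nonneg hq0'.le _),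
    eq_div_iff hZ, mul_assoc, mul_comm K.toReal, htot, mul_one]

/-! ### Bounds in all spaces `L^p` -/

/-- The family `Y` is bounded by a multiple of `a` in every `L^p`. -/
def LpBigO {Ω : Type*} [MeasurableSpace Ω] (P : Measure Ω) {ι : Type*} (Y : ι → Ω → ℝ)
    (a : ι → ℝ) : Prop :=
  (∀ i, AEStronglyMeasurable (Y i) P) ∧
    ∀ p : ℕ, ∃ C : ℝ, 0 ≤ C ∧ ∀ i, eLpNorm (Y i) p P ≤ ENNReal.ofReal (C * a i)

namespace LpBigO

variable {Ω : Type*} [MeasurableSpace Ω] {P : Measure Ω} [IsProbabilityMeasure P]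
  {ι κ : Type*} {Y Z : ι → Ω → ℝ} {a b : ι → ℝ}

omit [IsProbabilityMeasure P] in
theorem comp (h : LpBigO P Y a) (φ : κ → ι) : LpBigO P (fun k => Y (φ k)) fun k => a (φ k) :=
  ⟨fun k => h.1 _, fun p => (h.2 p).imp fun _ hC => ⟨hC.1, fun k => hC.2 _⟩⟩

omit [IsProbabilityMeasure P] in
theorem mono_rate (h : LpBigO P Y a) (hab : ∀ i, a i ≤ b i) : LpBigO P Y b :=
  ⟨h.1, fun p => (h.2 p).imp fun _ hC => ⟨hC.1, fun i => (hC.2 i).trans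
    (ENNReal.ofReal_le_ofReal (mul_le_mul_of_nonneg_left (hab i) hC.1))⟩⟩

omit [IsProbabilityMeasure P] in
theorem of_rate_mul {c : ℝ} (hc : 0 ≤ c) (h : LpBigO P Y fun i => c * a i) : LpBigO P Y a :=
  ⟨h.1, fun p => by
    obtain ⟨C, hC, hb⟩ := h.2 p
    exact ⟨C * c, mul_nonneg hC hc, fun i => by rw [mul_assoc]; exact hb i⟩⟩

omit [IsProbabilityMeasure P] in
theorem of_le (h : LpBigO P Y a) (hZ : ∀ i, AEStronglyMeasurable (Z i) P)
    (hle : ∀ i, ∀ᵐ ω ∂P, |Z i ω| ≤ |Y i ω|) : LpBigO P Z a :=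
  ⟨hZ, fun p => (h.2 p).imp fun _ hC => ⟨hC.1, fun i => (eLpNorm_mono_ae (hle i)).trans (hC.2 i)⟩⟩

/-- It suffices to bound arbitrarily large exponents. -/
theorem of_large (hY : ∀ i, AEStronglyMeasurable (Y i) P)
    (h : ∀ p : ℕ, 1 ≤ p → ∃ q : ℕ, p ≤ q ∧ ∃ C : ℝ, 0 ≤ C ∧
      ∀ i, eLpNorm (Y i) q P ≤ ENNReal.ofReal (C * a i)) : LpBigO P Y a := by
  refine ⟨hY, fun p => ?_⟩
  obtain ⟨q, hpq, C, hC, hb⟩ := h (p + 1) (Nat.le_add_left 1 p)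
  refine ⟨C, hC, fun i => le_trans ?_ (hb i)⟩
  exact eLpNorm_le_eLpNorm_of_exponent_le (by exact_mod_cast (Nat.le_succ p).trans hpq) (hY i)

theorem add (hY : LpBigO P Y a) (hZ : LpBigO P Z a) (ha : ∀ i, 0 ≤ a i) :
    LpBigO P (fun i ω => Y i ω + Z i ω) a := by
  refine of_large (fun i => (hY.1 i).add (hZ.1 i)) fun p hp => ⟨p, le_rfl, ?_⟩
  obtain ⟨C, hC, hCb⟩ := hY.2 p
  obtain ⟨D, hD, hDb⟩ := hZ.2 p
  refine ⟨C + D, add_nonneg hC hD, fun i => ?_⟩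
  refine (eLpNorm_add_le (hY.1 i) (hZ.1 i) (by exact_mod_cast hp)).trans ?_
  rw [add_mul, ENNReal.ofReal_add (mul_nonneg hC (ha i)) (mul_nonneg hD (ha i))]
  exact add_le_add (hCb i) (hDb i)

omit [IsProbabilityMeasure P] in
theorem neg (hY : LpBigO P Y a) : LpBigO P (fun i ω => -Y i ω) a :=
  hY.of_le (fun i => (hY.1 i).neg) fun i => Eventually.of_forall fun ω => (abs_neg _).le

theorem sub (hY : LpBigO P Y a) (hZ : LpBigO P Z a) (ha : ∀ i, 0 ≤ a i) :
    LpBigO P (fun i ω => Y i ω - Z i ω) a := by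
  simpa only [sub_eq_add_neg] using hY.add hZ.neg ha

omit [IsProbabilityMeasure P] in
theorem mul (hY : LpBigO P Y a) (hZ : LpBigO P Z b) (ha : ∀ i, 0 ≤ a i) :
    LpBigO P (fun i ω => Y i ω * Z i ω) fun i => a i * b i := by
  refine ⟨fun i => (hY.1 i).mul (hZ.1 i), fun p => ?_⟩
  obtain ⟨C, hC, hCb⟩ := hY.2 (2 * p)
  obtain ⟨D, hD, hDb⟩ := hZ.2 (2 * p)
  refine ⟨C * D, mul_nonneg hC hD, fun i => ?_⟩
  have : ENNReal.HolderTriple ((2 * p : ℕ) : ENNReal) ((2 * p : ℕ) : ENNReal) (p : ENNReal) := by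
    constructor
    push_cast
    rw [ENNReal.mul_inv (Or.inl two_ne_zero) (Or.inl ENNReal.ofNat_ne_top), ← add_mul,
      ENNReal.inv_two_add_inv_two, one_mul]
  refine (eLpNorm_smul_le_mul_eLpNorm (p := ((2 * p : ℕ) : ENNReal)) (q := ((2 * p : ℕ) : ENNReal))
    (hZ.1 i) (hY.1 i)).trans ?_
  have : C * D * (a i * b i) = (C * a i) * (D * b i) := by ring
  rw [this, ENNReal.ofReal_mul (mul_nonneg hC (ha i))]
  exact mul_le_mul' (hCb i) (hDb i)

theorem const (c : ι → ℝ) : LpBigO P (fun i _ => c i) fun i => |c i| := by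
  refine of_large (fun i => aestronglyMeasurable_const) fun p hp => ⟨p, le_rfl, 1, zero_le_one,
    fun i => ?_⟩
  rw [eLpNorm_const (c i) (by exact_mod_cast (by omega : p ≠ 0)) (IsProbabilityMeasure.ne_zero P)]
  simp [Real.enorm_eq_ofReal_abs]

theorem const_mul (h : LpBigO P Y a) (c : ℝ) : LpBigO P (fun i ω => c * Y i ω) a :=
  of_rate_mul (abs_nonneg c) ((const (P := P) fun _ : ι => c).mul h fun _ => abs_nonneg c)

/-- Sums of finitely many terms that are bounded uniformly. -/
theorem sum (s : ι → Finset κ) {W : ι → κ → Ω → ℝ}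
    (h : LpBigO P (fun x : {x : ι × κ // x.2 ∈ s x.1} => W x.1.1 x.1.2) fun x => a x.1.1)
    {n : ι → ℝ} (hn : ∀ i, ((s i).card : ℝ) ≤ n i) (ha : ∀ i, 0 ≤ a i) :
    LpBigO P (fun i ω => ∑ k ∈ s i, W i k ω) fun i => n i * a i := by
  have hm : ∀ i, ∀ k ∈ s i, AEStronglyMeasurable (W i k) P := fun i k hk => h.1 ⟨(i, k), hk⟩
  refine of_large (fun i => ?_) fun p hp => ⟨p, le_rfl, ?_⟩
  · exact Finset.aestronglyMeasurable_fun_sum (s i) (hm i)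
  · obtain ⟨C, hC, hb⟩ := h.2 p
    refine ⟨C, hC, fun i => ?_⟩
    have h1 := eLpNorm_sum_le (hm i) (p := p) (by exact_mod_cast hp)
    have h2 : (fun ω => ∑ k ∈ s i, W i k ω) = ∑ k ∈ s i, W i k := by
      funext ω; simp
    rw [h2]
    refine h1.trans ((Finset.sum_le_sum fun k hk =>
      show eLpNorm (W i k) p P ≤ ENNReal.ofReal (C * a i) from hb ⟨(i, k), hk⟩).trans ?_)
    rw [Finset.sum_const, nsmul_eq_mul, ← ENNReal.ofReal_natCast,
      ← ENNReal.ofReal_mul (Nat.cast_nonneg _)]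
    refine ENNReal.ofReal_le_ofReal ?_
    have := mul_le_mul_of_nonneg_right (hn i) (mul_nonneg hC (ha i))
    linarith

/-- An `L^p` bound on a `k`-th power is an `L^(kp)` bound on the variable. It serves to bound a term
at a random index by a sum of high powers over all indices. -/
theorem root {k : ℕ} (hk : 1 ≤ k) (h : LpBigO P Y fun i => a i ^ k) (ha : ∀ i, 0 ≤ a i)
    (hZ : ∀ i, AEStronglyMeasurable (Z i) P) (hle : ∀ i, ∀ᵐ ω ∂P, |Z i ω| ^ k ≤ |Y i ω|) :
    LpBigO P Z a := by
  refine of_large hZ fun p hp => ⟨k * p, Nat.le_mul_of_pos_left p hk, ?_⟩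
  obtain ⟨C, hC, hb⟩ := h.2 p
  refine ⟨C ^ ((1 : ℝ) / k), by positivity, fun i => ?_⟩
  have hk0 : (0 : ℝ) < k := by exact_mod_cast hk
  have h1 := eLpNorm_norm_rpow (p := (p : ENNReal)) (Z i) (μ := P) hk0
  have h2 : eLpNorm (fun x => ‖Z i x‖ ^ (k : ℝ)) p P ≤ ENNReal.ofReal (C * a i ^ k) := by
    refine le_trans (eLpNorm_mono_ae ?_) (hb i)
    filter_upwards [hle i] with ω hω
    simpa [Real.norm_eq_abs] using hω
  rw [h1, ENNReal.ofReal_natCast, mul_comm (p : ENNReal), ← Nat.cast_mul] at h2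
  have h3 : C * a i ^ k = (C ^ ((1 : ℝ) / k) * a i) ^ (k : ℝ) := by
    rw [Real.mul_rpow (by positivity) (ha i), ← Real.rpow_mul hC, one_div,
      inv_mul_cancel₀ hk0.ne', Real.rpow_one, Real.rpow_natCast]
  rw [h3, ← ENNReal.ofReal_rpow_of_nonneg (mul_nonneg (by positivity) (ha i)) hk0.le] at h2
  exact (ENNReal.rpow_le_rpow_iff hk0).1 h2

omit [IsProbabilityMeasure P] in
theorem memLp (h : LpBigO P Y a) (i : ι) (p : ℕ) : MemLp (Y i) p P := by
  obtain ⟨C, _, hb⟩ := h.2 p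
  exact ⟨h.1 i, (hb i).trans_lt ENNReal.ofReal_lt_top⟩

omit [IsProbabilityMeasure P] in
theorem integral_pow_le (h : LpBigO P Y a) (ha : ∀ i, 0 ≤ a i) {p : ℕ} (hp : Even p)
    (hp0 : 1 ≤ p) :
    ∃ C : ℝ, 0 ≤ C ∧ ∀ i, Integrable (fun ω => Y i ω ^ p) P ∧ ∫ ω, Y i ω ^ p ∂P ≤ C * a i ^ p := by
  obtain ⟨C, hC, hb⟩ := h.2 p
  refine ⟨C ^ p, by positivity, fun i => ?_⟩
  have hmem : MemLp (Y i) p P := ⟨h.1 i, (hb i).trans_lt ENNReal.ofReal_lt_top⟩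
  have hp' : (p : ENNReal) ≠ 0 := by exact_mod_cast (by omega : p ≠ 0)
  have heq : (fun ω => ‖Y i ω‖ ^ ((p : ENNReal).toReal)) = fun ω => Y i ω ^ p := by
    funext ω
    rw [ENNReal.toReal_natCast, Real.rpow_natCast, Real.norm_eq_abs, hp.pow_abs]
  have hint := (integrable_norm_rpow_iff (h.1 i) hp' (ENNReal.natCast_ne_top p)).2 hmem
  rw [heq] at hint
  refine ⟨hint, ?_⟩
  have h1 := hmem.eLpNorm_eq_integral_rpow_norm hp' (ENNReal.natCast_ne_top p)
  have h2 := hb i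
  rw [h1, ENNReal.ofReal_le_ofReal_iff (mul_nonneg hC (ha i)), heq] at h2
  have h0 : 0 ≤ ∫ ω, Y i ω ^ p ∂P := integral_nonneg fun ω => hp.pow_nonneg _
  have h3 := pow_le_pow_left₀ (by positivity) h2 p
  rw [← mul_pow]
  refine le_trans (le_of_eq ?_) h3
  rw [ENNReal.toReal_natCast, ← Real.rpow_natCast, ← Real.rpow_mul h0, inv_mul_cancel₀
    (by exact_mod_cast (by omega : p ≠ 0)), Real.rpow_one]

theorem of_integral_pow_le (hY : ∀ i, AEStronglyMeasurable (Y i) P) (ha : ∀ i, 0 ≤ a i)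
    (h : ∀ p : ℕ, 1 ≤ p → ∃ C : ℝ, 0 ≤ C ∧ ∀ i, Integrable (fun ω => Y i ω ^ (2 * p)) P ∧
      ∫ ω, Y i ω ^ (2 * p) ∂P ≤ C * a i ^ (2 * p)) : LpBigO P Y a := by
  refine of_large hY fun p hp => ⟨2 * p, by omega, ?_⟩
  obtain ⟨C, hC, hb⟩ := h p hp
  refine ⟨C ^ (((2 * p : ℕ) : ℝ)⁻¹), by positivity, fun i => ?_⟩
  have hp' : ((2 * p : ℕ) : ENNReal) ≠ 0 := by exact_mod_cast (by omega : 2 * p ≠ 0)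
  have hp2 : ((2 * p : ℕ) : ℝ) ≠ 0 := by exact_mod_cast (by omega : 2 * p ≠ 0)
  have heq : (fun ω => ‖Y i ω‖ ^ (((2 * p : ℕ) : ENNReal).toReal)) = fun ω => Y i ω ^ (2 * p) := by
    funext ω
    rw [ENNReal.toReal_natCast, Real.rpow_natCast, Real.norm_eq_abs, (even_two_mul p).pow_abs]
  have hmem : MemLp (Y i) ((2 * p : ℕ) : ENNReal) P := by
    refine (integrable_norm_rpow_iff (hY i) hp' (ENNReal.natCast_ne_top _)).1 ?_
    rw [heq]
    exact (hb i).1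
  rw [hmem.eLpNorm_eq_integral_rpow_norm hp' (ENNReal.natCast_ne_top _), heq]
  refine ENNReal.ofReal_le_ofReal ?_
  have h0 : 0 ≤ ∫ ω, Y i ω ^ (2 * p) ∂P := integral_nonneg fun ω => (even_two_mul p).pow_nonneg _
  refine (Real.rpow_le_rpow h0 (hb i).2 (by positivity)).trans (le_of_eq ?_)
  rw [ENNReal.toReal_natCast, Real.mul_rpow hC (pow_nonneg (ha i) _), ← Real.rpow_natCast (a i),
    ← Real.rpow_mul (ha i), mul_inv_cancel₀ hp2, Real.rpow_one]

end LpBigO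

theorem memLp_mul_all {Ω : Type*} [MeasurableSpace Ω] {P : Measure Ω} {f g : Ω → ℝ}
    (hf : ∀ p : ℕ, MemLp f p P) (hg : ∀ p : ℕ, MemLp g p P) (p : ℕ) :
    MemLp (fun ω => f ω * g ω) p P := by
  have : LpBigO P (fun (_ : Unit) b => f b * g b) fun _ => 1 * 1 := by
    refine LpBigO.mul (a := fun _ => 1) (b := fun _ => 1) ⟨fun _ => (hf 0).1, fun p => ?_⟩
      ⟨fun _ => (hg 0).1, fun p => ?_⟩ fun _ => zero_le_one
    · exact ⟨(eLpNorm f p P).toReal, ENNReal.toReal_nonneg, fun _ => by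
        rw [mul_one, ENNReal.ofReal_toReal (hf p).eLpNorm_ne_top]⟩
    · exact ⟨(eLpNorm g p P).toReal, ENNReal.toReal_nonneg, fun _ => by
        rw [mul_one, ENNReal.ofReal_toReal (hg p).eLpNorm_ne_top]⟩
  exact this.memLp () p

theorem memLp_pow_all {Ω : Type*} [MeasurableSpace Ω] {P : Measure Ω} [IsProbabilityMeasure P]
    {f : Ω → ℝ} (hf : ∀ p : ℕ, MemLp f p P) (r p : ℕ) : MemLp (fun ω => f ω ^ r) p P := by
  induction r generalizing p with
  | zero => simpa using memLp_const (1 : ℝ)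
  | succ r ih => simpa only [pow_succ] using memLp_mul_all ih hf p

/-! ### Martingale sums -/

/-- In the binomial expansion, every term of degree at least two in `y` contains `y ^ 2` times a
monomial bounded by `x ^ (2p-2) + y ^ (2p-2)`; the binomial coefficients sum to at most `4 ^ p`. The
linear term is kept, since it will integrate to zero. -/
theorem pow_expansion_le (x y : ℝ) {p : ℕ} (hp : 1 ≤ p) :
    (x + y) ^ (2 * p) ≤ x ^ (2 * p) + 2 * p * (x ^ (2 * p - 1) * y) +
      4 ^ p * (x ^ (2 * p - 2) * y ^ 2 + y ^ (2 * p)) := by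
  obtain ⟨m, rfl⟩ : ∃ m, p = m + 1 := ⟨p - 1, by omega⟩
  have h2 : 2 * (m + 1) = 2 * m + 2 := by ring
  rw [h2, add_comm x y, add_pow, Finset.sum_range_succ', Finset.sum_range_succ']
  simp only [Nat.sub_zero, pow_zero, one_mul, Nat.choose_zero_right, Nat.cast_one, mul_one,
    zero_add, pow_one, Nat.choose_one_right]
  have hterm : ∀ j ∈ Finset.range (2 * m + 1),
      y ^ (j + 1 + 1) * x ^ (2 * m + 2 - (j + 1 + 1)) * ((2 * m + 2).choose (j + 1 + 1) : ℝ) ≤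
      (x ^ (2 * m) * y ^ 2 + y ^ (2 * m + 2)) * ((2 * m + 2).choose (j + 1 + 1) : ℝ) := by
    intro j hj
    have hj' := Finset.mem_range.1 hj
    refine mul_le_mul_of_nonneg_right ?_ (Nat.cast_nonneg _)
    have e1 : 2 * m + 2 - (j + 1 + 1) = 2 * m - j := by omega
    have hy2 : 0 ≤ y ^ 2 := sq_nonneg y
    have hev : ∀ z : ℝ, |z| ^ (2 * m) = z ^ (2 * m) := fun z => (even_two_mul m).pow_abs z
    have h1 : y ^ j * x ^ (2 * m - j) ≤ x ^ (2 * m) + y ^ (2 * m) := by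
      refine (le_abs_self _).trans ?_
      rw [abs_mul, abs_pow, abs_pow, ← hev x, ← hev y]
      have e2 : 2 * m = j + (2 * m - j) := by omega
      rcases le_total |x| |y| with h | h
      · calc |y| ^ j * |x| ^ (2 * m - j) ≤ |y| ^ j * |y| ^ (2 * m - j) := by gcongr
          _ = |y| ^ (2 * m) := by rw [← pow_add, ← e2]
          _ ≤ _ := le_add_of_nonneg_left (by positivity)
      · calc |y| ^ j * |x| ^ (2 * m - j) ≤ |x| ^ j * |x| ^ (2 * m - j) := by gcongr
          _ = |x| ^ (2 * m) := by rw [← pow_add, ← e2]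
          _ ≤ _ := le_add_of_nonneg_right (by positivity)
    rw [e1]
    calc y ^ (j + 1 + 1) * x ^ (2 * m - j) = (y ^ j * x ^ (2 * m - j)) * y ^ 2 := by ring
      _ ≤ (x ^ (2 * m) + y ^ (2 * m)) * y ^ 2 := mul_le_mul_of_nonneg_right h1 hy2
      _ = _ := by ring
  have hsum := Finset.sum_le_sum hterm
  rw [← Finset.mul_sum] at hsum
  simp only [Nat.reduceSubDiff] at hsum
  have hch : ∑ j ∈ Finset.range (2 * m + 1), ((2 * m + 2).choose (j + 1 + 1) : ℝ) ≤ 4 ^ (m + 1) := by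
    have h1 := Nat.sum_range_choose (2 * m + 2)
    rw [Finset.sum_range_succ', Finset.sum_range_succ'] at h1
    have h3 : (2 : ℕ) ^ (2 * m + 2) = 4 ^ (m + 1) := by
      rw [show 2 * m + 2 = 2 * (m + 1) by ring, pow_mul]; norm_num
    rw [h3] at h1
    exact_mod_cast (by omega : ∑ j ∈ Finset.range (2 * m + 1), (2 * m + 2).choose (j + 1 + 1) ≤
      4 ^ (m + 1))
  have hpos : 0 ≤ x ^ (2 * m) * y ^ 2 + y ^ (2 * m + 2) := by
    have := (even_two_mul m).pow_nonneg x
    have h3 : Even (2 * m + 2) := ⟨m + 1, by ring⟩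
    have := h3.pow_nonneg y
    positivity
  have hfin := mul_le_mul_of_nonneg_left hch hpos
  have e3 : 2 * m + 2 - 1 = 2 * m + 1 := by omega
  have e4 : 2 * m + 2 - 2 = 2 * m := by omega
  rw [e3, e4]
  push_cast
  linarith

/-- Young's inequality with a parameter, by comparing `y ^ 2` with `x ^ 2 / K`. -/
theorem pow_split_le (x y : ℝ) {p : ℕ} (hp : 1 ≤ p) {K : ℝ} (hK : 0 < K) :
    x ^ (2 * p - 2) * y ^ 2 ≤ x ^ (2 * p) / K + K ^ (p - 1) * y ^ (2 * p) := by
  obtain ⟨m, rfl⟩ : ∃ m, p = m + 1 := ⟨p - 1, by omega⟩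
  have e4 : 2 * (m + 1) - 2 = 2 * m := by omega
  have e5 : 2 * (m + 1) = 2 * m + 2 := by omega
  rw [e4, e5, Nat.add_sub_cancel]
  have h1 : 0 ≤ x ^ (2 * m) := (even_two_mul m).pow_nonneg x
  have h2 : 0 ≤ y ^ (2 * m) := (even_two_mul m).pow_nonneg y
  have h3 : 0 ≤ y ^ 2 := sq_nonneg y
  have h4 : 0 ≤ x ^ 2 := sq_nonneg x
  rw [pow_add, pow_add]
  rcases le_total (y ^ 2) (x ^ 2 / K) with h | h
  · have := mul_le_mul_of_nonneg_left h h1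
    have h5 : 0 ≤ K ^ m * (y ^ (2 * m) * y ^ 2) := by positivity
    rw [← mul_div_assoc] at this
    linarith
  · have h5 : x ^ 2 ≤ K * y ^ 2 := by rw [div_le_iff₀ hK] at h; linarith
    have h6 : x ^ (2 * m) ≤ K ^ m * y ^ (2 * m) := by
      rw [pow_mul, pow_mul, ← mul_pow]
      exact pow_le_pow_left₀ h4 h5 m
    have h7 := mul_le_mul_of_nonneg_right h6 h3
    have h8 : 0 ≤ x ^ (2 * m) * x ^ 2 / K := by positivity
    linarith

section martingale

variable {X : Type*} [MeasurableSpace X] {ν : Measure X} [IsProbabilityMeasure ν]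

/-- A function of a sequence that depends only on the first `k` terms. -/
def DependsBefore {Y : Type*} (F : (ℕ → X) → Y) (k : ℕ) : Prop :=
  ∀ b b' : ℕ → X, (∀ i < k, b i = b' i) → F b = F b'

omit [MeasurableSpace X] in
theorem DependsBefore.mono {Y : Type*} {F : (ℕ → X) → Y} {k l : ℕ} (h : DependsBefore F k)
    (hkl : k ≤ l) : DependsBefore F l := fun b b' hb => h b b' fun i hi => hb i (hi.trans_le hkl)

/-- `F` sees only the coordinates before `k`, so it is independent of the `k`-th one. This makes the
sums below martingales when `g` is centred. -/
theorem integral_mul_eval {F : (ℕ → X) → ℝ} (hF : Measurable F) {k : ℕ} (hk : DependsBefore F k)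
    {g : X → ℝ} (hg : Measurable g) :
    ∫ b, F b * g (b k) ∂(Measure.infinitePi fun _ : ℕ => ν) =
      (∫ b, F b ∂(Measure.infinitePi fun _ : ℕ => ν)) * ∫ x, g x ∂ν := by
  have hm : Measurable fun b : ℕ → X => g (b k) := hg.comp (measurable_pi_apply k)
  have hind : IndepFun F (fun b : ℕ → X => g (b k)) (Measure.infinitePi fun _ : ℕ => ν) := by
    rw [indepFun_iff_measure_inter_preimage_eq_mul]
    intro s t hs ht
    have h1 : (fun b : ℕ → X => g (b k)) ⁻¹' t =
        shiftSeq k ⁻¹' ((fun b : ℕ → X => g (b 0)) ⁻¹' t) := rfl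
    have h2 : MeasurableSet ((fun b : ℕ → X => g (b 0)) ⁻¹' t) :=
      (hg.comp (measurable_pi_apply 0)) ht
    rw [h1, measure_inter_shiftSeq ν (hF hs) h2]
    · congr 1
      rw [← Measure.map_apply (measurable_shiftSeq k) h2, map_shiftSeq]
    · intro r r' h
      simp only [Set.mem_preimage, hk r r' h]
  rw [hind.integral_fun_mul_eq_mul_integral hF.aestronglyMeasurable hm.aestronglyMeasurable]
  congr 1
  conv_rhs => rw [← Measure.infinitePi_map_eval (fun _ : ℕ => ν) k]
  rw [integral_map (measurable_pi_apply k).aemeasurable hg.aestronglyMeasurable]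

theorem lpBigO_eval {f : X → ℝ} (hf : ∀ p : ℕ, MemLp f p ν) :
    LpBigO (Measure.infinitePi fun _ : ℕ => ν) (fun (k : ℕ) b => f (b k)) fun _ => 1 := by
  have hmp : ∀ k, MeasurePreserving (fun b : ℕ → X => b k) (Measure.infinitePi fun _ : ℕ => ν) ν :=
    fun k => measurePreserving_eval_infinitePi (fun _ : ℕ => ν) k
  refine ⟨fun k => (hf 0).1.comp_measurePreserving (hmp k), fun p => ?_⟩
  refine ⟨(eLpNorm f p ν).toReal, ENNReal.toReal_nonneg, fun k => ?_⟩
  have h1 := eLpNorm_comp_measurePreserving (p := (p : ENNReal)) (hf p).1 (hmp k)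
  rw [mul_one, ENNReal.ofReal_toReal (hf p).eLpNorm_ne_top, ← h1]
  rfl

variable {ι : Type*} {V : ι → ℕ → (ℕ → X) → ℝ} {g : X → ℝ}

theorem dependsBefore_martingale (hV : ∀ i k, DependsBefore (V i k) k) (i : ι) (m : ℕ) :
    DependsBefore (fun b => ∑ k ∈ Finset.range m, g (b k) * V i k b) m := by
  intro b b' h
  refine Finset.sum_congr rfl fun k hk => ?_
  have hk' := Finset.mem_range.1 hk
  rw [h k hk', (hV i k).mono hk'.le b b' h]

/-- A discrete Gronwall argument. Expanding the power of `M + D` at each step, the linear term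
vanishes by independence; the rest multiplies the moment by `1 + 4 ^ p / K` and adds a term of order
`K ^ (p - 1) * a ^ (2p)`. Over `K` steps the growth factor is at most `exp (4 ^ p)`, leaving the
order `K ^ p * a ^ (2p)`. -/
theorem integral_martingale_pow_le (hg : Measurable g) (hgp : ∀ p : ℕ, MemLp g p ν)
    (hg0 : ∫ x, g x ∂ν = 0) (hVm : ∀ i k, Measurable (V i k))
    (hV : ∀ i k, DependsBefore (V i k) k) (K : ι → ℕ) (hK : ∀ i, 1 ≤ K i) {a : ι → ℝ}
    (ha : ∀ i, 0 ≤ a i)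
    (hVa : LpBigO (Measure.infinitePi fun _ : ℕ => ν)
      (fun x : {x : ι × ℕ // x.2 < K x.1} => V x.1.1 x.1.2) fun x => a x.1.1) {p : ℕ}
    (hp : 1 ≤ p) :
    ∃ C : ℝ, 0 ≤ C ∧ ∀ i,
      Integrable (fun b => (∑ k ∈ Finset.range (K i), g (b k) * V i k b) ^ (2 * p))
        (Measure.infinitePi fun _ : ℕ => ν) ∧
      ∫ b, (∑ k ∈ Finset.range (K i), g (b k) * V i k b) ^ (2 * p)
        ∂(Measure.infinitePi fun _ : ℕ => ν) ≤ C * ((K i : ℝ) ^ p * a i ^ (2 * p)) := by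
  set P := Measure.infinitePi fun _ : ℕ => ν with hP
  have hD : LpBigO P (fun (x : {x : ι × ℕ // x.2 < K x.1}) b => g (b x.1.2) * V x.1.1 x.1.2 b)
      fun x => a x.1.1 := by
    have := ((lpBigO_eval hgp).comp fun x : {x : ι × ℕ // x.2 < K x.1} => x.1.2).mul hVa
      fun _ => zero_le_one
    simpa only [one_mul] using this
  obtain ⟨A, hA, hAb⟩ := hD.integral_pow_le (fun x => ha x.1.1) (even_two_mul p) (by omega)
  set M : ι → ℕ → (ℕ → X) → ℝ := fun i m b => ∑ k ∈ Finset.range m, g (b k) * V i k b with hM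
  have hMm : ∀ i m, Measurable (M i m) := fun i m =>
    Finset.measurable_fun_sum _ fun k _ => (hg.comp (measurable_pi_apply k)).mul (hVm i k)
  have hMp : ∀ i, ∀ m ≤ K i, ∀ r : ℕ, MemLp (M i m) r P := by
    intro i m hm r
    refine memLp_finsetSum _ fun k hk => ?_
    exact hD.memLp ⟨(i, k), (Finset.mem_range.1 hk).trans_le hm⟩ r
  have hpow : ∀ {f : (ℕ → X) → ℝ}, (∀ r : ℕ, MemLp f r P) → ∀ r s : ℕ,
      MemLp (fun b => f b ^ r) s P := fun hf r => memLp_pow_all hf r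
  refine ⟨(2 * 4 ^ p * A) * Real.exp (4 ^ p), by positivity, fun i => ?_⟩
  have hint : ∀ m ≤ K i, Integrable (fun b => M i m b ^ (2 * p)) P := fun m hm => by
    simpa using (hpow (hMp i m hm) (2 * p) 1).integrable (by simp)
  refine ⟨hint _ le_rfl, ?_⟩
  have hKi : (1 : ℝ) ≤ K i := by exact_mod_cast hK i
  have hstep : ∀ m < K i, ∫ b, M i (m + 1) b ^ (2 * p) ∂P ≤
      (1 + 4 ^ p / K i) * ∫ b, M i m b ^ (2 * p) ∂P +
        2 * 4 ^ p * A * ((K i : ℝ) ^ (p - 1) * a i ^ (2 * p)) := by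
    intro m hm
    obtain ⟨hDi, hDb⟩ := hAb ⟨(i, m), hm⟩
    simp only at hDi hDb
    have hcross : ∫ b, M i m b ^ (2 * p - 1) * (g (b m) * V i m b) ∂P = 0 := by
      have h1 : ∀ b, M i m b ^ (2 * p - 1) * (g (b m) * V i m b) =
          (M i m b ^ (2 * p - 1) * V i m b) * g (b m) := fun b => by ring
      simp_rw [h1]
      have h2 : DependsBefore (fun b => M i m b ^ (2 * p - 1) * V i m b) m := by
        intro b b' h
        have h3 : M i m b = M i m b' := dependsBefore_martingale hV i m b b' h
        simp only [h3, hV i m b b' h]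
      rw [integral_mul_eval (F := fun b => M i m b ^ (2 * p - 1) * V i m b)
        (((hMm i m).pow_const _).mul (hVm i m)) h2 hg, hg0, mul_zero]
    have hcross_int : Integrable (fun b => M i m b ^ (2 * p - 1) * (g (b m) * V i m b)) P := by
      have h1 := hpow (hMp i m hm.le) (2 * p - 1) 2
      have h2 := hD.memLp ⟨(i, m), hm⟩ 2
      exact MemLp.integrable_mul (by exact_mod_cast h1) (by exact_mod_cast h2)
    have hpt : ∀ b, M i (m + 1) b ^ (2 * p) ≤ ((1 + 4 ^ p / K i) * M i m b ^ (2 * p) +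
        2 * p * (M i m b ^ (2 * p - 1) * (g (b m) * V i m b))) +
        2 * 4 ^ p * (K i : ℝ) ^ (p - 1) * (g (b m) * V i m b) ^ (2 * p) := by
      intro b
      have h1 : M i (m + 1) b = M i m b + g (b m) * V i m b := Finset.sum_range_succ _ _
      rw [h1]
      have h2 := pow_expansion_le (M i m b) (g (b m) * V i m b) hp
      have h3 := pow_split_le (M i m b) (g (b m) * V i m b) hp (K := K i) (by linarith)
      have h4 : (1 : ℝ) ≤ (K i : ℝ) ^ (p - 1) := one_le_pow₀ hKi
      have h5 : 0 ≤ (g (b m) * V i m b) ^ (2 * p) := (even_two_mul p).pow_nonneg _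
      have h6 := mul_le_mul_of_nonneg_right h4 h5
      have h7 : (0 : ℝ) < 4 ^ p := by positivity
      have h8 := mul_le_mul_of_nonneg_left (add_le_add h3 h6) h7.le
      have h9 : 4 ^ p / (K i : ℝ) * M i m b ^ (2 * p) = 4 ^ p * (M i m b ^ (2 * p) / K i) := by
        ring
      rw [one_mul] at h8
      nlinarith
    have hab : Integrable (fun b => (1 + 4 ^ p / K i) * M i m b ^ (2 * p) +
        2 * p * (M i m b ^ (2 * p - 1) * (g (b m) * V i m b))) P :=
      ((hint m hm.le).const_mul _).add (hcross_int.const_mul _)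
    refine (integral_mono (hint _ hm) (hab.add (hDi.const_mul _)) hpt).trans ?_
    simp only [Pi.add_apply]
    rw [integral_add hab (hDi.const_mul _), integral_add ((hint m hm.le).const_mul _) (hcross_int.const_mul _), integral_const_mul,
      integral_const_mul, integral_const_mul, hcross, mul_zero, add_zero]
    have h1 : (0 : ℝ) ≤ 2 * 4 ^ p * (K i : ℝ) ^ (p - 1) := by positivity
    have h2 := mul_le_mul_of_nonneg_left hDb h1
    linarith
  set B : ℝ := 2 * 4 ^ p * A * ((K i : ℝ) ^ (p - 1) * a i ^ (2 * p)) with hB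
  have hB0 : 0 ≤ B := by have := pow_nonneg (ha i) (2 * p); positivity
  set r : ℝ := 1 + 4 ^ p / K i with hr
  have hr1 : 1 ≤ r := by rw [hr]; exact le_add_of_nonneg_right (by positivity)
  have hind : ∀ m ≤ K i, ∫ b, M i m b ^ (2 * p) ∂P ≤ m * r ^ m * B := by
    intro m
    induction m with
    | zero => intro _; simp [hM, zero_pow (by omega : 2 * p ≠ 0)]
    | succ m ih =>
      intro hm
      have h1 := hstep m hm
      have h2 := ih (by omega)
      have h3 := mul_le_mul_of_nonneg_left h2 (by linarith : 0 ≤ r)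
      have h4 : (1 : ℝ) ≤ r ^ (m + 1) := one_le_pow₀ hr1
      have h5 := mul_le_mul_of_nonneg_right h4 hB0
      push_cast
      rw [pow_succ] at h5 ⊢
      linarith
  have hrK : r ^ K i ≤ Real.exp (4 ^ p) := by
    have h1 : r ≤ Real.exp (4 ^ p / K i) := by
      rw [hr, add_comm]; exact Real.add_one_le_exp _
    calc r ^ K i ≤ Real.exp (4 ^ p / K i) ^ K i := pow_le_pow_left₀ (by linarith) h1 _
      _ = Real.exp (4 ^ p) := by
        rw [← Real.exp_nat_mul, mul_div_cancel₀ _ (by linarith : (K i : ℝ) ≠ 0)]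
  refine (hind _ le_rfl).trans ?_
  have h1 : (K i : ℝ) * r ^ K i * B ≤ K i * Real.exp (4 ^ p) * B := by gcongr
  refine h1.trans (le_of_eq ?_)
  have h2 : (K i : ℝ) ^ p = K i * (K i : ℝ) ^ (p - 1) := by
    rw [← pow_succ', Nat.sub_add_cancel hp]
  rw [hB, h2]
  ring

theorem lpBigO_martingale (hg : Measurable g) (hgp : ∀ p : ℕ, MemLp g p ν)
    (hg0 : ∫ x, g x ∂ν = 0) (hVm : ∀ i k, Measurable (V i k))
    (hV : ∀ i k, DependsBefore (V i k) k) (K : ι → ℕ) (hK : ∀ i, 1 ≤ K i) {a : ι → ℝ}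
    (ha : ∀ i, 0 ≤ a i)
    (hVa : LpBigO (Measure.infinitePi fun _ : ℕ => ν)
      (fun x : {x : ι × ℕ // x.2 < K x.1} => V x.1.1 x.1.2) fun x => a x.1.1) :
    LpBigO (Measure.infinitePi fun _ : ℕ => ν)
      (fun i b => ∑ k ∈ Finset.range (K i), g (b k) * V i k b) fun i => √(K i) * a i := by
  refine LpBigO.of_integral_pow_le (fun i => ?_) (fun i => mul_nonneg (Real.sqrt_nonneg _) (ha i))
    fun p hp => ?_
  · exact (Finset.measurable_fun_sum _ fun k _ =>
      (hg.comp (measurable_pi_apply k)).mul (hVm i k)).aestronglyMeasurable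
  · obtain ⟨C, hC, h⟩ := integral_martingale_pow_le hg hgp hg0 hVm hV K hK ha hVa hp
    refine ⟨C, hC, fun i => ⟨(h i).1, (h i).2.trans (le_of_eq ?_)⟩⟩
    rw [mul_pow, pow_mul (√(K i : ℝ)), Real.sq_sqrt (Nat.cast_nonneg _)]

end martingale

/-! ### The number of complete blocks before position `n` -/

theorem cutSeq_zero (b : ℕ → FinPerm) : cutSeq b 0 = 0 := rfl

theorem cutSeq_succ (b : ℕ → FinPerm) (k : ℕ) : cutSeq b (k + 1) = cutSeq b k + (b k).1 :=
  Finset.sum_range_succ _ _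

/-- The largest `k` such that the first `k` blocks fit into the first `n` positions. -/
def cutCount (b : ℕ → FinPerm) (n : ℕ) : ℕ := Nat.findGreatest (fun k => cutSeq b k ≤ n) n

theorem cutCount_le (b : ℕ → FinPerm) (n : ℕ) : cutCount b n ≤ n := Nat.findGreatest_le n

theorem cutSeq_cutCount_le (b : ℕ → FinPerm) (n : ℕ) : cutSeq b (cutCount b n) ≤ n :=
  Nat.findGreatest_spec (P := fun k => cutSeq b k ≤ n) (Nat.zero_le n)
    (by simp [cutSeq_zero])

section positive

variable {b : ℕ → FinPerm} (hb : ∀ k, 0 < (b k).1)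
include hb

theorem cutSeq_le_iff {k n : ℕ} : cutSeq b k ≤ n ↔ k ≤ cutCount b n := by
  refine ⟨fun h => Nat.le_findGreatest ?_ h, fun h =>
    ((cutSeq_strictMono hb).monotone h).trans (cutSeq_cutCount_le b n)⟩
  exact ((cutSeq_strictMono hb).le_apply).trans h

theorem lt_cutSeq_cutCount_succ (n : ℕ) : n < cutSeq b (cutCount b n + 1) := by
  by_contra! h
  have := (cutSeq_le_iff hb).1 h
  omega

theorem cutCount_zero : cutCount b 0 = 0 := Nat.le_zero.1 (cutCount_le b 0)

theorem cutCount_succ (n : ℕ) :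
    (cutCount b (n + 1) = cutCount b n ∧ n + 1 < cutSeq b (cutCount b n + 1)) ∨
      (cutCount b (n + 1) = cutCount b n + 1 ∧ cutSeq b (cutCount b n + 1) = n + 1) := by
  have h1 := lt_cutSeq_cutCount_succ hb n
  have h0 : cutCount b n ≤ cutCount b (n + 1) :=
    (cutSeq_le_iff hb).1 ((cutSeq_cutCount_le b n).trans (Nat.le_succ n))
  rcases Nat.lt_or_ge (n + 1) (cutSeq b (cutCount b n + 1)) with h | h
  · refine Or.inl ⟨le_antisymm ?_ h0, h⟩
    by_contra! h2
    have := (cutSeq_le_iff hb).2 (Nat.succ_le_of_lt h2)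
    simp only [Nat.succ_eq_add_one] at this
    omega
  · refine Or.inr ⟨le_antisymm ?_ ((cutSeq_le_iff hb).1 h), by omega⟩
    by_contra! h2
    have h3 := (cutSeq_le_iff hb).2 (Nat.succ_le_of_lt h2)
    have h4 := cutSeq_strictMono hb (Nat.lt_succ_self (cutCount b n + 1))
    simp only [Nat.succ_eq_add_one] at h3 h4
    omega

/-- Summation by parts: a sum over blocks weighted by their sizes is a sum over positions. -/
theorem sum_size_mul (V : ℕ → ℝ) (n : ℕ) :
    ∑ i ∈ Finset.range (cutCount b n), ((b i).1 : ℝ) * V i =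
      ∑ t ∈ Finset.range n, V (cutCount b t) -
        ((n : ℝ) - cutSeq b (cutCount b n)) * V (cutCount b n) := by
  induction n with
  | zero => simp [cutCount_zero hb, cutSeq_zero]
  | succ n ih =>
    rw [Finset.sum_range_succ]
    rcases cutCount_succ hb n with ⟨h, _⟩ | ⟨h, h1⟩
    · rw [h, ih]; push_cast; ring
    · have h2 := cutSeq_succ b (cutCount b n)
      have h3 : ((b (cutCount b n)).1 : ℝ) = (n + 1 : ℕ) - cutSeq b (cutCount b n) := by
        rw [← h1, h2]; push_cast; ring
      rw [h, Finset.sum_range_succ, ih, h3, h1]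
      push_cast
      ring

/-- The random range becomes a deterministic one with the indicator of `cutSeq b i ≤ n`, which
depends only on the blocks before `i`; the martingale bound then applies. The index `cutCount b n`
also meets this condition, so its term is subtracted. -/
theorem sum_range_cutCount (u : ℕ → ℝ) (n : ℕ) :
    ∑ i ∈ Finset.range (cutCount b n), u i =
      ∑ i ∈ Finset.range (n + 1), (if cutSeq b i ≤ n then u i else 0) - u (cutCount b n) := by
  have h1 : (Finset.range (n + 1)).filter (fun i => cutSeq b i ≤ n) =
      Finset.range (cutCount b n + 1) := by
    ext i
    have := cutCount_le b n
    simp only [Finset.mem_filter, Finset.mem_range, cutSeq_le_iff hb]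
    omega
  rw [← Finset.sum_filter, h1, Finset.sum_range_succ]
  ring

end positive

theorem sum_range_choose_eq (n d : ℕ) : ∑ t ∈ Finset.range n, t.choose d = n.choose (d + 1) := by
  induction n with
  | zero => simp
  | succ n ih => rw [Finset.sum_range_succ, ih, Nat.choose_succ_succ, add_comm]

theorem dependsBefore_cutSeq (k : ℕ) : DependsBefore (fun b => cutSeq b k) k := fun b b' h =>
  Finset.sum_congr rfl fun i hi => by rw [h i (Finset.mem_range.1 hi)]

theorem measurable_cutSeq (k : ℕ) : Measurable fun b : ℕ → FinPerm => cutSeq b k :=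
  Finset.measurable_fun_sum _ fun i _ =>
    (Measurable.of_discrete (f := fun B : FinPerm => B.1)).comp (measurable_pi_apply i)

theorem measurable_cutCount (n : ℕ) : Measurable fun b : ℕ → FinPerm => cutCount b n :=
  measurable_findGreatest fun k _ => measurableSet_le (measurable_cutSeq k) measurable_const

theorem measurable_at_cutCount {Y : Type*} [MeasurableSpace Y] {F : ℕ → (ℕ → FinPerm) → Y}
    (hF : ∀ k, Measurable (F k)) (n : ℕ) : Measurable fun b => F (cutCount b n) b := by
  have h : Measurable fun x : ℕ × (ℕ → FinPerm) => F x.1 x.2 :=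
    measurable_from_prod_countable_right hF
  exact h.comp ((measurable_cutCount n).prodMk measurable_id)

/-! ### Measurability and monotonicity of iterated sums -/

section sums

variable {d : ℕ}

theorem dependsBefore_strictSum {X : Type*} (f : Fin d → X → ℝ) (k : ℕ) :
    DependsBefore (fun b => strictSum f b k) k := by
  induction d generalizing k with
  | zero => intro b b' _; rfl
  | succ d ih =>
    intro b b' h
    refine Finset.sum_congr rfl fun i hi => ?_
    have hi' := Finset.mem_range.1 hi
    have h1 : strictSum (Fin.init f) b i = strictSum (Fin.init f) b' i :=
      (ih (Fin.init f) i).mono hi'.le b b' h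
    rw [h i hi', h1]

theorem measurable_strictSum (f : Fin d → FinPerm → ℝ) (k : ℕ) :
    Measurable fun b => strictSum f b k := by
  induction d generalizing k with
  | zero => exact measurable_const
  | succ d ih =>
    exact Finset.measurable_fun_sum _ fun i _ =>
      ((Measurable.of_discrete (f := f (Fin.last d))).comp (measurable_pi_apply i)).mul
        (ih (Fin.init f) i)

theorem measurable_weakSum (f : Fin d → FinPerm → ℝ) (k : ℕ) :
    Measurable fun b => weakSum f b k := by
  induction d generalizing k with
  | zero => exact measurable_const
  | succ d ih =>
    exact Finset.measurable_fun_sum _ fun i _ =>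
      ((Measurable.of_discrete (f := f (Fin.last d))).comp (measurable_pi_apply i)).mul
        (ih (Fin.init f) (i + 1))

variable {X : Type*} {f : Fin d → X → ℝ}

theorem strictSum_nonneg (hf : ∀ j x, 0 ≤ f j x) (b : ℕ → X) (k : ℕ) : 0 ≤ strictSum f b k := by
  induction d generalizing k with
  | zero => exact zero_le_one
  | succ d ih =>
    exact Finset.sum_nonneg fun i _ => mul_nonneg (hf _ _) (ih (fun j x => hf _ x) i)

theorem strictSum_mono (hf : ∀ j x, 0 ≤ f j x) (b : ℕ → X) : Monotone (strictSum f b) := by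
  cases d with
  | zero => exact fun _ _ _ => le_rfl
  | succ d =>
    refine monotone_nat_of_le_succ fun k => ?_
    rw [strictSum, strictSum, Finset.sum_range_succ]
    exact le_add_of_nonneg_right (mul_nonneg (hf _ _) (strictSum_nonneg (fun j x => hf _ x) b k))

theorem strictSum_le_weakSum (hf : ∀ j x, 0 ≤ f j x) (b : ℕ → X) (k : ℕ) :
    strictSum f b k ≤ weakSum f b k := by
  induction d generalizing k with
  | zero => exact le_rfl
  | succ d ih =>
    refine Finset.sum_le_sum fun i _ => mul_le_mul_of_nonneg_left ?_ (hf _ _)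
    exact (strictSum_mono (fun j x => hf _ x) b (Nat.le_succ i)).trans (ih (fun j x => hf _ x) _)

/-- Monotonicity allows evaluation at a random index at most `n` to be bounded by evaluation at `n`.
-/
theorem weakSum_sub_strictSum_mono (hf : ∀ j x, 0 ≤ f j x) (b : ℕ → X) :
    Monotone fun k => weakSum f b k - strictSum f b k := by
  cases d with
  | zero => exact fun _ _ _ => le_rfl
  | succ d =>
    refine monotone_nat_of_le_succ fun k => ?_
    simp only [strictSum, weakSum, Finset.sum_range_succ]
    have h1 := (strictSum_mono (f := Fin.init f) (fun j x => hf _ x) b (Nat.le_succ k)).trans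
      (strictSum_le_weakSum (f := Fin.init f) (fun j x => hf _ x) b (k + 1))
    have := mul_le_mul_of_nonneg_left h1 (hf (Fin.last d) (b k))
    linarith

end sums

/-! ### Moment bounds for iterated sums over blocks -/

/-- The law of an i.i.d. sequence of blocks. -/
abbrev iidLaw (ν : Measure FinPerm) : Measure (ℕ → FinPerm) := Measure.infinitePi fun _ : ℕ => ν

/-- Laws of non-empty permutations whose size has finite moments. -/
structure BlockLaw (ν : Measure FinPerm) : Prop where
  one_le : ∀ᵐ B ∂ν, 1 ≤ B.1
  memLp : ∀ p : ℕ, MemLp (fun B : FinPerm => (B.1 : ℝ)) p ν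

theorem BlockLaw.ae_pos {ν : Measure FinPerm} [IsProbabilityMeasure ν] (h : BlockLaw ν) :
    ∀ᵐ b ∂(iidLaw ν), ∀ k, 0 < (b k).1 := by
  refine ae_all_iff.2 fun k => ?_
  exact (measurePreserving_eval_infinitePi (fun _ : ℕ => ν) k).quasiMeasurePreserving.ae h.one_le

theorem BlockLaw.one_le_integral {ν : Measure FinPerm} [IsProbabilityMeasure ν] (h : BlockLaw ν) :
    1 ≤ ∫ B, (B.1 : ℝ) ∂ν := by
  have h1 : ∫ _, (1 : ℝ) ∂ν ≤ ∫ B, (B.1 : ℝ) ∂ν := by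
    refine integral_mono_ae (integrable_const 1) ((h.memLp 1).integrable (by simp)) ?_
    filter_upwards [h.one_le] with B hB
    exact_mod_cast hB
  simpa using h1

section bounds

variable {ν : Measure FinPerm} [IsProbabilityMeasure ν] {d : ℕ} {f : Fin d → FinPerm → ℝ}

theorem lpBigO_strictSum (hfp : ∀ j (p : ℕ), MemLp (f j) p ν) :
    LpBigO (iidLaw ν) (fun k b => strictSum f b k) fun k => ((k : ℝ) + 1) ^ d := by
  induction d with
  | zero =>
    have := LpBigO.const (P := iidLaw ν) fun _ : ℕ => (1 : ℝ)
    simpa [strictSum] using this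
  | succ d ih =>
    have h1 : LpBigO (iidLaw ν)
        (fun (x : {x : ℕ × ℕ // x.2 ∈ Finset.range x.1}) b =>
          f (Fin.last d) (b x.1.2) * strictSum (Fin.init f) b x.1.2)
        fun x => ((x.1.1 : ℝ) + 1) ^ d := by
      refine (((lpBigO_eval (hfp (Fin.last d))).comp
        fun x : {x : ℕ × ℕ // x.2 ∈ Finset.range x.1} => x.1.2).mul
        ((ih (f := Fin.init f) fun j => hfp _).comp
          fun x : {x : ℕ × ℕ // x.2 ∈ Finset.range x.1} => x.1.2)
        fun _ => zero_le_one).mono_rate fun x => ?_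
      have := Finset.mem_range.1 x.2
      rw [one_mul]
      gcongr
    have h2 := LpBigO.sum (fun n : ℕ => Finset.range n)
      (W := fun n k b => f (Fin.last d) (b k) * strictSum (Fin.init f) b k)
      (a := fun n : ℕ => ((n : ℝ) + 1) ^ d) h1 (n := fun n : ℕ => (n : ℝ) + 1)
      (fun i => by simp) fun i => by positivity
    simpa only [strictSum, pow_succ'] using h2

/-- A coincidence of two consecutive indices loses one summation. In the induction the difference
splits into a coincidence among the inner indices and one between the last two. -/
theorem lpBigO_weakSum_sub {f : Fin (d + 1) → FinPerm → ℝ} (hf : ∀ j x, 0 ≤ f j x)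
    (hfp : ∀ j (p : ℕ), MemLp (f j) p ν) :
    LpBigO (iidLaw ν) (fun k b => weakSum f b k - strictSum f b k) fun k => ((k : ℝ) + 1) ^ d := by
  induction d with
  | zero =>
    have := LpBigO.const (P := iidLaw ν) fun _ : ℕ => (0 : ℝ)
    refine LpBigO.mono_rate (a := fun _ => |0|) ?_ fun k => by simp
    simpa [strictSum, weakSum] using this
  | succ d ih =>
    have hle : ∀ {k n : ℕ}, k ∈ Finset.range n → (((k + 1 : ℕ) : ℝ) + 1) ^ d ≤ ((n : ℝ) + 1) ^ d := by
      intro k n hk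
      have := Finset.mem_range.1 hk
      gcongr
      omega
    have h0 : LpBigO (iidLaw ν) (fun (k : ℕ) b => (weakSum (Fin.init f) b (k + 1) -
        strictSum (Fin.init f) b (k + 1)) + f (Fin.castSucc (Fin.last d)) (b k) *
          strictSum (Fin.init (Fin.init f)) b k) fun k => (((k + 1 : ℕ) : ℝ) + 1) ^ d := by
      refine ((ih (f := Fin.init f) (fun j x => hf _ x) fun j => hfp _).comp fun k : ℕ => k + 1).add
        ((((lpBigO_eval (hfp _)).mul (lpBigO_strictSum (f := Fin.init (Fin.init f))
          fun j => hfp _) fun _ => zero_le_one)).mono_rate fun k => ?_) fun k => by positivity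
      rw [one_mul]
      gcongr
      omega
    have h1 : LpBigO (iidLaw ν)
        (fun (x : {x : ℕ × ℕ // x.2 ∈ Finset.range x.1}) b =>
          f (Fin.last (d + 1)) (b x.1.2) * (weakSum (Fin.init f) b (x.1.2 + 1) -
            strictSum (Fin.init f) b x.1.2))
        fun x => ((x.1.1 : ℝ) + 1) ^ d := by
      have h0' : LpBigO (iidLaw ν) (fun (k : ℕ) b => weakSum (Fin.init f) b (k + 1) -
          strictSum (Fin.init f) b k) fun k => (((k + 1 : ℕ) : ℝ) + 1) ^ d := by
        convert h0 using 3 with k b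
        have : strictSum (Fin.init f) b (k + 1) = strictSum (Fin.init f) b k +
            f (Fin.castSucc (Fin.last d)) (b k) * strictSum (Fin.init (Fin.init f)) b k :=
          Finset.sum_range_succ _ _
        rw [this]; ring
      refine (((lpBigO_eval (hfp (Fin.last (d + 1)))).comp
        fun x : {x : ℕ × ℕ // x.2 ∈ Finset.range x.1} => x.1.2).mul
        (h0'.comp fun x : {x : ℕ × ℕ // x.2 ∈ Finset.range x.1} => x.1.2)
        fun _ => zero_le_one).mono_rate fun x => ?_
      rw [one_mul]
      exact hle x.2
    have h2 := LpBigO.sum (fun n : ℕ => Finset.range n)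
      (W := fun n k b => f (Fin.last (d + 1)) (b k) * (weakSum (Fin.init f) b (k + 1) -
        strictSum (Fin.init f) b k))
      (a := fun n : ℕ => ((n : ℝ) + 1) ^ d) h1 (n := fun n : ℕ => (n : ℝ) + 1)
      (fun i => by simp) fun i => by positivity
    simp only [pow_succ']
    convert h2 using 3 with n b
    rw [weakSum, strictSum, ← Finset.sum_sub_distrib]
    exact Finset.sum_congr rfl fun i _ => (mul_sub _ _ _).symm

/-- The block at the random index is size-biased and need not have the law `ν`, but its fourth power
is at most the sum of all fourth powers up to `n`; this costs a factor `n ^ (1/4)`, below the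
required `n ^ (1/2)`. -/
theorem lpBigO_at_cutCount {χ : FinPerm → ℝ} (hχ : ∀ p : ℕ, MemLp χ p ν) :
    LpBigO (iidLaw ν) (fun n b => χ (b (cutCount b n))) fun n => √√((n : ℝ) + 1) := by
  have h1 : LpBigO (iidLaw ν) (fun (n : ℕ) b => ∑ i ∈ Finset.range (n + 1), χ (b i) ^ 4)
      fun n => ((n : ℝ) + 1) * 1 := by
    refine LpBigO.sum (fun n : ℕ => Finset.range (n + 1))
      (W := fun _ i (b : ℕ → FinPerm) => χ (b i) ^ 4) (a := fun _ => 1) (n := fun n : ℕ => (n : ℝ) + 1) ?_ (fun n => by simp) fun _ => zero_le_one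
    exact (lpBigO_eval (memLp_pow_all hχ 4)).comp _
  refine LpBigO.root (k := 4) (by norm_num) (h1.mono_rate fun n => ?_)
    (fun n => Real.sqrt_nonneg _) (fun n => ?_) fun n => Eventually.of_forall fun b => ?_
  · rw [show 4 = 2 * 2 from rfl, pow_mul, Real.sq_sqrt (Real.sqrt_nonneg _),
      Real.sq_sqrt (by positivity), mul_one]
  · exact (measurable_at_cutCount (F := fun k b => χ (b k))
      (fun k => (Measurable.of_discrete (f := χ)).comp (measurable_pi_apply k)) n).aestronglyMeasurable
  · have h4 : Even 4 := ⟨2, rfl⟩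
    rw [h4.pow_abs, abs_of_nonneg (Finset.sum_nonneg fun i _ => h4.pow_nonneg _)]
    exact Finset.single_le_sum (f := fun i => χ (b i) ^ 4) (fun i _ => h4.pow_nonneg _)
      (Finset.mem_range.2 (Nat.lt_succ_of_le (cutCount_le b n)))

theorem lpBigO_strictSum_cutCount (hf : ∀ j x, 0 ≤ f j x) (hfp : ∀ j (p : ℕ), MemLp (f j) p ν) :
    LpBigO (iidLaw ν) (fun n b => strictSum f b (cutCount b n)) fun n => ((n : ℝ) + 1) ^ d := by
  refine (lpBigO_strictSum hfp).of_le (fun n => (measurable_at_cutCount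
    (F := fun k b => strictSum f b k) (measurable_strictSum f) n).aestronglyMeasurable)
    fun n => Eventually.of_forall fun b => ?_
  rw [abs_of_nonneg (strictSum_nonneg hf _ _), abs_of_nonneg (strictSum_nonneg hf _ _)]
  exact strictSum_mono hf b (cutCount_le b n)

/-- The asymptotic frequency `E f / E|B|`. -/
def freq (ν : Measure FinPerm) (f : FinPerm → ℝ) : ℝ := (∫ B, f B ∂ν) / ∫ B, (B.1 : ℝ) ∂ν

/-- The centred function `f - freq f * |B|`. -/
def centred (ν : Measure FinPerm) (f : FinPerm → ℝ) (B : FinPerm) : ℝ := f B - freq ν f * B.1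

omit [IsProbabilityMeasure ν] in
theorem memLp_centred (hν : BlockLaw ν) {f : FinPerm → ℝ} (hf : ∀ p : ℕ, MemLp f p ν) (p : ℕ) :
    MemLp (centred ν f) p ν :=
  (hf p).sub ((hν.memLp p).const_mul _)

theorem integral_centred (hν : BlockLaw ν) {f : FinPerm → ℝ} (hf : ∀ p : ℕ, MemLp f p ν) :
    ∫ B, centred ν f B ∂ν = 0 := by
  have h1 : Integrable f ν := (hf 1).integrable (by simp)
  have h2 : Integrable (fun B : FinPerm => (B.1 : ℝ)) ν := (hν.memLp 1).integrable (by simp)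
  have h3 := hν.one_le_integral
  unfold centred
  rw [integral_sub h1 (h2.const_mul _), integral_const_mul, freq, div_mul_cancel₀, sub_self]
  linarith

/-- The centred iterated sum at position `n`. -/
def centredSum (ν : Measure FinPerm) {d : ℕ} (f : Fin d → FinPerm → ℝ) (n : ℕ)
    (b : ℕ → FinPerm) : ℝ :=
  strictSum f b (cutCount b n) - (∏ j, freq ν (f j)) * n.choose d

omit [IsProbabilityMeasure ν] in
theorem centredSum_zero (f : Fin 0 → FinPerm → ℝ) (n : ℕ) (b : ℕ → FinPerm) :
    centredSum ν f n b = 0 := by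
  simp [centredSum, strictSum]

omit [IsProbabilityMeasure ν] in
theorem measurable_centredSum (f : Fin d → FinPerm → ℝ) (n : ℕ) :
    Measurable (centredSum ν f n) :=
  (measurable_at_cutCount (F := fun k b => strictSum f b k) (measurable_strictSum f) n).sub
    measurable_const

/-- The martingale part of the centred iterated sum. -/
def blockMartingale (ν : Measure FinPerm) {d : ℕ} (f : Fin (d + 1) → FinPerm → ℝ) (n : ℕ)
    (b : ℕ → FinPerm) : ℝ :=
  ∑ i ∈ Finset.range (n + 1), centred ν (f (Fin.last d)) (b i) *
    (if cutSeq b i ≤ n then strictSum (Fin.init f) b i else 0)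

/-- The boundary part of the centred iterated sum. -/
def blockBoundary (ν : Measure FinPerm) {d : ℕ} (f : Fin (d + 1) → FinPerm → ℝ) (n : ℕ)
    (b : ℕ → FinPerm) : ℝ :=
  (centred ν (f (Fin.last d)) (b (cutCount b n)) +
    freq ν (f (Fin.last d)) * ((n : ℝ) - cutSeq b (cutCount b n))) *
      strictSum (Fin.init f) b (cutCount b n)

/-- The last factor is written as its centred version plus `freq` times the size. The first part
gives the martingale; by `sum_size_mul`, the second becomes a sum over positions of iterated sums
with one factor less. The cut-off at `n` leaves the boundary term. -/
theorem centredSum_succ {f : Fin (d + 1) → FinPerm → ℝ} {b : ℕ → FinPerm}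
    (hb : ∀ k, 0 < (b k).1) (n : ℕ) :
    centredSum ν f n b = blockMartingale ν f n b - blockBoundary ν f n b +
      freq ν (f (Fin.last d)) * ∑ t ∈ Finset.range n, centredSum ν (Fin.init f) t b := by
  have h1 : strictSum f b (cutCount b n) =
      ∑ i ∈ Finset.range (cutCount b n), centred ν (f (Fin.last d)) (b i) *
        strictSum (Fin.init f) b i +
      freq ν (f (Fin.last d)) * ∑ i ∈ Finset.range (cutCount b n),
        ((b i).1 : ℝ) * strictSum (Fin.init f) b i := by
    rw [strictSum, Finset.mul_sum, ← Finset.sum_add_distrib]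
    exact Finset.sum_congr rfl fun i _ => by rw [centred]; ring
  have h2 : ∑ t ∈ Finset.range n, centredSum ν (Fin.init f) t b =
      ∑ t ∈ Finset.range n, strictSum (Fin.init f) b (cutCount b t) -
        (∏ j, freq ν (Fin.init f j)) * n.choose (d + 1) := by
    simp only [centredSum]
    rw [Finset.sum_sub_distrib, ← Finset.mul_sum, ← sum_range_choose_eq n d]
    push_cast
    rfl
  have h3 : ∀ i, (if cutSeq b i ≤ n then centred ν (f (Fin.last d)) (b i) *
      strictSum (Fin.init f) b i else 0) = centred ν (f (Fin.last d)) (b i) *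
      (if cutSeq b i ≤ n then strictSum (Fin.init f) b i else 0) := fun i => by
    split_ifs <;> simp
  rw [centredSum, h1, sum_range_cutCount hb, sum_size_mul hb, h2, blockMartingale, blockBoundary,
    Fin.prod_univ_castSucc]
  simp only [h3, Fin.init]
  ring

theorem dependsBefore_indicator (f : Fin d → FinPerm → ℝ) (n i : ℕ) :
    DependsBefore (fun b => if cutSeq b i ≤ n then strictSum f b i else 0) i := by
  intro b b' h
  have h1 : cutSeq b i = cutSeq b' i := dependsBefore_cutSeq i b b' h
  have h2 : strictSum f b i = strictSum f b' i := dependsBefore_strictSum f i b b' h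
  simp only [h1, h2]

theorem measurable_indicator (f : Fin d → FinPerm → ℝ) (n i : ℕ) :
    Measurable fun b => if cutSeq b i ≤ n then strictSum f b i else 0 :=
  Measurable.ite (measurableSet_le (measurable_cutSeq i) measurable_const)
    (measurable_strictSum f i) measurable_const

theorem lpBigO_blockMartingale {f : Fin (d + 1) → FinPerm → ℝ} (hν : BlockLaw ν)
    (hfp : ∀ j (p : ℕ), MemLp (f j) p ν) :
    LpBigO (iidLaw ν) (blockMartingale ν f) fun n => √((n : ℝ) + 1) * ((n : ℝ) + 1) ^ d := by
  have hV : LpBigO (iidLaw ν) (fun (x : {x : ℕ × ℕ // x.2 < x.1 + 1}) b =>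
      if cutSeq b x.1.2 ≤ x.1.1 then strictSum (Fin.init f) b x.1.2 else 0)
      fun x => ((x.1.1 : ℝ) + 1) ^ d := by
    refine (((lpBigO_strictSum (f := Fin.init f) fun j => hfp _).comp
      fun x : {x : ℕ × ℕ // x.2 < x.1 + 1} => x.1.2).mono_rate fun x => ?_).of_le
      (fun x => (measurable_indicator _ _ _).aestronglyMeasurable)
      fun x => Eventually.of_forall fun b => ?_
    · have := Nat.lt_succ_iff.1 x.2
      gcongr
    · split_ifs
      · exact le_rfl
      · rw [abs_zero]; exact abs_nonneg _
  have := lpBigO_martingale (V := fun n i b => if cutSeq b i ≤ n then strictSum (Fin.init f) b i else 0)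
    (Measurable.of_discrete (f := centred ν (f (Fin.last d)))) (memLp_centred hν (hfp _))
    (integral_centred hν (hfp _)) (fun n i => measurable_indicator _ _ _)
    (fun n i => dependsBefore_indicator _ _ _) (fun n => n + 1) (fun n => Nat.le_add_left 1 n)
    (a := fun n => ((n : ℝ) + 1) ^ d) (fun n => by positivity) hV
  simp only [Nat.cast_add, Nat.cast_one] at this
  exact this

/-- Only the block straddling position `n` contributes, and `n - cutSeq b (cutCount b n)` is at most
its size. -/
theorem lpBigO_blockBoundary {f : Fin (d + 1) → FinPerm → ℝ} (hν : BlockLaw ν)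
    (hf : ∀ j x, 0 ≤ f j x) (hfp : ∀ j (p : ℕ), MemLp (f j) p ν) :
    LpBigO (iidLaw ν) (blockBoundary ν f) fun n => √√((n : ℝ) + 1) * ((n : ℝ) + 1) ^ d := by
  have h1 : ∀ p : ℕ, MemLp (fun B : FinPerm => |centred ν (f (Fin.last d)) B| +
      |freq ν (f (Fin.last d))| * B.1) p ν := fun p =>
    (memLp_centred hν (hfp _) p).abs.add ((hν.memLp p).const_mul _)
  refine ((lpBigO_at_cutCount h1).mul (lpBigO_strictSum_cutCount (f := Fin.init f)
    (fun j x => hf _ x) fun j => hfp _) fun n => Real.sqrt_nonneg _).of_le (fun n => ?_) fun n => ?_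
  · refine Measurable.aestronglyMeasurable ?_
    refine measurable_at_cutCount (F := fun k b => (centred ν (f (Fin.last d)) (b k) +
      freq ν (f (Fin.last d)) * ((n : ℝ) - cutSeq b k)) * strictSum (Fin.init f) b k) (fun k => ?_) n
    refine Measurable.mul (Measurable.add ?_ (measurable_const.mul (measurable_const.sub ?_)))
      (measurable_strictSum _ k)
    · exact (Measurable.of_discrete (f := centred ν (f (Fin.last d)))).comp (measurable_pi_apply k)
    · exact (Measurable.of_discrete (f := fun m : ℕ => (m : ℝ))).comp (measurable_cutSeq k)
  · filter_upwards [hν.ae_pos] with b hb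
    rw [blockBoundary, abs_mul, abs_mul]
    refine mul_le_mul_of_nonneg_right ?_ (abs_nonneg _)
    refine le_trans ?_ (le_abs_self _)
    refine (abs_add_le _ _).trans ?_
    rw [abs_mul]
    have h2 : |(n : ℝ) - cutSeq b (cutCount b n)| ≤ (b (cutCount b n)).1 := by
      have h3 : (cutSeq b (cutCount b n) : ℝ) ≤ n := by exact_mod_cast cutSeq_cutCount_le b n
      have h4 := (lt_cutSeq_cutCount_succ hb n).le
      rw [cutSeq_succ] at h4
      have h5 : (n : ℝ) ≤ cutSeq b (cutCount b n) + (b (cutCount b n)).1 := by exact_mod_cast h4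
      rw [abs_of_nonneg (by linarith)]
      linarith
    gcongr

theorem sqrt_sqrt_le (n : ℕ) : √√((n : ℝ) + 1) ≤ √((n : ℝ) + 1) := by
  refine Real.sqrt_le_sqrt ?_
  have h1 : (1 : ℝ) ≤ (n : ℝ) + 1 := by linarith [(Nat.cast_nonneg n : (0 : ℝ) ≤ n)]
  have h2 := Real.sq_sqrt (by linarith : (0 : ℝ) ≤ (n : ℝ) + 1)
  have h3 := Real.one_le_sqrt.2 h1
  nlinarith

/-- In the recursion the martingale has the stated order, the boundary is smaller, and summing the
induction hypothesis over positions gains one factor `n`. -/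
theorem lpBigO_centredSum {f : Fin (d + 1) → FinPerm → ℝ} (hν : BlockLaw ν)
    (hf : ∀ j x, 0 ≤ f j x) (hfp : ∀ j (p : ℕ), MemLp (f j) p ν) :
    LpBigO (iidLaw ν) (centredSum ν f) fun n => √((n : ℝ) + 1) * ((n : ℝ) + 1) ^ d := by
  induction d with
  | zero =>
    refine ((lpBigO_blockMartingale hν hfp).sub ((lpBigO_blockBoundary hν hf hfp).mono_rate
      fun n => mul_le_mul_of_nonneg_right (sqrt_sqrt_le n) (by positivity))
      fun n => by positivity).of_le (fun n => (measurable_centredSum f n).aestronglyMeasurable)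
      fun n => ?_
    filter_upwards [hν.ae_pos] with b hb
    rw [centredSum_succ hb]
    simp [centredSum_zero]
  | succ d ih =>
    have h1 := ih (f := Fin.init f) (fun j x => hf _ x) fun j => hfp _
    have h2 : LpBigO (iidLaw ν) (fun n b => ∑ t ∈ Finset.range n, centredSum ν (Fin.init f) t b)
        fun n => ((n : ℝ) + 1) * (√((n : ℝ) + 1) * ((n : ℝ) + 1) ^ d) := by
      refine LpBigO.sum (fun n : ℕ => Finset.range n) (W := fun n t b => centredSum ν (Fin.init f) t b)
        ((h1.comp fun x : {x : ℕ × ℕ // x.2 ∈ Finset.range x.1} => x.1.2).mono_rate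
          fun x => ?_) (fun n => by simp) fun n => by positivity
      have := Finset.mem_range.1 x.2
      gcongr
    refine (((lpBigO_blockMartingale hν hfp).sub ((lpBigO_blockBoundary hν hf hfp).mono_rate
      fun n => mul_le_mul_of_nonneg_right (sqrt_sqrt_le n) (by positivity))
      fun n => by positivity).add ((h2.const_mul (freq ν (f (Fin.last (d + 1))))).mono_rate
        fun n => ?_) fun n => by positivity).of_le
      (fun n => (measurable_centredSum f n).aestronglyMeasurable) fun n => ?_
    · rw [pow_succ]; exact le_of_eq (by ring)
    · filter_upwards [hν.ae_pos] with b hb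
      rw [centredSum_succ hb]

/-- The gap between the two bounds on the pattern count is the monotone difference `weakSum -
strictSum` at one more block, plus the contribution of the straddling block to the strict sum. -/
theorem lpBigO_remainder {f : Fin (d + 1) → FinPerm → ℝ} (hf : ∀ j x, 0 ≤ f j x)
    (hfp : ∀ j (p : ℕ), MemLp (f j) p ν) :
    LpBigO (iidLaw ν) (fun n b => weakSum f b (cutCount b n + 1) - strictSum f b (cutCount b n))
      fun n => √√((n : ℝ) + 1) * ((n : ℝ) + 1) ^ d := by
  have h1 := (lpBigO_weakSum_sub hf hfp).comp fun n : ℕ => n + 1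
  have h2 := (lpBigO_at_cutCount (hfp (Fin.last d))).mul
    (lpBigO_strictSum_cutCount (f := Fin.init f) (fun j x => hf _ x) fun j => hfp _)
    fun n => Real.sqrt_nonneg _
  have h3 : LpBigO (iidLaw ν) (fun (n : ℕ) b => weakSum f b (n + 1) - strictSum f b (n + 1))
      fun n => √√((n : ℝ) + 1) * ((n : ℝ) + 1) ^ d := by
    refine LpBigO.of_rate_mul (c := 2 ^ d) (by positivity) (h1.mono_rate fun n => ?_)
    have h4 : (1 : ℝ) ≤ √√((n : ℝ) + 1) :=
      Real.one_le_sqrt.2 (Real.one_le_sqrt.2 (by linarith [(Nat.cast_nonneg n : (0 : ℝ) ≤ n)]))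
    have h5 : (((n + 1 : ℕ) : ℝ) + 1) ^ d ≤ (2 * ((n : ℝ) + 1)) ^ d := by
      gcongr; push_cast; linarith
    rw [mul_pow] at h5
    refine h5.trans (mul_le_mul_of_nonneg_left ?_ (by positivity))
    exact le_mul_of_one_le_left (by positivity) h4
  refine (h3.add h2 fun n => by positivity).of_le (fun n => ?_) fun n =>
    Eventually.of_forall fun b => ?_
  · exact ((measurable_at_cutCount (F := fun k b => weakSum f b (k + 1))
      (fun k => measurable_weakSum f (k + 1)) n).sub (measurable_at_cutCount
      (F := fun k b => strictSum f b k) (measurable_strictSum f) n)).aestronglyMeasurable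
  · have h4 : strictSum f b (cutCount b n + 1) = strictSum f b (cutCount b n) +
        f (Fin.last d) (b (cutCount b n)) * strictSum (Fin.init f) b (cutCount b n) :=
      Finset.sum_range_succ _ _
    have h5 := weakSum_sub_strictSum_mono hf b (Nat.succ_le_succ (cutCount_le b n))
    have h6 := (strictSum_mono hf b (Nat.le_succ (cutCount b n))).trans
      (strictSum_le_weakSum hf b (cutCount b n + 1))
    simp only [Nat.succ_eq_add_one] at h5 h6
    rw [abs_of_nonneg (by linarith)]
    refine le_trans ?_ (le_abs_self _)
    linarith

end bounds

/-! ### The law of large numbers -/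

/-- After normalization the fourth moments are of order `1 / n ^ 2`, hence summable, so the fourth
powers are almost surely summable. The proof divides by powers of `n + 1` and only at the end
returns to powers of `n`. -/
theorem LpBigO.ae_tendsto_zero {Ω : Type*} [MeasurableSpace Ω] {P : Measure Ω}
    {Y : ℕ → Ω → ℝ} {d : ℕ} (h : LpBigO P Y fun n => √((n : ℝ) + 1) * ((n : ℝ) + 1) ^ d) :
    ∀ᵐ ω ∂P, Tendsto (fun n : ℕ => Y n ω / (n : ℝ) ^ (d + 1)) atTop (𝓝 0) := by
  obtain ⟨C, hC, hb⟩ := h.integral_pow_le (fun n => by positivity) (p := 4) ⟨2, rfl⟩ (by norm_num)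
  set Z : ℕ → Ω → ℝ := fun n ω => (Y n ω / ((n : ℝ) + 1) ^ (d + 1)) ^ 4 with hZ
  have hZ0 : ∀ n ω, 0 ≤ Z n ω := fun n ω => Even.pow_nonneg ⟨2, rfl⟩ _
  have hZi : ∀ n, Integrable (Z n) P ∧ ∫ ω, Z n ω ∂P ≤ C * (1 / ((n : ℝ) + 1) ^ 2) := by
    intro n
    have h1 : Z n = fun ω => (1 / ((n : ℝ) + 1) ^ (4 * (d + 1))) * Y n ω ^ 4 := by
      funext ω
      simp only [hZ, div_pow, ← pow_mul]
      rw [mul_comm (d + 1) 4]; ring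
    rw [h1]
    refine ⟨(hb n).1.const_mul _, ?_⟩
    rw [integral_const_mul]
    have h2 := mul_le_mul_of_nonneg_left (hb n).2
      (by positivity : 0 ≤ 1 / ((n : ℝ) + 1) ^ (4 * (d + 1)))
    refine h2.trans (le_of_eq ?_)
    have h3 : √((n : ℝ) + 1) ^ 4 = ((n : ℝ) + 1) ^ 2 := by
      rw [show 4 = 2 * 2 from rfl, pow_mul, Real.sq_sqrt (by positivity)]
    have h4 : ((n : ℝ) + 1) ≠ 0 := by positivity
    rw [mul_pow, h3]
    field_simp
    ring
  have hsum : Summable fun n : ℕ => C * (1 / ((n : ℝ) + 1) ^ 2) := by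
    have := (summable_nat_add_iff 1).2 (Real.summable_one_div_nat_pow.2 (by norm_num : 1 < 2))
    simpa using this.mul_left C
  have hlin : ∫⁻ ω, ∑' n, ENNReal.ofReal (Z n ω) ∂P ≠ ⊤ := by
    rw [lintegral_tsum fun n => (hZi n).1.aemeasurable.ennreal_ofReal]
    have h1 : ∀ n, ∫⁻ ω, ENNReal.ofReal (Z n ω) ∂P ≤ ENNReal.ofReal (C * (1 / ((n : ℝ) + 1) ^ 2)) := by
      intro n
      rw [← ofReal_integral_eq_lintegral_ofReal (hZi n).1 (Eventually.of_forall (hZ0 n))]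
      exact ENNReal.ofReal_le_ofReal (hZi n).2
    exact ne_top_of_le_ne_top hsum.tsum_ofReal_ne_top (ENNReal.tsum_le_tsum h1)
  filter_upwards [ae_lt_top' (AEMeasurable.tsum
    fun n => (hZi n).1.aemeasurable.ennreal_ofReal) hlin] with ω hω
  have h1 := ENNReal.tendsto_atTop_zero_of_tsum_ne_top hω.ne
  have h2 : Tendsto (fun n => Z n ω) atTop (𝓝 0) := by
    have := (ENNReal.tendsto_toReal ENNReal.zero_ne_top).comp h1
    simpa [Function.comp_def, ENNReal.toReal_ofReal (hZ0 _ ω)] using this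
  have h3 : Tendsto (fun n : ℕ => Y n ω / ((n : ℝ) + 1) ^ (d + 1)) atTop (𝓝 0) := by
    rw [tendsto_zero_iff_abs_tendsto_zero]
    have h0 : Tendsto (fun x : ℝ => √x) (𝓝 0) (𝓝 0) := by
      simpa using Real.continuous_sqrt.tendsto 0
    have h4 := h0.comp (h0.comp h2)
    refine h4.congr fun n => ?_
    change √√((Y n ω / ((n : ℝ) + 1) ^ (d + 1)) ^ 4) = _
    rw [show 4 = 2 * 2 from rfl, pow_mul, Real.sqrt_sq (sq_nonneg _), Real.sqrt_sq_eq_abs]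
    rfl
  have h4 : Tendsto (fun n : ℕ => (1 + 1 / (n : ℝ)) ^ (d + 1)) atTop (𝓝 1) := by
    simpa using ((tendsto_const_nhds (x := (1 : ℝ))).add
      (tendsto_one_div_atTop_nhds_zero_nat (𝕜 := ℝ))).pow (d + 1)
  have h5 := h3.mul h4
  rw [zero_mul] at h5
  refine h5.congr' ?_
  filter_upwards [eventually_gt_atTop 0] with n hn
  have hn' : (n : ℝ) ≠ 0 := by positivity
  have hn1 : (n : ℝ) + 1 ≠ 0 := by positivity
  have h6 : (1 + 1 / (n : ℝ)) = (n + 1) / n := by field_simp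
  rw [h6, div_pow]
  field_simp

theorem tendsto_choose_div_pow (d : ℕ) :
    Tendsto (fun n : ℕ => (n.choose d : ℝ) / (n : ℝ) ^ d) atTop (𝓝 (1 / d.factorial)) := by
  have h : Tendsto (fun n : ℕ => (n.descFactorial d : ℝ) / (n : ℝ) ^ d) atTop (𝓝 1) := by
    induction d with
    | zero => simp
    | succ d ih =>
      have h1 : Tendsto (fun n : ℕ => 1 - (d : ℝ) / n) atTop (𝓝 1) := by
        simpa using tendsto_const_nhds.sub (tendsto_const_div_atTop_nhds_zero_nat (d : ℝ))
      have h2 := h1.mul ih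
      rw [mul_one] at h2
      refine h2.congr' ?_
      filter_upwards [eventually_gt_atTop d] with n hn
      have hn' : (n : ℝ) ≠ 0 := by
        have : 0 < n := by omega
        positivity
      rw [Nat.descFactorial_succ, Nat.cast_mul, Nat.cast_sub hn.le]
      field_simp
      ring
  have h1 := h.div_const (d.factorial : ℝ)
  refine h1.congr fun n => ?_
  rw [Nat.descFactorial_eq_factorial_mul_choose, Nat.cast_mul]
  have : (d.factorial : ℝ) ≠ 0 := by positivity
  field_simp

/-! ### Pattern counts in the infinite Mallows permutation -/

section counts

variable {q : unitInterval} {d : ℕ}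

theorem blockLaw_mallowsBlock (hq1 : q < 1) : BlockLaw (mallowsBlock q) :=
  ⟨ae_one_le_size hq1, memLp_size hq1⟩

/-- The number of occurrences of a pattern among the first `n` positions of the permutation with
right-inversion counts `r`. -/
def occAt (π : FinPerm) (n : ℕ) (r : ℕ → ℕ) : ℝ := occ π (pat (Finset.range n) (permOfCounts r))

theorem measurable_occAt (π : FinPerm) (n : ℕ) : Measurable (occAt π n) :=
  (Measurable.of_discrete (f := fun τ : FinPerm => (occ π τ : ℝ))).comp
    ((measurable_pat _).comp measurable_permOfCounts)

theorem eConst_eq_prod_freq (π : BlockPattern d) :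
    eConst q π = ∏ j, freq (mallowsBlock q) (occFun π j) := rfl

theorem measurePreserving_blockSeq (hq1 : q < 1) :
    MeasurePreserving blockSeq (countsMeasure q) (iidLaw (mallowsBlock q)) :=
  ⟨measurable_blockSeq, map_blockSeq hq1⟩

theorem LpBigO.comp_blockSeq (hq1 : q < 1) {Y : ℕ → (ℕ → FinPerm) → ℝ} {a : ℕ → ℝ}
    (h : LpBigO (iidLaw (mallowsBlock q)) Y a) :
    LpBigO (countsMeasure q) (fun n r => Y n (blockSeq r)) a := by
  refine ⟨fun n => (h.1 n).comp_measurePreserving (measurePreserving_blockSeq hq1), fun p => ?_⟩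
  obtain ⟨C, hC, hb⟩ := h.2 p
  refine ⟨C, hC, fun n => ?_⟩
  have := eLpNorm_comp_measurePreserving (p := (p : ENNReal)) (h.1 n)
    (measurePreserving_blockSeq hq1)
  exact this.trans_le (hb n)

theorem occFun_nonneg (π : BlockPattern d) (j : Fin d) (B : FinPerm) : 0 ≤ occFun π j B :=
  Nat.cast_nonneg _

/-- The pattern count and the strict sum both lie between the bounds of `GoodCounts.occ_bounds`, so
their difference is at most the gap already estimated. -/
theorem lpBigO_occAt_sub (hq1 : q < 1) (π : BlockPattern (d + 1)) :
    LpBigO (countsMeasure q) (fun n r => occAt π.toPerm n r - (n.choose (d + 1) : ℝ) * eConst q π -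
      centredSum (mallowsBlock q) (occFun π) n (blockSeq r))
      fun n => √√((n : ℝ) + 1) * ((n : ℝ) + 1) ^ d := by
  refine ((lpBigO_remainder (occFun_nonneg π)
    fun j => memLp_occ hq1 (π j).1).comp_blockSeq hq1).of_le (fun n => ?_) fun n => ?_
  · exact (((measurable_occAt π.toPerm n).sub_const _).sub
      ((measurable_centredSum _ n).comp measurable_blockSeq)).aestronglyMeasurable
  · filter_upwards [ae_goodCounts hq1] with r hr
    obtain ⟨h1, h2⟩ := hr.occ_bounds π (cutSeq_cutCount_le _ n)
      (lt_cutSeq_cutCount_succ hr.blockSeq_pos n).le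
    have h3 : occAt π.toPerm n r - (n.choose (d + 1) : ℝ) * eConst q π -
        centredSum (mallowsBlock q) (occFun π) n (blockSeq r) =
        occ π.toPerm (pat (Finset.range n) (permOfCounts r)) -
          strictSum (occFun π) (blockSeq r) (cutCount (blockSeq r) n) := by
      rw [centredSum, eConst_eq_prod_freq, occAt]; ring
    rw [h3, abs_of_nonneg (by linarith)]
    refine le_trans ?_ (le_abs_self _)
    linarith

theorem lpBigO_occAt (hq1 : q < 1) (π : BlockPattern (d + 1)) :
    LpBigO (countsMeasure q) (fun n r => occAt π.toPerm n r - (n.choose (d + 1) : ℝ) * eConst q π)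
      fun n => √((n : ℝ) + 1) * ((n : ℝ) + 1) ^ d := by
  have h1 := (lpBigO_occAt_sub hq1 π).mono_rate (b := fun n : ℕ => √((n : ℝ) + 1) * ((n : ℝ) + 1) ^ d)
    fun n => mul_le_mul_of_nonneg_right (sqrt_sqrt_le n) (by positivity)
  have h2 := (lpBigO_centredSum (blockLaw_mallowsBlock hq1) (occFun_nonneg π)
    fun j => memLp_occ hq1 (π j).1).comp_blockSeq hq1
  simpa only [sub_add_cancel] using h1.add h2 fun n => by positivity

theorem ae_tendsto_occAt (hq1 : q < 1) (π : BlockPattern (d + 1)) :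
    ∀ᵐ r ∂(countsMeasure q), Tendsto (fun n : ℕ => occAt π.toPerm n r / (n : ℝ) ^ (d + 1)) atTop
      (𝓝 (eConst q π / (d + 1).factorial)) := by
  filter_upwards [(lpBigO_occAt hq1 π).ae_tendsto_zero] with r hr
  have h1 := hr.add ((tendsto_choose_div_pow (d + 1)).mul_const (eConst q π))
  rw [zero_add, one_div_mul_eq_div] at h1
  refine h1.congr fun n => ?_
  ring

end counts

/-! ### Estimates for powers and binomial coefficients -/

/-- The error has one degree less than the main term. Multiplying by `X` on the left expresses this
without the exponent `r - 1`. -/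
theorem exists_abs_descFactorial_sub_pow_le (r : ℕ) : ∃ A : ℝ, 0 ≤ A ∧ ∀ (x : ℕ) (X : ℝ), 1 ≤ X →
    (x : ℝ) ≤ X → |(x.descFactorial r : ℝ) - (x : ℝ) ^ r| * X ≤ A * X ^ r := by
  induction r with
  | zero => exact ⟨0, le_rfl, fun x X _ _ => by simp⟩
  | succ r ih =>
    obtain ⟨A, hA, h⟩ := ih
    refine ⟨A + r, by positivity, fun x X h1 hx => ?_⟩
    have h0 : (0 : ℝ) ≤ x := Nat.cast_nonneg x
    have hX : 0 ≤ X := by linarith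
    have e1 : (x.descFactorial (r + 1) : ℝ) = (x - r) * x.descFactorial r := by
      rw [Nat.descFactorial_succ, Nat.cast_mul]
      rcases le_or_gt r x with h2 | h2
      · rw [Nat.cast_sub h2]
      · rw [Nat.descFactorial_eq_zero_iff_lt.2 h2]; simp
    have e2 : (x.descFactorial (r + 1) : ℝ) - (x : ℝ) ^ (r + 1) =
        x * ((x.descFactorial r : ℝ) - (x : ℝ) ^ r) - r * x.descFactorial r := by
      rw [e1]; ring
    have h3 : (x.descFactorial r : ℝ) ≤ X ^ r := by
      have : (x.descFactorial r : ℝ) ≤ (x : ℝ) ^ r := by exact_mod_cast Nat.descFactorial_le_pow x r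
      exact this.trans (pow_le_pow_left₀ h0 hx r)
    have h4 : |(x.descFactorial (r + 1) : ℝ) - (x : ℝ) ^ (r + 1)| ≤
        x * |(x.descFactorial r : ℝ) - (x : ℝ) ^ r| + r * x.descFactorial r := by
      rw [e2]
      refine (abs_sub _ _).trans (le_of_eq ?_)
      rw [abs_mul, abs_of_nonneg h0, abs_of_nonneg (by positivity : (0 : ℝ) ≤ r * x.descFactorial r)]
    calc _ ≤ (x * |(x.descFactorial r : ℝ) - (x : ℝ) ^ r| + r * x.descFactorial r) * X :=
          mul_le_mul_of_nonneg_right h4 hX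
      _ = x * (|(x.descFactorial r : ℝ) - (x : ℝ) ^ r| * X) + r * x.descFactorial r * X := by ring
      _ ≤ X * (A * X ^ r) + r * X ^ r * X := by
          have := h x X h1 hx
          gcongr
      _ = _ := by ring

theorem exists_abs_choose_sub_le (r : ℕ) : ∃ A : ℝ, 0 ≤ A ∧ ∀ (x : ℕ) (X : ℝ), 1 ≤ X →
    (x : ℝ) ≤ X → |(x.choose r : ℝ) - (x : ℝ) ^ r / r.factorial| * X ≤ A * X ^ r := by
  obtain ⟨A, hA, h⟩ := exists_abs_descFactorial_sub_pow_le r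
  refine ⟨A, hA, fun x X h1 hx => le_trans ?_ (h x X h1 hx)⟩
  refine mul_le_mul_of_nonneg_right ?_ (by linarith)
  have h2 : (1 : ℝ) ≤ r.factorial := by exact_mod_cast Nat.factorial_pos r
  have h3 : (x.descFactorial r : ℝ) - (x : ℝ) ^ r =
      r.factorial * ((x.choose r : ℝ) - (x : ℝ) ^ r / r.factorial) := by
    rw [Nat.descFactorial_eq_factorial_mul_choose, Nat.cast_mul]
    field_simp
  rw [h3, abs_mul, abs_of_nonneg (by linarith : (0 : ℝ) ≤ r.factorial)]
  exact le_mul_of_one_le_left (abs_nonneg _) h2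

/-- Taylor's formula to first order, by induction on the degree; the factor `X` again avoids the
exponent `d - 1`. -/
theorem abs_pow_succ_sub_linear_le (d : ℕ) {x y X : ℝ} (hx0 : 0 ≤ x) (hx : x ≤ X) (hy0 : 0 ≤ y)
    (hy : y ≤ X) :
    |x ^ (d + 1) - y ^ (d + 1) - (d + 1) * y ^ d * (x - y)| * X ≤
      ((d : ℝ) + 1) ^ 2 * ((x - y) ^ 2 * X ^ d) := by
  have hX : 0 ≤ X := hx0.trans hx
  induction d with
  | zero => simp; positivity
  | succ d ih =>
    have e1 : x ^ (d + 1 + 1) - y ^ (d + 1 + 1) - ((d + 1 : ℕ) + 1) * y ^ (d + 1) * (x - y) =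
        x * (x ^ (d + 1) - y ^ (d + 1) - (d + 1) * y ^ d * (x - y)) +
          (d + 1) * ((x - y) ^ 2 * y ^ d) := by
      push_cast; ring
    have h1 : |x ^ (d + 1 + 1) - y ^ (d + 1 + 1) - ((d + 1 : ℕ) + 1) * y ^ (d + 1) * (x - y)| ≤
        x * |x ^ (d + 1) - y ^ (d + 1) - (d + 1) * y ^ d * (x - y)| +
          (d + 1) * ((x - y) ^ 2 * y ^ d) := by
      rw [e1]
      refine (abs_add_le _ _).trans (le_of_eq ?_)
      rw [abs_mul, abs_of_nonneg hx0,
        abs_of_nonneg (by positivity : 0 ≤ ((d : ℝ) + 1) * ((x - y) ^ 2 * y ^ d))]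
    calc _ ≤ (x * |x ^ (d + 1) - y ^ (d + 1) - (d + 1) * y ^ d * (x - y)| +
          (d + 1) * ((x - y) ^ 2 * y ^ d)) * X := mul_le_mul_of_nonneg_right h1 hX
      _ = x * (|x ^ (d + 1) - y ^ (d + 1) - (d + 1) * y ^ d * (x - y)| * X) +
          (d + 1) * ((x - y) ^ 2 * y ^ d) * X := by ring
      _ ≤ X * (((d : ℝ) + 1) ^ 2 * ((x - y) ^ 2 * X ^ d)) + (d + 1) * ((x - y) ^ 2 * X ^ d) * X := by
          gcongr
      _ = (((d : ℝ) + 1) ^ 2 + (d + 1)) * ((x - y) ^ 2 * X ^ (d + 1)) := by ring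
      _ ≤ _ := by
          refine mul_le_mul_of_nonneg_right ?_ (by positivity)
          push_cast
          nlinarith [(Nat.cast_nonneg d : (0 : ℝ) ≤ d)]

/-! ### Linearization of iterated sums over blocks -/

/-- The linear part of the iterated sum of the functions `f` over the first `k` blocks. -/
def linSum (ν : Measure FinPerm) : {d : ℕ} → (Fin d → FinPerm → ℝ) → ℕ → (ℕ → FinPerm) → ℝ
  | 0, _, _, _ => 0
  | d + 1, f, k, b => ∑ i ∈ Finset.range k,
      ((f (Fin.last d) (b i) - ∫ B, f (Fin.last d) B ∂ν) *
          ((∏ j, ∫ B, Fin.init f j B ∂ν) * (i.choose d : ℝ)) +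
        (∫ B, f (Fin.last d) B ∂ν) * linSum ν (Fin.init f) i b)

theorem measurable_linSum (ν : Measure FinPerm) {d : ℕ} (f : Fin d → FinPerm → ℝ) (k : ℕ) :
    Measurable (linSum ν f k) := by
  induction d generalizing k with
  | zero => exact measurable_const
  | succ d ih =>
    exact Finset.measurable_fun_sum _ fun i _ =>
      ((((Measurable.of_discrete (f := f (Fin.last d))).comp
        (measurable_pi_apply i)).sub_const _).mul_const _).add ((ih (Fin.init f) i).const_mul _)

section linearization

variable {ν : Measure FinPerm} [IsProbabilityMeasure ν] {d : ℕ}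

theorem memLp_sub_integral {f : FinPerm → ℝ} (hf : ∀ p : ℕ, MemLp f p ν) (p : ℕ) :
    MemLp (fun B => f B - ∫ B, f B ∂ν) p ν := (hf p).sub (memLp_const _)

theorem integral_sub_integral {f : FinPerm → ℝ} (hf : ∀ p : ℕ, MemLp f p ν) :
    ∫ B, (f B - ∫ B, f B ∂ν) ∂ν = 0 := by
  rw [integral_sub ((hf 1).integrable (by simp)) (integrable_const _)]
  simp

theorem LpBigO.sum_range {Y : ℕ → (ℕ → FinPerm) → ℝ} {a : ℕ → ℝ} (h : LpBigO (iidLaw ν) Y a)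
    (ha : ∀ n, 0 ≤ a n) (ham : Monotone a) :
    LpBigO (iidLaw ν) (fun n b => ∑ i ∈ Finset.range n, Y i b) fun n => ((n : ℝ) + 1) * a n := by
  refine LpBigO.sum (fun n : ℕ => Finset.range n) (W := fun _ i b => Y i b)
    ((h.comp fun x : {x : ℕ × ℕ // x.2 ∈ Finset.range x.1} => x.1.2).mono_rate
      fun x => ham (Finset.mem_range.1 x.2).le) (fun n => by simp) ha

theorem lpBigO_martingale_range {g : FinPerm → ℝ} (hgp : ∀ p : ℕ, MemLp g p ν)
    (hg0 : ∫ x, g x ∂ν = 0) {V : ℕ → (ℕ → FinPerm) → ℝ} (hVm : ∀ k, Measurable (V k))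
    (hV : ∀ k, DependsBefore (V k) k) {a : ℕ → ℝ} (hVa : LpBigO (iidLaw ν) V a)
    (ha : ∀ n, 0 ≤ a n) (ham : Monotone a) :
    LpBigO (iidLaw ν) (fun n b => ∑ i ∈ Finset.range n, g (b i) * V i b)
      fun n => √((n : ℝ) + 1) * a n := by
  -- The martingale bound requires at least one term, so the sum runs to `n + 1` with its last
  -- coefficient switched off.
  have h1 : LpBigO (iidLaw ν)
      (fun n b => ∑ i ∈ Finset.range (n + 1), g (b i) * (if i < n then V i b else 0))
      fun n => √((n + 1 : ℕ) : ℝ) * a n := by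
    refine lpBigO_martingale (V := fun n i b => if i < n then V i b else 0) .of_discrete hgp hg0
      (fun n i => ?_) (fun n i => ?_) (fun n => n + 1) (fun n => Nat.le_add_left 1 n) ha ?_
    · split_ifs
      · exact hVm i
      · exact measurable_const
    · split_ifs
      · exact hV i
      · exact fun _ _ _ => rfl
    · refine ((hVa.comp fun x : {x : ℕ × ℕ // x.2 < x.1 + 1} => x.1.2).mono_rate
        fun x => ham (Nat.lt_succ_iff.1 x.2)).of_le (fun x => ?_) fun x =>
          Eventually.of_forall fun b => ?_
      · split_ifs
        · exact (hVm _).aestronglyMeasurable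
        · exact aestronglyMeasurable_const
      · split_ifs
        · exact le_rfl
        · rw [abs_zero]; exact abs_nonneg _
  have h2 : ∀ n (b : ℕ → FinPerm),
      ∑ i ∈ Finset.range (n + 1), g (b i) * (if i < n then V i b else 0) =
        ∑ i ∈ Finset.range n, g (b i) * V i b := fun n b => by
    rw [Finset.sum_range_succ, if_neg (lt_irrefl n), mul_zero, add_zero]
    exact Finset.sum_congr rfl fun i hi => by rw [if_pos (Finset.mem_range.1 hi)]
  simpa only [h2, Nat.cast_add, Nat.cast_one] using h1

theorem monotone_rate_pow (d : ℕ) : Monotone fun n : ℕ => ((n : ℝ) + 1) ^ d := fun m n h => by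
  dsimp only; gcongr

theorem monotone_rate (d : ℕ) : Monotone fun n : ℕ => √((n : ℝ) + 1) * ((n : ℝ) + 1) ^ d :=
  fun m n h => by dsimp only; gcongr

/-- The deviation of the iterated sum from its mean. -/
def devSum (ν : Measure FinPerm) {d : ℕ} (f : Fin d → FinPerm → ℝ) (k : ℕ)
    (b : ℕ → FinPerm) : ℝ :=
  strictSum f b k - (∏ j, ∫ B, f j B ∂ν) * (k.choose d : ℝ)

omit [IsProbabilityMeasure ν] in
theorem measurable_devSum (f : Fin d → FinPerm → ℝ) (k : ℕ) : Measurable (devSum ν f k) :=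
  (measurable_strictSum f k).sub_const _

omit [IsProbabilityMeasure ν] in
theorem devSum_zero (f : Fin 0 → FinPerm → ℝ) (k : ℕ) (b : ℕ → FinPerm) : devSum ν f k b = 0 := by
  simp [devSum, strictSum]

omit [IsProbabilityMeasure ν] in
theorem devSum_succ (f : Fin (d + 1) → FinPerm → ℝ) (k : ℕ) (b : ℕ → FinPerm) :
    devSum ν f k b =
      ∑ i ∈ Finset.range k, (f (Fin.last d) (b i) - ∫ B, f (Fin.last d) B ∂ν) *
          strictSum (Fin.init f) b i +
        (∫ B, f (Fin.last d) B ∂ν) * ∑ i ∈ Finset.range k, devSum ν (Fin.init f) i b := by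
  rw [devSum, strictSum, ← sum_range_choose_eq, Fin.prod_univ_castSucc, Nat.cast_sum,
    Finset.mul_sum, Finset.mul_sum, ← Finset.sum_sub_distrib, ← Finset.sum_add_distrib]
  refine Finset.sum_congr rfl fun i _ => ?_
  simp only [Fin.init, devSum]
  ring

omit [IsProbabilityMeasure ν] in
-- The linear part replaces the inner iterated sum by its mean when the last factor is centred. The
-- new error is thus a martingale sum against a deviation, not against a full iterated sum.
theorem devSum_sub_linSum_succ (f : Fin (d + 1) → FinPerm → ℝ) (k : ℕ) (b : ℕ → FinPerm) :
    devSum ν f k b - linSum ν f k b =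
      ∑ i ∈ Finset.range k, (f (Fin.last d) (b i) - ∫ B, f (Fin.last d) B ∂ν) *
          devSum ν (Fin.init f) i b +
        (∫ B, f (Fin.last d) B ∂ν) * ∑ i ∈ Finset.range k,
          (devSum ν (Fin.init f) i b - linSum ν (Fin.init f) i b) := by
  rw [devSum_succ, linSum, Finset.mul_sum, Finset.mul_sum,
    ← Finset.sum_add_distrib, ← Finset.sum_add_distrib, ← Finset.sum_sub_distrib]
  refine Finset.sum_congr rfl fun i _ => ?_
  simp only [devSum]
  ring

theorem lpBigO_devSum {f : Fin (d + 1) → FinPerm → ℝ} (hfp : ∀ j (p : ℕ), MemLp (f j) p ν) :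
    LpBigO (iidLaw ν) (devSum ν f) fun k => √((k : ℝ) + 1) * ((k : ℝ) + 1) ^ d := by
  have hmart : ∀ {d : ℕ} {f : Fin (d + 1) → FinPerm → ℝ}, (∀ j (p : ℕ), MemLp (f j) p ν) →
      LpBigO (iidLaw ν) (fun (k : ℕ) b => ∑ i ∈ Finset.range k,
        (f (Fin.last d) (b i) - ∫ B, f (Fin.last d) B ∂ν) * strictSum (Fin.init f) b i)
        fun k => √((k : ℝ) + 1) * ((k : ℝ) + 1) ^ d := fun {d f} hfp =>
    lpBigO_martingale_range (g := fun B => f (Fin.last d) B - ∫ B, f (Fin.last d) B ∂ν)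
      (memLp_sub_integral (hfp _)) (integral_sub_integral (hfp _))
      (measurable_strictSum _) (dependsBefore_strictSum _) (lpBigO_strictSum fun j => hfp _)
      (fun n => by positivity) (monotone_rate_pow d)
  induction d with
  | zero =>
    convert hmart hfp using 3 with k b
    rw [devSum_succ]
    simp [devSum_zero]
  | succ d ih =>
    have h1 := ((ih (f := Fin.init f) fun j => hfp _).sum_range (fun n => by positivity)
      (monotone_rate d)).const_mul (∫ B, f (Fin.last (d + 1)) B ∂ν)
    have h2 := (hmart hfp).add (h1.mono_rate
      (b := fun k : ℕ => √((k : ℝ) + 1) * ((k : ℝ) + 1) ^ (d + 1)) fun n =>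
        le_of_eq (by ring)) fun n => by positivity
    convert h2 using 3 with k b
    exact devSum_succ f k b

/-- Two cancellations occur: the deviation is already smaller than the iterated sum by a factor of
order `√k`, and summing it against centred variables saves another such factor. -/
theorem lpBigO_devSum_sub_linSum {f : Fin (d + 1) → FinPerm → ℝ}
    (hfp : ∀ j (p : ℕ), MemLp (f j) p ν) :
    LpBigO (iidLaw ν) (fun k b => devSum ν f k b - linSum ν f k b)
      fun k => ((k : ℝ) + 1) ^ d := by
  induction d with
  | zero =>
    have h := LpBigO.const (P := iidLaw ν) fun _ : ℕ => (0 : ℝ)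
    convert h.mono_rate (b := fun k : ℕ => ((k : ℝ) + 1) ^ 0) (fun k => by simp) using 3 with k b
    rw [devSum_sub_linSum_succ]
    simp [devSum_zero, linSum]
  | succ d ih =>
    have h1 := ((ih (f := Fin.init f) fun j => hfp _).sum_range (fun n => by positivity)
      (monotone_rate_pow d)).const_mul (∫ B, f (Fin.last (d + 1)) B ∂ν)
    have h2 := lpBigO_martingale_range
      (g := fun B => f (Fin.last (d + 1)) B - ∫ B, f (Fin.last (d + 1)) B ∂ν)
      (memLp_sub_integral (hfp _)) (integral_sub_integral (hfp _))
      (measurable_devSum (Fin.init f)) (fun k b b' h => by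
        have : strictSum (Fin.init f) b k = strictSum (Fin.init f) b' k :=
          dependsBefore_strictSum _ _ b b' h
        simp only [devSum, this])
      (lpBigO_devSum fun j => hfp _) (fun n => by positivity) (monotone_rate d)
    have h3 := (h2.mono_rate (b := fun k : ℕ => ((k : ℝ) + 1) ^ (d + 1)) fun n => by
        rw [← mul_assoc, Real.mul_self_sqrt (by positivity), pow_succ']).add
      (h1.mono_rate (b := fun k : ℕ => ((k : ℝ) + 1) ^ (d + 1)) fun n => by rw [pow_succ'])
      fun n => by positivity
    convert h3 using 3 with k b
    exact devSum_sub_linSum_succ f k b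

theorem lpBigO_linSum {f : Fin (d + 1) → FinPerm → ℝ} (hfp : ∀ j (p : ℕ), MemLp (f j) p ν) :
    LpBigO (iidLaw ν) (linSum ν f) fun k => √((k : ℝ) + 1) * ((k : ℝ) + 1) ^ d := by
  have h1 := (lpBigO_devSum_sub_linSum hfp).mono_rate
    (b := fun k : ℕ => √((k : ℝ) + 1) * ((k : ℝ) + 1) ^ d) fun k =>
      le_mul_of_one_le_left (by positivity)
        (Real.one_le_sqrt.2 (by linarith [(Nat.cast_nonneg k : (0 : ℝ) ≤ k)]))
  simpa only [sub_sub_cancel] using (lpBigO_devSum hfp).sub h1 fun k => by positivity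

/-! ### Increments of linear sums -/

theorem LpBigO.comp_shiftSeq {ι : Type*} {Y : ι → (ℕ → FinPerm) → ℝ} {a : ι → ℝ}
    (h : LpBigO (iidLaw ν) Y a) (φ : ι → ℕ) :
    LpBigO (iidLaw ν) (fun i b => Y i (shiftSeq (φ i) b)) a := by
  have hmp : ∀ k, MeasurePreserving (shiftSeq k) (iidLaw ν) (iidLaw ν) := fun k =>
    ⟨measurable_shiftSeq k, map_shiftSeq ν k⟩
  refine ⟨fun n => (h.1 n).comp_measurePreserving (hmp _), fun p => ?_⟩
  obtain ⟨C, hC, hb⟩ := h.2 p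
  refine ⟨C, hC, fun i => ?_⟩
  exact (eLpNorm_comp_measurePreserving (p := (p : ENNReal)) (h.1 i) (hmp (φ i))).trans_le (hb i)

theorem lpBigO_sum_shift {g : FinPerm → ℝ} (hgp : ∀ p : ℕ, MemLp g p ν)
    (hg0 : ∫ x, g x ∂ν = 0) (c : ℕ → ℝ) {a : ℕ → ℝ} (hc : ∀ n i, i ≤ n → |c i| ≤ a n) :
    LpBigO (iidLaw ν) (fun (x : {x : ℕ × ℕ × ℕ // x.2.1 + x.2.2 ≤ x.1}) b =>
      ∑ i ∈ Finset.range x.1.2.2, g (b (x.1.2.1 + i)) * c (x.1.2.1 + i))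
      fun x => √((x.1.2.2 : ℝ) + 1) * a x.1.1 := by
  have ha : ∀ n, 0 ≤ a n := fun n => (abs_nonneg _).trans (hc n n le_rfl)
  have h1 : LpBigO (iidLaw ν) (fun (x : {x : ℕ × ℕ × ℕ // x.2.1 + x.2.2 ≤ x.1}) b =>
      ∑ i ∈ Finset.range (x.1.2.2 + 1), g (b i) * (if i < x.1.2.2 then c (x.1.2.1 + i) else 0))
      fun x => √((x.1.2.2 + 1 : ℕ) : ℝ) * a x.1.1 := by
    refine lpBigO_martingale (V := fun (x : {x : ℕ × ℕ × ℕ // x.2.1 + x.2.2 ≤ x.1}) i _ =>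
      if i < x.1.2.2 then c (x.1.2.1 + i) else 0) .of_discrete hgp hg0
      (fun n i => measurable_const) (fun n i => fun _ _ _ => rfl)
      (fun x => x.1.2.2 + 1) (fun n => Nat.le_add_left 1 _) (fun x => ha _) ?_
    refine (LpBigO.const _).mono_rate fun y => ?_
    split_ifs with h
    · refine hc _ _ ?_
      have := y.1.1.2
      omega
    · rw [abs_zero]; exact ha _
  have h2 := h1.comp_shiftSeq fun x => x.1.2.1
  convert h2 using 3 with x b x
  · rw [Finset.sum_range_succ, if_neg (lt_irrefl _), mul_zero, add_zero]
    exact Finset.sum_congr rfl fun i hi => by rw [if_pos (Finset.mem_range.1 hi)]; rfl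
  · push_cast; rfl

/-- An increment over `k` blocks is a shifted sum of `k` independent centred terms of size `n ^ d`,
plus `k` values of a lower linear sum, each of order `n ^ (d - 1/2)`. Since `k ≤ n`, both are of
order `√k * n ^ d`. -/
theorem lpBigO_linSum_increment {f : Fin (d + 1) → FinPerm → ℝ}
    (hfp : ∀ j (p : ℕ), MemLp (f j) p ν) :
    LpBigO (iidLaw ν) (fun (x : {x : ℕ × ℕ × ℕ // x.2.1 + x.2.2 ≤ x.1}) b =>
      linSum ν f (x.1.2.1 + x.1.2.2) b - linSum ν f x.1.2.1 b)
      fun x => √((x.1.2.2 : ℝ) + 1) * ((x.1.1 : ℝ) + 1) ^ d := by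
  have hrec : ∀ (l k : ℕ) (b : ℕ → FinPerm), linSum ν f (l + k) b - linSum ν f l b =
      ∑ i ∈ Finset.range k, (f (Fin.last d) (b (l + i)) - ∫ B, f (Fin.last d) B ∂ν) *
          ((∏ j, ∫ B, Fin.init f j B ∂ν) * ((l + i).choose d : ℝ)) +
        (∫ B, f (Fin.last d) B ∂ν) *
          ∑ i ∈ Finset.range k, linSum ν (Fin.init f) (l + i) b := by
    intro l k b
    rw [linSum, linSum, Finset.sum_range_add, add_sub_cancel_left, Finset.mul_sum,
      ← Finset.sum_add_distrib]
  have h1 := lpBigO_sum_shift (g := fun B => f (Fin.last d) B - ∫ B, f (Fin.last d) B ∂ν)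
    (memLp_sub_integral (hfp _)) (integral_sub_integral (hfp _))
    (fun i => (∏ j, ∫ B, Fin.init f j B ∂ν) * (i.choose d : ℝ))
    (a := fun n => |∏ j, ∫ B, Fin.init f j B ∂ν| * ((n : ℝ) + 1) ^ d) fun n i hi => by
      rw [abs_mul]
      refine mul_le_mul_of_nonneg_left ?_ (abs_nonneg _)
      rw [Nat.abs_cast]
      have h2 : (i.choose d : ℝ) ≤ (i : ℝ) ^ d := by exact_mod_cast Nat.choose_le_pow i d
      refine h2.trans ?_
      gcongr
      exact_mod_cast hi.trans (Nat.le_succ n)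
  have h1' : LpBigO (iidLaw ν) (fun (x : {x : ℕ × ℕ × ℕ // x.2.1 + x.2.2 ≤ x.1}) b =>
      ∑ i ∈ Finset.range x.1.2.2,
        (f (Fin.last d) (b (x.1.2.1 + i)) - ∫ B, f (Fin.last d) B ∂ν) *
          ((∏ j, ∫ B, Fin.init f j B ∂ν) * ((x.1.2.1 + i).choose d : ℝ)))
      fun x => √((x.1.2.2 : ℝ) + 1) * ((x.1.1 : ℝ) + 1) ^ d :=
    LpBigO.of_rate_mul (abs_nonneg (∏ j, ∫ B, Fin.init f j B ∂ν))
      (h1.mono_rate fun x => le_of_eq (by ring))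
  simp_rw [hrec]
  cases d with
  | zero =>
    simpa [linSum] using h1'
  | succ d =>
    have h2 : LpBigO (iidLaw ν) (fun (x : {x : ℕ × ℕ × ℕ // x.2.1 + x.2.2 ≤ x.1}) b =>
        ∑ i ∈ Finset.range x.1.2.2, linSum ν (Fin.init f) (x.1.2.1 + i) b)
        fun x => ((x.1.2.2 : ℝ) + 1) * (√((x.1.1 : ℝ) + 1) * ((x.1.1 : ℝ) + 1) ^ d) := by
      refine LpBigO.sum (fun x : {x : ℕ × ℕ × ℕ // x.2.1 + x.2.2 ≤ x.1} => Finset.range x.1.2.2)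
        (W := fun x i b => linSum ν (Fin.init f) (x.1.2.1 + i) b)
        (((lpBigO_linSum (f := Fin.init f) fun j => hfp _).comp
          fun y : {y : {x : ℕ × ℕ × ℕ // x.2.1 + x.2.2 ≤ x.1} × ℕ //
            y.2 ∈ Finset.range y.1.1.2.2} => y.1.1.1.2.1 + y.1.2).mono_rate fun y => ?_)
        (fun x => by simp) fun x => by positivity
      refine monotone_rate d ?_
      have := y.1.1.2
      have := Finset.mem_range.1 y.2
      omega
    refine h1'.add ((h2.const_mul _).mono_rate fun x => ?_) fun x => by positivity
    have h3 : ((x.1.2.2 : ℝ) + 1) = √((x.1.2.2 : ℝ) + 1) * √((x.1.2.2 : ℝ) + 1) :=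
      (Real.mul_self_sqrt (by positivity)).symm
    have h4 : ((x.1.1 : ℝ) + 1) = √((x.1.1 : ℝ) + 1) * √((x.1.1 : ℝ) + 1) :=
      (Real.mul_self_sqrt (by positivity)).symm
    have h5 : √((x.1.2.2 : ℝ) + 1) ≤ √((x.1.1 : ℝ) + 1) := by
      refine Real.sqrt_le_sqrt ?_
      have : x.1.2.2 ≤ x.1.1 := by have := x.2; omega
      gcongr
    calc ((x.1.2.2 : ℝ) + 1) * (√((x.1.1 : ℝ) + 1) * ((x.1.1 : ℝ) + 1) ^ d) =
        √((x.1.2.2 : ℝ) + 1) * √((x.1.2.2 : ℝ) + 1) *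
          (√((x.1.1 : ℝ) + 1) * ((x.1.1 : ℝ) + 1) ^ d) := by rw [← h3]
      _ ≤ √((x.1.2.2 : ℝ) + 1) * √((x.1.1 : ℝ) + 1) *
          (√((x.1.1 : ℝ) + 1) * ((x.1.1 : ℝ) + 1) ^ d) := by gcongr
      _ = √((x.1.2.2 : ℝ) + 1) * ((√((x.1.1 : ℝ) + 1) * √((x.1.1 : ℝ) + 1)) *
          ((x.1.1 : ℝ) + 1) ^ d) := by ring
      _ = _ := by rw [← h4, ← pow_succ']

end linearization

/-! ### Linearization at the random number of blocks -/

section randomIndex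

variable {ν : Measure FinPerm} [IsProbabilityMeasure ν] {d : ℕ}

theorem LpBigO.pow {Ω ι : Type*} [MeasurableSpace Ω] {P : Measure Ω} [IsProbabilityMeasure P]
    {Y : ι → Ω → ℝ} {a : ι → ℝ} (h : LpBigO P Y a) (ha : ∀ i, 0 ≤ a i) (r : ℕ) :
    LpBigO P (fun i ω => Y i ω ^ r) fun i => a i ^ r := by
  induction r with
  | zero => simpa using LpBigO.const (P := P) fun _ : ι => (1 : ℝ)
  | succ r ih => simpa only [pow_succ] using ih.mul h fun i => pow_nonneg (ha i) r

/-- Eighth powers are summed over all possible indices, so the random index costs only `n ^ (1/8)`;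
combined with a further loss of `n ^ (1/4)` this stays below `n ^ (1/2)`. -/
theorem lpBigO_family_at_cutCount {Y : ℕ → ℕ → (ℕ → FinPerm) → ℝ}
    (hYm : ∀ n k, Measurable (Y n k)) {a : ℕ → ℝ} (ha : ∀ n, 0 ≤ a n)
    (hY : LpBigO (iidLaw ν) (fun x : {x : ℕ × ℕ // x.2 ∈ Finset.range (x.1 + 1)} => Y x.1.1 x.1.2)
      fun x => a x.1.1) :
    LpBigO (iidLaw ν) (fun n b => Y n (cutCount b n) b) fun n => √√√((n : ℝ) + 1) * a n := by
  have h1 : LpBigO (iidLaw ν) (fun n b => ∑ k ∈ Finset.range (n + 1), Y n k b ^ 8)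
      fun n : ℕ => ((n : ℝ) + 1) * a n ^ 8 :=
    LpBigO.sum (fun n : ℕ => Finset.range (n + 1)) (W := fun n k b => Y n k b ^ 8)
      (hY.pow (fun x => ha _) 8) (fun n => by simp) fun n => pow_nonneg (ha n) 8
  have h8 : Even 8 := ⟨4, rfl⟩
  refine LpBigO.root (k := 8) (by norm_num) (h1.mono_rate fun n => ?_)
    (fun n => mul_nonneg (Real.sqrt_nonneg _) (ha n)) (fun n => ?_)
    fun n => Eventually.of_forall fun b => ?_
  · rw [mul_pow, show 8 = 2 * 2 * 2 from rfl, pow_mul (√√√((n : ℝ) + 1)),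
      pow_mul (√√√((n : ℝ) + 1)), Real.sq_sqrt (Real.sqrt_nonneg _),
      Real.sq_sqrt (Real.sqrt_nonneg _), Real.sq_sqrt (by positivity)]
  · exact (measurable_at_cutCount (hYm n) n).aestronglyMeasurable
  · rw [h8.pow_abs, abs_of_nonneg (Finset.sum_nonneg fun i _ => h8.pow_nonneg _)]
    exact Finset.single_le_sum (f := fun k => Y n k b ^ 8) (fun i _ => h8.pow_nonneg _)
      (Finset.mem_range.2 (Nat.lt_succ_of_le (cutCount_le b n)))

/-- The expected size of a block. -/
def sizeMean (ν : Measure FinPerm) : ℝ := ∫ B, (B.1 : ℝ) ∂ν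

/-- The typical number of blocks before position `n`. -/
def blockIndex (ν : Measure FinPerm) (n : ℕ) : ℕ := ⌊(n : ℝ) / sizeMean ν⌋₊

omit [IsProbabilityMeasure ν] in
theorem div_sizeMean_le (h : 1 ≤ sizeMean ν) (n : ℕ) : (n : ℝ) / sizeMean ν ≤ n :=
  div_le_self (Nat.cast_nonneg n) h

omit [IsProbabilityMeasure ν] in
theorem blockIndex_le (h : 1 ≤ sizeMean ν) (n : ℕ) : blockIndex ν n ≤ n :=
  Nat.floor_le_of_le (div_sizeMean_le h n)

/-- The number of blocks is the iterated sum of the single constant function `1`, so its fluctuation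
is an instance of `lpBigO_centredSum`. -/
theorem lpBigO_cutCount_sub (hν : BlockLaw ν) :
    LpBigO (iidLaw ν) (fun n b => (cutCount b n : ℝ) - n / sizeMean ν) fun n => √((n : ℝ) + 1) := by
  have h := lpBigO_centredSum hν (f := fun (_ : Fin (0 + 1)) _ => 1) (fun _ _ => zero_le_one)
    fun _ _ => memLp_const _
  convert h using 3 with n b n
  · simp [centredSum, strictSum, freq, sizeMean]
    ring
  · simp

/-- The distance between the number of blocks and its typical value. -/
def indexGap (ν : Measure FinPerm) (n k : ℕ) : ℕ := max k (blockIndex ν n) - min k (blockIndex ν n)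

theorem lpBigO_sqrt_indexGap (hν : BlockLaw ν) :
    LpBigO (iidLaw ν) (fun n b => √((indexGap ν n (cutCount b n) : ℝ) + 1))
      fun n => √√((n : ℝ) + 1) := by
  have h1 : LpBigO (iidLaw ν) (fun n b => |(cutCount b n : ℝ) - n / sizeMean ν| + 2)
      fun n => √((n : ℝ) + 1) := by
    refine LpBigO.add ((lpBigO_cutCount_sub hν).of_le (fun n => ?_) fun n =>
      Eventually.of_forall fun b => (abs_abs _).le) ?_ fun n => Real.sqrt_nonneg _
    · exact ((lpBigO_cutCount_sub hν).1 n).norm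
    · refine LpBigO.of_rate_mul (c := 2) (by norm_num) ((LpBigO.const fun _ : ℕ => (2 : ℝ)).mono_rate
        fun n => ?_)
      have := Real.one_le_sqrt.2 (by linarith [(Nat.cast_nonneg n : (0 : ℝ) ≤ n)] :
        (1 : ℝ) ≤ (n : ℝ) + 1)
      rw [abs_of_pos (by norm_num)]
      linarith
  refine LpBigO.root (k := 2) (by norm_num) (h1.mono_rate fun n => ?_)
    (fun n => Real.sqrt_nonneg _) (fun n => ?_) fun n => Eventually.of_forall fun b => ?_
  · rw [Real.sq_sqrt (Real.sqrt_nonneg _)]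
  · exact (Measurable.comp (g := fun k : ℕ => √((indexGap ν n k : ℝ) + 1)) .of_discrete
      (measurable_cutCount n)).aestronglyMeasurable
  · rw [sq_abs, Real.sq_sqrt (by positivity), abs_of_nonneg (by positivity)]
    have hm := hν.one_le_integral
    have hy : (0 : ℝ) ≤ n / sizeMean ν := by
      have : (0 : ℝ) ≤ sizeMean ν := zero_le_one.trans hm
      positivity
    have h2 := Nat.floor_le hy
    have h3 := Nat.lt_floor_add_one ((n : ℝ) / sizeMean ν)
    have h4 : (indexGap ν n (cutCount b n) : ℝ) = |(cutCount b n : ℝ) - blockIndex ν n| := by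
      rw [indexGap, Nat.cast_sub min_le_max]
      push_cast
      exact max_sub_min_eq_abs' _ _
    have h5 : |(cutCount b n : ℝ) - blockIndex ν n| ≤ |(cutCount b n : ℝ) - n / sizeMean ν| +
        |(n : ℝ) / sizeMean ν - blockIndex ν n| := abs_sub_le _ _ _
    have h6 : |(n : ℝ) / sizeMean ν - blockIndex ν n| ≤ 1 := by
      rw [blockIndex, abs_of_nonneg (by linarith)]
      linarith
    rw [h4]
    linarith

/-- For each possible index the increment is first divided by the square root of the distance to
`blockIndex`. The quotient is of order `n ^ d` uniformly, hence of order `n ^ (d + 1/8)` at the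
random index; multiplying back contributes `n ^ (1/4)`, as that distance is of order `√n`. -/
theorem lpBigO_linSum_cutCount_sub {f : Fin (d + 1) → FinPerm → ℝ} (hν : BlockLaw ν)
    (hfp : ∀ j (p : ℕ), MemLp (f j) p ν) :
    LpBigO (iidLaw ν) (fun n b => linSum ν f (cutCount b n) b - linSum ν f (blockIndex ν n) b)
      fun n => √√√((n : ℝ) + 1) * ((n : ℝ) + 1) ^ d * √√((n : ℝ) + 1) := by
  have hm : 1 ≤ sizeMean ν := hν.one_le_integral
  have h1 : LpBigO (iidLaw ν)
      (fun (x : {x : ℕ × ℕ // x.2 ∈ Finset.range (x.1 + 1)}) b =>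
        (√((indexGap ν x.1.1 x.1.2 : ℝ) + 1))⁻¹ *
          (linSum ν f x.1.2 b - linSum ν f (blockIndex ν x.1.1) b))
      fun x => ((x.1.1 : ℝ) + 1) ^ d := by
    have h2 := (lpBigO_linSum_increment hfp).comp
      fun x : {x : ℕ × ℕ // x.2 ∈ Finset.range (x.1 + 1)} =>
        (⟨(x.1.1, min x.1.2 (blockIndex ν x.1.1), indexGap ν x.1.1 x.1.2), by
          have := Finset.mem_range.1 x.2
          have := blockIndex_le hm x.1.1
          simp only [indexGap]
          omega⟩ : {x : ℕ × ℕ × ℕ // x.2.1 + x.2.2 ≤ x.1})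
    have h3 := (LpBigO.const (P := iidLaw ν)
      fun x : {x : ℕ × ℕ // x.2 ∈ Finset.range (x.1 + 1)} =>
        (√((indexGap ν x.1.1 x.1.2 : ℝ) + 1))⁻¹).mul h2 fun x => abs_nonneg _
    refine (h3.mono_rate fun x => ?_).of_le (fun x => ?_) fun x => Eventually.of_forall fun b => ?_
    · have h4 : (0 : ℝ) < √((indexGap ν x.1.1 x.1.2 : ℝ) + 1) := by positivity
      rw [abs_of_pos (by positivity), ← mul_assoc, inv_mul_cancel₀ h4.ne', one_mul]
    · exact (((measurable_linSum ν f _).sub (measurable_linSum ν f _)).const_mul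
        _).aestronglyMeasurable
    · rw [abs_mul, abs_mul]
      refine mul_le_mul_of_nonneg_left (le_of_eq ?_) (abs_nonneg _)
      simp only [indexGap]
      rcases le_total x.1.2 (blockIndex ν x.1.1) with h | h
      · rw [min_eq_left h, max_eq_right h, Nat.add_sub_cancel' h, abs_sub_comm]
      · rw [min_eq_right h, max_eq_left h, Nat.add_sub_cancel' h]
  have h2 := (lpBigO_family_at_cutCount (Y := fun n k b => (√((indexGap ν n k : ℝ) + 1))⁻¹ *
    (linSum ν f k b - linSum ν f (blockIndex ν n) b)) (fun n k =>
      ((measurable_linSum ν f _).sub (measurable_linSum ν f _)).const_mul _)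
    (a := fun n => ((n : ℝ) + 1) ^ d) (fun n => by positivity) h1).mul (lpBigO_sqrt_indexGap hν)
    fun n => by positivity
  convert h2 using 3 with n b
  have h4 : (0 : ℝ) < √((indexGap ν n (cutCount b n) : ℝ) + 1) := by positivity
  field_simp

omit [IsProbabilityMeasure ν] in
theorem linSum_size (k : ℕ) (b : ℕ → FinPerm) :
    linSum ν (fun (_ : Fin (0 + 1)) B => (B.1 : ℝ)) k b = cutSeq b k - k * sizeMean ν := by
  simp [linSum, cutSeq, sizeMean]

/-- The linear statistic that approximates the centred iterated sum. -/
def linApprox (ν : Measure FinPerm) {d : ℕ} (f : Fin (d + 1) → FinPerm → ℝ) (n : ℕ)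
    (b : ℕ → FinPerm) : ℝ :=
  linSum ν f (blockIndex ν n) b - (∏ j, ∫ B, f j B ∂ν) * ((n : ℝ) / sizeMean ν) ^ d /
    (d.factorial * sizeMean ν) * (cutSeq b (blockIndex ν n) - blockIndex ν n * sizeMean ν)

omit [IsProbabilityMeasure ν] in
theorem measurable_linApprox (f : Fin (d + 1) → FinPerm → ℝ) (n : ℕ) :
    Measurable (linApprox ν f n) :=
  (measurable_linSum ν f _).sub ((((Measurable.of_discrete (f := fun m : ℕ => (m : ℝ))).comp
    (measurable_cutSeq _)).sub_const _).const_mul _)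

theorem one_le_sqrt_cast_succ (n : ℕ) : 1 ≤ √((n : ℝ) + 1) :=
  Real.one_le_sqrt.2 (by linarith [(Nat.cast_nonneg n : (0 : ℝ) ≤ n)])

/-- With `N` the number of blocks and `m` the mean size, the centred sum is the deviation at `N`
plus `∏ E f_j` times `N.choose (d+1) - n.choose (d+1) / m ^ (d+1)`. The deviation is linearized and
moved to `blockIndex`. The binomials become powers, expanded to first order at `n / m`, and `m * (N
- n / m)` is minus the centred size sum at `N`, up to the uncovered length `n - cutSeq b N`. The
terms `t1` to `t6` are the successive errors. -/
theorem lpBigO_centredSum_sub_linApprox {f : Fin (d + 1) → FinPerm → ℝ} (hν : BlockLaw ν)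
    (hfp : ∀ j (p : ℕ), MemLp (f j) p ν) :
    LpBigO (iidLaw ν) (fun n b => centredSum ν f n b - linApprox ν f n b)
      fun n => √√√((n : ℝ) + 1) * √√((n : ℝ) + 1) * ((n : ℝ) + 1) ^ d := by
  have hm : 1 ≤ sizeMean ν := hν.one_le_integral
  have hm0 : sizeMean ν ≠ 0 := by linarith
  set μ : ℝ := ∏ j, ∫ B, f j B ∂ν with hμ
  have s1 := one_le_sqrt_cast_succ
  have s2 : ∀ n : ℕ, 1 ≤ √√((n : ℝ) + 1) := fun n => Real.one_le_sqrt.2 (s1 n)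
  have s3 : ∀ n : ℕ, 1 ≤ √√√((n : ℝ) + 1) := fun n => Real.one_le_sqrt.2 (s2 n)
  have hdet : ∀ n : ℕ, ((n : ℝ) + 1) ^ d ≤ √√√((n : ℝ) + 1) * √√((n : ℝ) + 1) * ((n : ℝ) + 1) ^ d :=
    fun n => le_mul_of_one_le_left (by positivity) (one_le_mul_of_one_le_of_one_le (s3 n) (s2 n))
  obtain ⟨A, hA, hchoose⟩ := exists_abs_choose_sub_le (d + 1)
  have hchoose' : ∀ n x : ℕ, x ≤ n → |(x.choose (d + 1) : ℝ) - (x : ℝ) ^ (d + 1) /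
      (d + 1).factorial| ≤ A * ((n : ℝ) + 1) ^ d := by
    intro n x hx
    have h1 := hchoose x ((n : ℝ) + 1) (by linarith [(Nat.cast_nonneg n : (0 : ℝ) ≤ n)])
      (by exact_mod_cast hx.trans (Nat.le_succ n))
    rw [pow_succ ((n : ℝ) + 1), ← mul_assoc] at h1
    exact le_of_mul_le_mul_right h1 (by positivity)
  have t1 : LpBigO (iidLaw ν) (fun n b => devSum ν f (cutCount b n) b -
      linSum ν f (cutCount b n) b)
      fun n => √√√((n : ℝ) + 1) * √√((n : ℝ) + 1) * ((n : ℝ) + 1) ^ d := by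
    refine (lpBigO_family_at_cutCount (Y := fun _ k b => devSum ν f k b - linSum ν f k b)
      (fun n k => (measurable_devSum f k).sub (measurable_linSum ν f k))
      (a := fun n => ((n : ℝ) + 1) ^ d) (fun n => by positivity)
      (((lpBigO_devSum_sub_linSum hfp).comp
        fun x : {x : ℕ × ℕ // x.2 ∈ Finset.range (x.1 + 1)} => x.1.2).mono_rate
          fun x => monotone_rate_pow d (Nat.lt_succ_iff.1 (Finset.mem_range.1 x.2)))).mono_rate
      fun n => ?_
    rw [mul_assoc]
    refine mul_le_mul_of_nonneg_left ?_ (Real.sqrt_nonneg _)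
    exact le_mul_of_one_le_left (by positivity) (s2 n)
  have t2 : LpBigO (iidLaw ν) (fun n b => linSum ν f (cutCount b n) b -
      linSum ν f (blockIndex ν n) b)
      fun n => √√√((n : ℝ) + 1) * √√((n : ℝ) + 1) * ((n : ℝ) + 1) ^ d :=
    (lpBigO_linSum_cutCount_sub hν hfp).mono_rate fun n => le_of_eq (by ring)
  have t3 : LpBigO (iidLaw ν) (fun (n : ℕ) b => ((cutCount b n).choose (d + 1) : ℝ) -
      (cutCount b n : ℝ) ^ (d + 1) / (d + 1).factorial)
      fun n => √√√((n : ℝ) + 1) * √√((n : ℝ) + 1) * ((n : ℝ) + 1) ^ d := by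
    refine LpBigO.of_rate_mul hA (((LpBigO.const fun n : ℕ => A * ((n : ℝ) + 1) ^ d).of_le
      (fun n => ?_) fun n => Eventually.of_forall fun b => ?_).mono_rate fun n => ?_)
    · exact (Measurable.comp (g := fun k : ℕ => (k.choose (d + 1) : ℝ) -
        (k : ℝ) ^ (d + 1) / (d + 1).factorial) .of_discrete
        (measurable_cutCount n)).aestronglyMeasurable
    · exact (hchoose' n _ (cutCount_le b n)).trans (le_abs_self _)
    · rw [abs_of_nonneg (by positivity)]
      exact mul_le_mul_of_nonneg_left (hdet n) hA
  have t4 : LpBigO (iidLaw ν) (fun (n : ℕ) b => (cutCount b n : ℝ) ^ (d + 1) -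
      ((n : ℝ) / sizeMean ν) ^ (d + 1) - (d + 1) * ((n : ℝ) / sizeMean ν) ^ d *
        ((cutCount b n : ℝ) - n / sizeMean ν))
      fun n => √√√((n : ℝ) + 1) * √√((n : ℝ) + 1) * ((n : ℝ) + 1) ^ d := by
    -- The second-order Taylor error is the square of a variable of order `√n` times `n ^ (d - 1)`.
    have h1 := ((LpBigO.const (P := iidLaw ν) fun n : ℕ => ((n : ℝ) + 1) ^ d / ((n : ℝ) + 1)).mul
      ((lpBigO_cutCount_sub hν).pow (fun n => Real.sqrt_nonneg _) 2)
      fun n => abs_nonneg _).const_mul (((d : ℝ) + 1) ^ 2)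
    refine (h1.mono_rate fun n => ?_).of_le (fun n => ?_) fun n => Eventually.of_forall fun b => ?_
    · rw [Real.sq_sqrt (by positivity), abs_of_nonneg (by positivity), div_mul_cancel₀ _
        (by positivity)]
      exact hdet n
    · exact (Measurable.comp (g := fun k : ℕ => (k : ℝ) ^ (d + 1) -
        ((n : ℝ) / sizeMean ν) ^ (d + 1) - (d + 1) * ((n : ℝ) / sizeMean ν) ^ d *
          ((k : ℝ) - n / sizeMean ν)) .of_discrete (measurable_cutCount n)).aestronglyMeasurable
    · have h2 := abs_pow_succ_sub_linear_le d (x := cutCount b n) (y := n / sizeMean ν)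
        (X := (n : ℝ) + 1) (Nat.cast_nonneg _)
        (by exact_mod_cast (cutCount_le b n).trans (Nat.le_succ n))
        (div_nonneg (Nat.cast_nonneg n) (by linarith))
        ((div_sizeMean_le hm n).trans (by linarith))
      refine le_trans ?_ (le_abs_self _)
      have h3 : (0 : ℝ) < (n : ℝ) + 1 := by positivity
      rw [← le_div_iff₀ h3] at h2
      refine h2.trans (le_of_eq ?_)
      ring
  have t5 : LpBigO (iidLaw ν) (fun (n : ℕ) b => ((n : ℝ) / sizeMean ν) ^ d *
      ((linSum ν (fun (_ : Fin (0 + 1)) B => (B.1 : ℝ)) (cutCount b n) b -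
        linSum ν (fun (_ : Fin (0 + 1)) B => (B.1 : ℝ)) (blockIndex ν n) b) +
          ((n : ℝ) - cutSeq b (cutCount b n))))
      fun n => √√√((n : ℝ) + 1) * √√((n : ℝ) + 1) * ((n : ℝ) + 1) ^ d := by
    have h1 := lpBigO_linSum_cutCount_sub hν (f := fun (_ : Fin (0 + 1)) B => (B.1 : ℝ))
      fun _ => hν.memLp
    have h2 : LpBigO (iidLaw ν) (fun (n : ℕ) b => (n : ℝ) - cutSeq b (cutCount b n))
        fun n => √√((n : ℝ) + 1) := by
      refine (lpBigO_at_cutCount hν.memLp).of_le (fun n => ?_) fun n => ?_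
      · exact (measurable_at_cutCount (F := fun k b => (n : ℝ) - cutSeq b k) (fun k =>
          measurable_const.sub ((Measurable.of_discrete (f := fun m : ℕ => (m : ℝ))).comp
            (measurable_cutSeq k))) n).aestronglyMeasurable
      · filter_upwards [hν.ae_pos] with b hb
        have h3 : (cutSeq b (cutCount b n) : ℝ) ≤ n := by exact_mod_cast cutSeq_cutCount_le b n
        have h4 := (lt_cutSeq_cutCount_succ hb n).le
        rw [cutSeq_succ] at h4
        have h5 : (n : ℝ) ≤ cutSeq b (cutCount b n) + (b (cutCount b n)).1 := by exact_mod_cast h4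
        rw [abs_of_nonneg (by linarith), Nat.abs_cast]
        linarith
    have h3 := (h1.mono_rate (b := fun n : ℕ => √√√((n : ℝ) + 1) * √√((n : ℝ) + 1)) fun n =>
      le_of_eq (by ring)).add (h2.mono_rate (b := fun n : ℕ => √√√((n : ℝ) + 1) * √√((n : ℝ) + 1))
        fun n => le_mul_of_one_le_left (Real.sqrt_nonneg _) (s3 n)) fun n => by positivity
    have h4 := (LpBigO.const (P := iidLaw ν) fun n : ℕ => ((n : ℝ) / sizeMean ν) ^ d).mul h3
      fun n => abs_nonneg _
    refine h4.mono_rate fun n => ?_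
    have h5 : (0 : ℝ) ≤ n / sizeMean ν := div_nonneg (Nat.cast_nonneg n) (by linarith)
    rw [abs_of_nonneg (by positivity), mul_comm]
    have h6 : (n : ℝ) / sizeMean ν ≤ n + 1 := (div_sizeMean_le hm n).trans (by linarith)
    gcongr
  have t6 : LpBigO (iidLaw ν) (fun (n : ℕ) _ => (n.choose (d + 1) : ℝ) -
      (n : ℝ) ^ (d + 1) / (d + 1).factorial)
      fun n => √√√((n : ℝ) + 1) * √√((n : ℝ) + 1) * ((n : ℝ) + 1) ^ d := by
    refine LpBigO.of_rate_mul hA ((LpBigO.const fun n : ℕ => (n.choose (d + 1) : ℝ) -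
      (n : ℝ) ^ (d + 1) / (d + 1).factorial).mono_rate fun n => ?_)
    exact (hchoose' n n le_rfl).trans (mul_le_mul_of_nonneg_left (hdet n) hA)
  have h0 : ∀ n : ℕ, 0 ≤ √√√((n : ℝ) + 1) * √√((n : ℝ) + 1) * ((n : ℝ) + 1) ^ d :=
    fun n => by positivity
  have hall := ((((t1.add t2 h0).add (t3.const_mul μ) h0).add
    (t4.const_mul (μ / (d + 1).factorial)) h0).add
    (t5.const_mul (-(μ / (d.factorial * sizeMean ν)))) h0).add
    (t6.const_mul (-∏ j, freq ν (f j))) h0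
  convert hall using 3 with n b
  have hfreq : (∏ j, freq ν (f j)) = μ / sizeMean ν ^ (d + 1) := by
    simp only [freq]
    rw [Finset.prod_div_distrib, Finset.prod_const, Finset.card_univ, Fintype.card_fin]
    rfl
  rw [centredSum, hfreq, linApprox, linSum_size, linSum_size, devSum, ← hμ, Nat.factorial_succ]
  push_cast
  have hd0 : (d.factorial : ℝ) ≠ 0 := by positivity
  have hd1 : (d : ℝ) + 1 ≠ 0 := by positivity
  simp only [div_pow]
  field_simp
  ring

end randomIndex

/-! ### A central limit theorem for triangular arrays -/

theorem norm_cexp_mul_I_sub_le (x : ℝ) :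
    ‖Complex.exp (x * Complex.I) - (1 + x * Complex.I - (x : ℂ) ^ 2 / 2)‖ ≤ 4 * |x| ^ 3 := by
  have hsum : ∑ m ∈ Finset.range 3, ((x : ℂ) * Complex.I) ^ m / m.factorial =
      1 + x * Complex.I - (x : ℂ) ^ 2 / 2 := by
    simp [Finset.sum_range_succ, mul_pow, Nat.factorial]
    ring
  have hnorm : ‖(x : ℂ) * Complex.I‖ = |x| := by simp
  rcases le_or_gt |x| 1 with h | h
  · have h1 := Complex.norm_exp_sub_sum_le_norm_mul_exp ((x : ℂ) * Complex.I) 3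
    rw [hsum, hnorm] at h1
    refine h1.trans ?_
    have h2 : Real.exp |x| ≤ 4 := by
      have := Real.exp_le_exp.2 h
      have h3 := Real.exp_one_lt_d9
      linarith
    have h3 : 0 ≤ |x| ^ 3 := by positivity
    nlinarith
  · have h1 : ‖(x : ℂ) ^ 2 / 2‖ = |x| ^ 2 / 2 := by simp
    have h2 : ‖Complex.exp (x * Complex.I)‖ = 1 := Complex.norm_exp_ofReal_mul_I x
    have h3 := norm_sub_le (Complex.exp (x * Complex.I)) (1 + x * Complex.I - (x : ℂ) ^ 2 / 2)
    have h4 := norm_sub_le (1 + x * Complex.I) ((x : ℂ) ^ 2 / 2)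
    have h5 := norm_add_le (1 : ℂ) (x * Complex.I)
    rw [hnorm, norm_one] at h5
    rw [h1] at h4
    rw [h2] at h3
    have h6 : |x| ≤ |x| ^ 3 := le_self_pow₀ h.le (by norm_num)
    have h7 : |x| ^ 2 ≤ |x| ^ 3 := pow_le_pow_right₀ h.le (by norm_num)
    have h8 : 1 ≤ |x| ^ 3 := one_le_pow₀ h.le
    linarith

theorem abs_exp_neg_sub_le {x : ℝ} (hx : 0 ≤ x) : |Real.exp (-x) - (1 - x)| ≤ x ^ 2 := by
  have h1 := Real.add_one_le_exp (-x)
  rw [abs_of_nonneg (by linarith)]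
  rcases le_or_gt x 1 with h | h
  · have h2 := Real.norm_exp_sub_one_sub_id_le (x := -x) (by simpa [abs_of_nonneg hx] using h)
    rw [Real.norm_eq_abs, Real.norm_eq_abs, abs_neg, abs_of_nonneg hx] at h2
    have := (abs_le.1 h2).2
    linarith
  · have h2 : Real.exp (-x) ≤ 1 := Real.exp_le_one_iff.2 (by linarith)
    nlinarith

/-- Factors are exchanged one at a time; all others lie in the unit disc. -/
theorem norm_prod_sub_prod_le_sum {ι : Type*} (s : Finset ι) {a c : ι → ℂ}
    (ha : ∀ i ∈ s, ‖a i‖ ≤ 1) (hc : ∀ i ∈ s, ‖c i‖ ≤ 1) :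
    ‖∏ i ∈ s, a i - ∏ i ∈ s, c i‖ ≤ ∑ i ∈ s, ‖a i - c i‖ := by
  classical
  induction s using Finset.induction_on with
  | empty => simp
  | insert i s hi ih =>
    rw [Finset.prod_insert hi, Finset.prod_insert hi, Finset.sum_insert hi]
    have h1 := ih (fun j hj => ha j (Finset.mem_insert_of_mem hj))
      fun j hj => hc j (Finset.mem_insert_of_mem hj)
    have h2 : ‖∏ j ∈ s, c j‖ ≤ 1 := by
      rw [norm_prod]
      exact Finset.prod_le_one (fun j _ => norm_nonneg _)
        fun j hj => hc j (Finset.mem_insert_of_mem hj)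
    have h3 : a i * ∏ j ∈ s, a j - c i * ∏ j ∈ s, c j =
        a i * (∏ j ∈ s, a j - ∏ j ∈ s, c j) + (a i - c i) * ∏ j ∈ s, c j := by ring
    rw [h3]
    refine (norm_add_le _ _).trans ?_
    rw [norm_mul, norm_mul]
    have h4 := mul_le_mul_of_nonneg_left h2 (norm_nonneg (a i - c i))
    have h5 := mul_le_mul_of_nonneg_right (ha i (Finset.mem_insert_self i s))
      (norm_nonneg (∏ j ∈ s, a j - ∏ j ∈ s, c j))
    linarith

section triangular

variable {ν : Measure FinPerm} [IsProbabilityMeasure ν]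

theorem integral_cexp_sum (ξ : ℕ → FinPerm → ℝ) (K : ℕ) :
    ∫ b, Complex.exp ((∑ k ∈ Finset.range K, ξ k (b k) : ℝ) * Complex.I) ∂(iidLaw ν) =
      ∏ k ∈ Finset.range K, ∫ B, Complex.exp (ξ k B * Complex.I) ∂ν := by
  have hm : ∀ k, Measurable fun B => Complex.exp (ξ k B * Complex.I) := fun k => .of_discrete
  have h1 : iIndepFun (fun (k : Fin K) (b : ℕ → FinPerm) =>
      Complex.exp (ξ k (b k) * Complex.I)) (iidLaw ν) :=
    (iIndepFun_infinitePi (P := fun _ : ℕ => ν)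
      (X := fun k B => Complex.exp (ξ k B * Complex.I)) hm).precomp Fin.val_injective
  have h2 := h1.integral_fun_prod_eq_prod_integral
    fun k => ((hm k).comp (measurable_pi_apply _)).aestronglyMeasurable
  rw [Finset.prod_range]
  convert h2 using 1
  · congr 1
    funext b
    rw [← Complex.exp_sum, ← Finset.sum_mul, Finset.sum_range]
    push_cast
    rfl
  · refine Finset.prod_congr rfl fun k _ => ?_
    have h3 := measurePreserving_eval_infinitePi (fun _ : ℕ => ν) (k : ℕ)
    have h4 := integral_map (μ := iidLaw ν) h3.measurable.aemeasurable
      (f := fun B => Complex.exp (ξ k B * Complex.I)) (hm k).aestronglyMeasurable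
    rw [h3.map_eq] at h4
    exact h4

/-- Lyapunov's argument. Each factor of the characteristic function is `1 - Var / 2` up to a
third-moment error of order `n ^ (-3/2)`, and agrees with the Gaussian factor up to another `n ^
(-2)`. Summed over at most `n` factors, these errors vanish; the domination by `G B / √n` makes them
uniform. -/
theorem tendsto_integral_cexp_sum {ξ : ℕ → ℕ → FinPerm → ℝ} {K : ℕ → ℕ} (hK : ∀ n, K n ≤ n)
    {G : FinPerm → ℝ} (hG : ∀ p : ℕ, MemLp G p ν) (hξ0 : ∀ n k, ∫ B, ξ n k B ∂ν = 0)
    (hξ : ∀ n, 1 ≤ n → ∀ k < K n, ∀ B, |ξ n k B| ≤ G B / √n) {v : ℝ}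
    (hv : Tendsto (fun n => ∑ k ∈ Finset.range (K n), ∫ B, ξ n k B ^ 2 ∂ν) atTop (𝓝 v)) :
    Tendsto (fun n => ∫ b, Complex.exp ((∑ k ∈ Finset.range (K n), ξ n k (b k) : ℝ) * Complex.I)
      ∂(iidLaw ν)) atTop (𝓝 (Complex.exp (-(v / 2 : ℝ)))) := by
  simp_rw [integral_cexp_sum]
  set g2 := ∫ B, G B ^ 2 ∂ν with hg2
  set g3 := ∫ B, |G B| ^ 3 ∂ν with hg3
  have hint : ∀ {f : FinPerm → ℝ}, (∀ p : ℕ, MemLp f p ν) → Integrable f ν := fun hf =>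
    (hf 1).integrable (by simp)
  have hGi2 : Integrable (fun B => G B ^ 2) ν := hint (memLp_pow_all hG 2)
  have hGi3 : Integrable (fun B => |G B| ^ 3) ν := hint (memLp_pow_all (fun p => (hG p).abs) 3)
  have hbound : ∀ n, 1 ≤ n → ‖∏ k ∈ Finset.range (K n), ∫ B, Complex.exp (ξ n k B * Complex.I) ∂ν -
      ∏ k ∈ Finset.range (K n), Complex.exp (-((∫ B, ξ n k B ^ 2 ∂ν) / 2 : ℝ))‖ ≤
      4 * g3 / √n + g2 ^ 2 / 4 / n := by
    intro n hn
    have hn0 : (0 : ℝ) < n := by exact_mod_cast hn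
    have hs : 0 < √(n : ℝ) := Real.sqrt_pos.2 hn0
    have hss : √(n : ℝ) * √n = n := Real.mul_self_sqrt hn0.le
    refine (norm_prod_sub_prod_le_sum _ (fun k _ => ?_) fun k _ => ?_).trans ?_
    · refine (norm_integral_le_integral_norm _).trans (le_of_eq ?_)
      simp [Complex.norm_exp_ofReal_mul_I]
    · rw [← Complex.ofReal_neg, ← Complex.ofReal_exp, Complex.norm_real, Real.norm_eq_abs,
        Real.abs_exp, Real.exp_le_one_iff, neg_nonpos]
      exact div_nonneg (integral_nonneg fun B => sq_nonneg _) (by norm_num)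
    · have hterm : ∀ k ∈ Finset.range (K n), ‖∫ B, Complex.exp (ξ n k B * Complex.I) ∂ν -
          Complex.exp (-((∫ B, ξ n k B ^ 2 ∂ν) / 2 : ℝ))‖ ≤
          4 * g3 / (n * √n) + g2 ^ 2 / 4 / (n : ℝ) ^ 2 := by
        intro k hk
        have hk' := hξ n hn k (Finset.mem_range.1 hk)
        have hξm : MemLp (ξ n k) 2 ν := by
          refine MemLp.of_le (g := fun B => G B / √n) ?_
            (Measurable.of_discrete (f := ξ n k)).aestronglyMeasurable
            (Eventually.of_forall fun B => (hk' B).trans (le_abs_self _))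
          simpa [div_eq_mul_inv] using (hG 2).mul_const (√(n : ℝ))⁻¹
        have hi1 : Integrable (ξ n k) ν := hξm.integrable (by norm_num)
        have hi2 : Integrable (fun B => ξ n k B ^ 2) ν := hξm.integrable_sq
        have hexp : Integrable (fun B => Complex.exp (ξ n k B * Complex.I)) ν := by
          refine (integrable_const (1 : ℝ)).mono'
            (Measurable.of_discrete
              (f := fun B => Complex.exp (ξ n k B * Complex.I))).aestronglyMeasurable
            (Eventually.of_forall fun B => ?_)
          rw [Complex.norm_exp_ofReal_mul_I]
        have hpoly : Integrable (fun B => 1 + (ξ n k B : ℂ) * Complex.I - (ξ n k B : ℂ) ^ 2 / 2) ν := by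
          refine ((integrable_const 1).add (hi1.ofReal.mul_const _)).sub ?_
          have := hi2.ofReal (𝕜 := ℂ)
          push_cast at this
          exact this.div_const 2
        have hpint : ∫ B, (1 + (ξ n k B : ℂ) * Complex.I - (ξ n k B : ℂ) ^ 2 / 2) ∂ν =
            ((1 - (∫ B, ξ n k B ^ 2 ∂ν) / 2 : ℝ) : ℂ) := by
          have e1 : ∫ B, (ξ n k B : ℂ) ∂ν = ((∫ B, ξ n k B ∂ν : ℝ) : ℂ) := integral_ofReal
          have e2 : ∫ B, (ξ n k B : ℂ) ^ 2 ∂ν = ((∫ B, ξ n k B ^ 2 ∂ν : ℝ) : ℂ) := by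
            have := integral_ofReal (𝕜 := ℂ) (μ := ν) (f := fun B => ξ n k B ^ 2)
            push_cast at this ⊢
            exact this
          have hi2' : Integrable (fun B => (ξ n k B : ℂ) ^ 2 / 2) ν := by
            have := hi2.ofReal (𝕜 := ℂ)
            push_cast at this
            exact this.div_const 2
          have hi1' : Integrable (fun B => (1 : ℂ) + (ξ n k B : ℂ) * Complex.I) ν :=
            (integrable_const 1).add (hi1.ofReal.mul_const _)
          rw [integral_sub hi1' hi2', integral_add (integrable_const _)
            (hi1.ofReal.mul_const _), integral_mul_const, integral_div, e1, e2, hξ0]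
          simp
        have hd1 : ‖∫ B, Complex.exp (ξ n k B * Complex.I) ∂ν -
            ((1 - (∫ B, ξ n k B ^ 2 ∂ν) / 2 : ℝ) : ℂ)‖ ≤ 4 * g3 / (n * √n) := by
          rw [← hpint, ← integral_sub hexp hpoly]
          refine (norm_integral_le_integral_norm _).trans ?_
          have h1 : ∫ B, ‖Complex.exp (ξ n k B * Complex.I) -
              (1 + (ξ n k B : ℂ) * Complex.I - (ξ n k B : ℂ) ^ 2 / 2)‖ ∂ν ≤
              ∫ B, 4 / (n * √n) * |G B| ^ 3 ∂ν := by
            refine integral_mono (hexp.sub hpoly).norm (hGi3.const_mul _) fun B => ?_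
            refine (norm_cexp_mul_I_sub_le _).trans ?_
            have h2 := pow_le_pow_left₀ (abs_nonneg _) ((hk' B).trans
              (div_le_div_of_nonneg_right (le_abs_self (G B)) hs.le)) 3
            have h3 : (√(n : ℝ)) ^ 3 = n * √n := by rw [pow_succ, sq, hss]
            rw [div_pow, h3] at h2
            calc 4 * |ξ n k B| ^ 3 ≤ 4 * (|G B| ^ 3 / (n * √n)) := by linarith
              _ = _ := by ring
          refine h1.trans (le_of_eq ?_)
          rw [integral_const_mul]
          ring
        have hv2 : ∫ B, ξ n k B ^ 2 ∂ν ≤ g2 / n := by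
          have h1 : ∫ B, ξ n k B ^ 2 ∂ν ≤ ∫ B, (n : ℝ)⁻¹ * G B ^ 2 ∂ν := by
            refine integral_mono hi2 (hGi2.const_mul _) fun B => ?_
            have h2 := pow_le_pow_left₀ (abs_nonneg _) (hk' B) 2
            rw [sq_abs, div_pow, Real.sq_sqrt hn0.le] at h2
            refine h2.trans (le_of_eq ?_)
            ring
          rw [integral_const_mul] at h1
          refine h1.trans (le_of_eq ?_)
          rw [hg2]; ring
        have hv0 : 0 ≤ ∫ B, ξ n k B ^ 2 ∂ν := integral_nonneg fun B => sq_nonneg _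
        have hd2 : ‖Complex.exp (-((∫ B, ξ n k B ^ 2 ∂ν) / 2 : ℝ)) -
            ((1 - (∫ B, ξ n k B ^ 2 ∂ν) / 2 : ℝ) : ℂ)‖ ≤ g2 ^ 2 / 4 / (n : ℝ) ^ 2 := by
          rw [← Complex.ofReal_neg, ← Complex.ofReal_exp, ← Complex.ofReal_sub, Complex.norm_real,
            Real.norm_eq_abs]
          refine (abs_exp_neg_sub_le (by positivity)).trans ?_
          have := pow_le_pow_left₀ (by positivity)
            (div_le_div_of_nonneg_right hv2 (by norm_num : (0 : ℝ) ≤ 2)) 2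
          refine this.trans (le_of_eq ?_)
          ring
        rw [norm_sub_rev] at hd2
        exact (norm_sub_le_norm_sub_add_norm_sub _ _ _).trans (add_le_add hd1 hd2)
      refine (Finset.sum_le_card_nsmul _ _ _ hterm).trans ?_
      rw [Finset.card_range, nsmul_eq_mul]
      have hKn : (K n : ℝ) ≤ n := by exact_mod_cast hK n
      have hg3' : 0 ≤ g3 := integral_nonneg fun B => by positivity
      refine (mul_le_mul_of_nonneg_right hKn (by positivity)).trans (le_of_eq ?_)
      field_simp
  have hlim : Tendsto (fun n : ℕ => ∏ k ∈ Finset.range (K n),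
      Complex.exp (-((∫ B, ξ n k B ^ 2 ∂ν) / 2 : ℝ))) atTop (𝓝 (Complex.exp (-(v / 2 : ℝ)))) := by
    have h1 : ∀ n, ∏ k ∈ Finset.range (K n), Complex.exp (-((∫ B, ξ n k B ^ 2 ∂ν) / 2 : ℝ)) =
        Complex.exp (-((∑ k ∈ Finset.range (K n), ∫ B, ξ n k B ^ 2 ∂ν) / 2 : ℝ)) := by
      intro n
      rw [← Complex.exp_sum, Finset.sum_neg_distrib, Finset.sum_div]
      push_cast
      rfl
    simp_rw [h1]
    refine (Complex.continuous_exp.tendsto _).comp (Tendsto.neg ?_)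
    exact (Complex.continuous_ofReal.tendsto _).comp (hv.div_const 2)
  have hzero : Tendsto (fun n : ℕ => 4 * g3 / √(n : ℝ) + g2 ^ 2 / 4 / n) atTop (𝓝 0) := by
    have h1 : Tendsto (fun n : ℕ => √(n : ℝ)) atTop atTop :=
      Real.tendsto_sqrt_atTop.comp tendsto_natCast_atTop_atTop
    simpa using (h1.const_div_atTop (4 * g3)).add
      (tendsto_natCast_atTop_atTop.const_div_atTop (g2 ^ 2 / 4))
  have hdiff := squeeze_zero_norm' (eventually_atTop.2 ⟨1, hbound⟩) hzero
  simpa using hdiff.add hlim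

end triangular

/-! ### Sums of products of binomial coefficients -/

/-- Subsets of size `a + c + 1` are counted by their element of rank `a`, which has `a` elements
below it and `c` above. The induction uses Pascal's rule. -/
theorem sum_choose_mul_choose (a c K : ℕ) :
    ∑ k ∈ Finset.range K, k.choose a * (K - 1 - k).choose c = K.choose (a + c + 1) := by
  induction c generalizing K with
  | zero => simpa using sum_range_choose_eq K a
  | succ c ih =>
    induction K with
    | zero => simp
    | succ K ihK =>
      rw [Nat.choose_succ_succ, ← ihK, show a + (c + 1) = a + c + 1 from rfl, ← ih,
        Finset.sum_range_succ, Nat.add_sub_cancel, Nat.sub_self, Nat.choose_zero_succ, mul_zero,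
        add_zero, ← Finset.sum_add_distrib]
      refine Finset.sum_congr rfl fun k hk => ?_
      have : K - k = K - 1 - k + 1 := by have := Finset.mem_range.1 hk; omega
      rw [this, Nat.choose_succ_succ, mul_add]

theorem choose_le_pow_real {x : ℕ} {X : ℝ} (hx : (x : ℝ) ≤ X) (r : ℕ) : (x.choose r : ℝ) ≤ X ^ r := by
  have h2 : (x.choose r : ℝ) ≤ (x : ℝ) ^ r := by exact_mod_cast Nat.choose_le_pow x r
  exact h2.trans (pow_le_pow_left₀ (Nat.cast_nonneg x) hx r)

theorem abs_mul_sub_mul_le {a a' b b' X A B p r : ℝ} (hX : 0 ≤ X) (hb0 : 0 ≤ b) (hb : b ≤ r)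
    (ha0 : 0 ≤ a') (ha : a' ≤ p) (h1 : |a - a'| * X ≤ A * p) (h2 : |b - b'| * X ≤ B * r)
    (hA : 0 ≤ A) (hB : 0 ≤ B) :
    |a * b - a' * b'| * X ≤ (A + B) * (p * r) := by
  have e : a * b - a' * b' = (a - a') * b + a' * (b - b') := by ring
  have hp : 0 ≤ p := ha0.trans ha
  calc |a * b - a' * b'| * X ≤ (|a - a'| * b + a' * |b - b'|) * X := by
        refine mul_le_mul_of_nonneg_right ?_ hX
        rw [e]
        refine (abs_add_le _ _).trans (le_of_eq ?_)
        rw [abs_mul, abs_mul, abs_of_nonneg hb0, abs_of_nonneg ha0]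
    _ = (|a - a'| * X) * b + a' * (|b - b'| * X) := by ring
    _ ≤ (A * p) * r + p * (B * r) := by
        refine add_le_add (mul_le_mul h1 hb hb0 (mul_nonneg hA hp))
          (mul_le_mul ha h2 (mul_nonneg (abs_nonneg _) hX) hp)
    _ = _ := by ring

/-- Both sides have leading term `x ^ (i + j) / (i! j!)`, so they differ by one degree less. -/
theorem exists_abs_choose_mul_choose_sub_le (i j : ℕ) : ∃ A : ℝ, 0 ≤ A ∧ ∀ (x : ℕ) (X : ℝ), 1 ≤ X →
    (x : ℝ) ≤ X → |(x.choose i : ℝ) * x.choose j - ((i + j).choose i : ℝ) * x.choose (i + j)| * X ≤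
      A * X ^ (i + j) := by
  obtain ⟨A, hA, h1⟩ := exists_abs_choose_sub_le i
  obtain ⟨B, hB, h2⟩ := exists_abs_choose_sub_le j
  obtain ⟨C, hC, h3⟩ := exists_abs_choose_sub_le (i + j)
  refine ⟨A + B + (i + j).choose i * C, by positivity, fun x X hX hx => ?_⟩
  have hX0 : 0 ≤ X := by linarith
  have hx0 : (0 : ℝ) ≤ x := Nat.cast_nonneg x
  have hpow : (x : ℝ) ^ i / i.factorial ≤ X ^ i := by
    refine (div_le_self (by positivity) ?_).trans (pow_le_pow_left₀ hx0 hx i)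
    exact_mod_cast Nat.factorial_pos i
  have h4 := abs_mul_sub_mul_le hX0 (Nat.cast_nonneg (x.choose j)) (choose_le_pow_real hx j)
    (by positivity) hpow (h1 x X hX hx) (h2 x X hX hx) hA hB
  have e : (x : ℝ) ^ i / i.factorial * ((x : ℝ) ^ j / j.factorial) =
      ((i + j).choose i : ℝ) * ((x : ℝ) ^ (i + j) / (i + j).factorial) := by
    have := Nat.add_choose_mul_factorial_mul_factorial i j
    have h5 : ((i + j).choose i : ℝ) * i.factorial * j.factorial = (i + j).factorial := by
      rw [Nat.choose_symm_add]
      exact_mod_cast this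
    rw [← h5, pow_add]
    have : ((i + j).choose i : ℝ) ≠ 0 := by
      exact_mod_cast (Nat.choose_pos (Nat.le_add_right i j)).ne'
    field_simp
  rw [e, ← pow_add] at h4
  have h5 := mul_le_mul_of_nonneg_left (h3 x X hX hx) (Nat.cast_nonneg ((i + j).choose i) : (0 : ℝ) ≤ _)
  have h6 := abs_sub_le ((x.choose i : ℝ) * x.choose j)
    (((i + j).choose i : ℝ) * ((x : ℝ) ^ (i + j) / (i + j).factorial))
    (((i + j).choose i : ℝ) * x.choose (i + j))
  rw [← mul_sub (((i + j).choose i : ℕ) : ℝ), abs_mul, Nat.abs_cast,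
    abs_sub_comm ((x : ℝ) ^ (i + j) / (i + j).factorial)] at h6
  have h7 := mul_le_mul_of_nonneg_right h6 hX0
  nlinarith

/-- The coefficient of the `j`-th function at the `k`-th of `K` blocks. -/
def chooseCoef (d K k j : ℕ) : ℝ := (k.choose j : ℝ) * ((K - 1 - k).choose (d - j) : ℝ)

theorem chooseCoef_nonneg (d K k j : ℕ) : 0 ≤ chooseCoef d K k j :=
  mul_nonneg (Nat.cast_nonneg _) (Nat.cast_nonneg _)

theorem chooseCoef_le {d K k j : ℕ} (hj : j ≤ d) (hk : k < K) {X : ℝ} (hX : (K : ℝ) ≤ X) :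
    chooseCoef d K k j ≤ X ^ d := by
  have h1 : (k : ℝ) ≤ X := le_trans (by exact_mod_cast hk.le) hX
  have h2 : ((K - 1 - k : ℕ) : ℝ) ≤ X := le_trans (by exact_mod_cast (by omega : K - 1 - k ≤ K)) hX
  have h0 : 0 ≤ X := (Nat.cast_nonneg k).trans h1
  calc chooseCoef d K k j ≤ X ^ j * X ^ (d - j) :=
        mul_le_mul (choose_le_pow_real h1 j) (choose_le_pow_real h2 _) (Nat.cast_nonneg _)
          (by positivity)
    _ = X ^ d := by rw [← pow_add, Nat.add_sub_cancel' hj]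

theorem sum_chooseCoef {d j : ℕ} (hj : j ≤ d) (K : ℕ) :
    ∑ k ∈ Finset.range K, chooseCoef d K k j = K.choose (d + 1) := by
  have := sum_choose_mul_choose j (d - j) K
  rw [Nat.add_sub_cancel' hj] at this
  simp only [chooseCoef]
  exact_mod_cast this

/-- The products of two binomials in `k`, and in `K - 1 - k`, are replaced by multiples of single
binomials at a relative cost `1 / K`. The resulting sum is evaluated exactly by
`sum_choose_mul_choose`. -/
theorem tendsto_sum_chooseCoef_mul {d i j : ℕ} (hi : i ≤ d) (hj : j ≤ d) :
    Tendsto (fun K : ℕ => (∑ k ∈ Finset.range K, chooseCoef d K k i * chooseCoef d K k j) /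
      (K : ℝ) ^ (2 * d + 1)) atTop
      (𝓝 (((i + j).choose i : ℝ) * (((d - i) + (d - j)).choose (d - i) : ℝ) /
        (2 * d + 1).factorial)) := by
  obtain ⟨A, hA, h1⟩ := exists_abs_choose_mul_choose_sub_le i j
  obtain ⟨B, hB, h2⟩ := exists_abs_choose_mul_choose_sub_le (d - i) (d - j)
  set c1 : ℝ := ((i + j).choose i : ℝ) with hc1
  set c2 : ℝ := (((d - i) + (d - j)).choose (d - i) : ℝ) with hc2
  have hexp : (i + j) + ((d - i) + (d - j)) = 2 * d := by omega
  have hmain : Tendsto (fun K : ℕ => c1 * c2 * ((K.choose (2 * d + 1) : ℝ) / (K : ℝ) ^ (2 * d + 1)))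
      atTop (𝓝 (c1 * c2 / (2 * d + 1).factorial)) := by
    have := (tendsto_choose_div_pow (2 * d + 1)).const_mul (c1 * c2)
    rwa [mul_one_div] at this
  have hc10 : 0 ≤ c1 := Nat.cast_nonneg _
  have hdiff : ∀ K : ℕ, 1 ≤ K → ‖(∑ k ∈ Finset.range K, chooseCoef d K k i * chooseCoef d K k j) /
      (K : ℝ) ^ (2 * d + 1) - c1 * c2 * ((K.choose (2 * d + 1) : ℝ) / (K : ℝ) ^ (2 * d + 1))‖ ≤
      (c1 * A + A + c1 * B) / K := by
    intro K hK
    have hK0 : (0 : ℝ) < K := by exact_mod_cast hK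
    have hK1 : (1 : ℝ) ≤ K := by exact_mod_cast hK
    have e1 : c1 * c2 * (K.choose (2 * d + 1) : ℝ) = ∑ k ∈ Finset.range K,
        (c1 * k.choose (i + j)) * (c2 * (K - 1 - k).choose ((d - i) + (d - j))) := by
      rw [← hexp, ← sum_choose_mul_choose]
      push_cast
      rw [Finset.mul_sum]
      exact Finset.sum_congr rfl fun k _ => by ring
    have hterm : ∀ k ∈ Finset.range K, |chooseCoef d K k i * chooseCoef d K k j -
        (c1 * k.choose (i + j)) * (c2 * (K - 1 - k).choose ((d - i) + (d - j)))| ≤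
        (c1 * A + A + c1 * B) * (K : ℝ) ^ (2 * d) / K := by
      intro k hk
      have hk' := Finset.mem_range.1 hk
      have hx1 : (k : ℝ) ≤ K := by exact_mod_cast hk'.le
      have hx2 : ((K - 1 - k : ℕ) : ℝ) ≤ K := by exact_mod_cast (by omega : K - 1 - k ≤ K)
      have h3 := h1 k K hK1 hx1
      have h4 := h2 (K - 1 - k) K hK1 hx2
      have h5 : ((K - 1 - k).choose (d - i) : ℝ) * (K - 1 - k).choose (d - j) ≤
          (K : ℝ) ^ ((d - i) + (d - j)) := by
        rw [pow_add]
        exact mul_le_mul (choose_le_pow_real hx2 _) (choose_le_pow_real hx2 _) (Nat.cast_nonneg _)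
          (by positivity)
      have h6 : c1 * k.choose (i + j) ≤ c1 * (K : ℝ) ^ (i + j) :=
        mul_le_mul_of_nonneg_left (choose_le_pow_real hx1 _) hc10
      have e2 : chooseCoef d K k i * chooseCoef d K k j =
          ((k.choose i : ℝ) * k.choose j) *
            (((K - 1 - k).choose (d - i) : ℝ) * (K - 1 - k).choose (d - j)) := by
        simp only [chooseCoef]; ring
      have e3 : (k.choose i : ℝ) * k.choose j * (((K - 1 - k).choose (d - i) : ℝ) *
          (K - 1 - k).choose (d - j)) - (c1 * k.choose (i + j)) *
            (c2 * (K - 1 - k).choose ((d - i) + (d - j))) =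
          ((k.choose i : ℝ) * k.choose j - c1 * k.choose (i + j)) *
            (((K - 1 - k).choose (d - i) : ℝ) * (K - 1 - k).choose (d - j)) +
          (c1 * k.choose (i + j)) * (((K - 1 - k).choose (d - i) : ℝ) *
            (K - 1 - k).choose (d - j) - c2 * (K - 1 - k).choose ((d - i) + (d - j))) := by ring
      rw [le_div_iff₀ hK0, e2, e3]
      set U := (k.choose i : ℝ) * k.choose j - c1 * k.choose (i + j)
      set V := ((K - 1 - k).choose (d - i) : ℝ) * (K - 1 - k).choose (d - j)
      set W := V - c2 * (K - 1 - k).choose ((d - i) + (d - j))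
      set Z := c1 * (k.choose (i + j) : ℝ)
      have hV : 0 ≤ V := by positivity
      have hZ : 0 ≤ Z := by positivity
      calc |U * V + Z * W| * K ≤ (|U| * V + Z * |W|) * K := by
            refine mul_le_mul_of_nonneg_right ?_ hK0.le
            refine (abs_add_le _ _).trans (le_of_eq ?_)
            rw [abs_mul U V, abs_mul Z W, abs_of_nonneg hV, abs_of_nonneg hZ]
        _ = (|U| * K) * V + Z * (|W| * K) := by ring
        _ ≤ (A * (K : ℝ) ^ (i + j)) * (K : ℝ) ^ ((d - i) + (d - j)) +
            (c1 * (K : ℝ) ^ (i + j)) * (B * (K : ℝ) ^ ((d - i) + (d - j))) := by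
            refine add_le_add (mul_le_mul h3 h5 hV (by positivity))
              (mul_le_mul h6 h4 (by positivity) (by positivity))
        _ = (A + c1 * B) * (K : ℝ) ^ (2 * d) := by rw [← hexp, pow_add]; ring
        _ ≤ _ := by
            refine mul_le_mul_of_nonneg_right ?_ (by positivity)
            have : 0 ≤ c1 * A := mul_nonneg hc10 hA
            linarith
    rw [← mul_div_assoc, e1, ← sub_div, ← Finset.sum_sub_distrib, Real.norm_eq_abs, abs_div,
      abs_of_pos (by positivity : (0 : ℝ) < (K : ℝ) ^ (2 * d + 1)), div_le_iff₀ (by positivity)]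
    refine (Finset.abs_sum_le_sum_abs _ _).trans ((Finset.sum_le_card_nsmul _ _ _ hterm).trans
      (le_of_eq ?_))
    rw [Finset.card_range, nsmul_eq_mul]
    field_simp
    ring
  have hzero : Tendsto (fun K : ℕ => (c1 * A + A + c1 * B) / (K : ℝ)) atTop (𝓝 0) :=
    tendsto_const_div_atTop_nhds_zero_nat _
  have := (squeeze_zero_norm' (eventually_atTop.2 ⟨1, hdiff⟩) hzero).add hmain
  simpa using this

/-! ### Closed form of the linear part -/

/-- If the `j`-th factor of `d` falls on block `k`, there remain `j` earlier blocks and `d - 1 - j`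
later ones to choose, each contributing a mean. The means are nonzero, so the product of the others
is written as a quotient. -/
theorem linSum_eq {ν : Measure FinPerm} {d : ℕ} (f : Fin d → FinPerm → ℝ)
    (hf : ∀ j, ∫ B, f j B ∂ν ≠ 0) (K : ℕ) (b : ℕ → FinPerm) :
    linSum ν f K b = ∑ k ∈ Finset.range K, ∑ j, (∏ l, ∫ B, f l B ∂ν) / (∫ B, f j B ∂ν) *
      chooseCoef (d - 1) K k j * (f j (b k) - ∫ B, f j B ∂ν) := by
  induction d generalizing K with
  | zero => simp [linSum]
  | succ d ih =>
    have hinit : ∀ i, linSum ν (Fin.init f) i b = _ := fun i => ih (Fin.init f) (fun j => hf _) i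
    rw [linSum, Finset.sum_add_distrib]
    simp only [hinit]
    have hsw : ∑ i ∈ Finset.range K, (∫ B, f (Fin.last d) B ∂ν) * ∑ k ∈ Finset.range i, ∑ j,
        (∏ l, ∫ B, Fin.init f l B ∂ν) / (∫ B, Fin.init f j B ∂ν) * chooseCoef (d - 1) i k j *
          (Fin.init f j (b k) - ∫ B, Fin.init f j B ∂ν) =
        ∑ k ∈ Finset.range K, ∑ j : Fin d, (∏ l, ∫ B, f l B ∂ν) / (∫ B, f j.castSucc B ∂ν) *
          chooseCoef d K k j * (f j.castSucc (b k) - ∫ B, f j.castSucc B ∂ν) := by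
      simp only [Finset.mul_sum, Finset.range_eq_Ico]
      rw [← Finset.sum_Ico_Ico_comm']
      refine Finset.sum_congr rfl fun k hk => ?_
      rw [Finset.sum_comm]
      refine Finset.sum_congr rfl fun j _ => ?_
      have hch : ∑ i ∈ Finset.Ico (k + 1) K, chooseCoef (d - 1) i k j = chooseCoef d K k j := by
        simp only [chooseCoef]
        rw [← Finset.mul_sum, Finset.sum_Ico_eq_sum_range]
        congr 1
        have e1 : ∀ t ∈ Finset.range (K - (k + 1)), ((k + 1 + t - 1 - k).choose (d - 1 - j) : ℝ) =
            (t.choose (d - 1 - j) : ℝ) := fun t _ => by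
          rw [show k + 1 + t - 1 - k = t by omega]
        rw [Finset.sum_congr rfl e1]
        have e2 := sum_range_choose_eq (K - (k + 1)) (d - 1 - j)
        have e3 : d - 1 - (j : ℕ) + 1 = d - j := by have := j.2; omega
        rw [e3, show K - (k + 1) = K - 1 - k by omega] at e2
        rw [show K - (k + 1) = K - 1 - k by omega]
        exact_mod_cast e2
      rw [← hch, Fin.prod_univ_castSucc, Finset.mul_sum, Finset.sum_mul]
      refine Finset.sum_congr rfl fun i _ => ?_
      simp only [Fin.init]
      ring
    rw [hsw, ← Finset.sum_add_distrib]
    refine Finset.sum_congr rfl fun k _ => ?_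
    rw [Fin.sum_univ_castSucc, add_comm]
    congr 1
    have h1 := hf (Fin.last d)
    rw [Fin.prod_univ_castSucc, mul_div_cancel_right₀ _ h1]
    simp [chooseCoef, Fin.init]
    ring

/-! ### The limiting covariance -/

section covariance

variable {q : unitInterval} {d : ℕ}

/-- The statistics of a block that enter the linear approximation: its size, and its numbers of
occurrences of the blocks of a pattern. -/
def blockStat (π : BlockPattern (d + 1)) (a : Option (Fin (d + 1))) : FinPerm → ℝ :=
  a.elim (fun B => (B.1 : ℝ)) fun j => occFun π j

/-- The weights of these statistics. -/
def statWeight (q : unitInterval) (π : BlockPattern (d + 1)) (a : Option (Fin (d + 1))) : ℝ :=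
  a.elim (-((∏ l, meanOcc q (π l).1) / (d.factorial * meanSize q)))
    fun j => (∏ l, meanOcc q (π l).1) / meanOcc q (π j).1

/-- The position-dependent coefficients of these statistics. -/
def statCoef (q : unitInterval) (d n k : ℕ) (a : Option (Fin (d + 1))) : ℝ :=
  a.elim (((n : ℝ) / meanSize q) ^ d)
    fun j => chooseCoef d (blockIndex (mallowsBlock q) n) k j

/-- The contribution of the `k`-th block to the linear approximation. -/
def linTerm (q : unitInterval) (π : BlockPattern (d + 1)) (n k : ℕ) (B : FinPerm) : ℝ :=
  ∑ a, statWeight q π a * statCoef q d n k a *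
    (blockStat π a B - ∫ B, blockStat π a B ∂(mallowsBlock q))

theorem linApprox_eq_sum (hq0 : 0 < q) (hq1 : q < 1) (π : BlockPattern (d + 1)) (n : ℕ)
    (b : ℕ → FinPerm) :
    linApprox (mallowsBlock q) (occFun π) n b =
      ∑ k ∈ Finset.range (blockIndex (mallowsBlock q) n), linTerm q π n k (b k) := by
  have h1 : ∀ j, ∫ B, occFun π j B ∂(mallowsBlock q) ≠ 0 := fun j => (meanOcc_pos hq0 hq1 (π j)).ne'
  have h2 : ∀ k, linTerm q π n k (b k) = (∑ j : Fin (d + 1), (∏ l, ∫ B, occFun π l B ∂(mallowsBlock q)) /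
      (∫ B, occFun π j B ∂(mallowsBlock q)) *
      chooseCoef d (blockIndex (mallowsBlock q) n) k j *
        (occFun π j (b k) - ∫ B, occFun π j B ∂(mallowsBlock q))) -
      (∏ j, ∫ B, occFun π j B ∂(mallowsBlock q)) * ((n : ℝ) / sizeMean (mallowsBlock q)) ^ d /
        (d.factorial * sizeMean (mallowsBlock q)) *
          (((b k).1 : ℝ) - sizeMean (mallowsBlock q)) := by
    intro k
    rw [linTerm, Fintype.sum_option, add_comm, sub_eq_add_neg]
    congr 1
    change -((∏ l, ∫ B, occFun π l B ∂(mallowsBlock q)) / (d.factorial * sizeMean (mallowsBlock q))) *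
      ((n : ℝ) / sizeMean (mallowsBlock q)) ^ d * (((b k).1 : ℝ) - sizeMean (mallowsBlock q)) = _
    ring
  simp only [h2]
  rw [linApprox, linSum_eq _ h1, Finset.sum_sub_distrib, Nat.add_sub_cancel, ← Finset.mul_sum,
    Finset.sum_sub_distrib, Finset.sum_const, Finset.card_range, nsmul_eq_mul, cutSeq, Nat.cast_sum]

theorem memLp_blockStat (hq1 : q < 1) (π : BlockPattern (d + 1)) (a : Option (Fin (d + 1))) (p : ℕ) :
    MemLp (blockStat π a) p (mallowsBlock q) := by
  cases a with
  | none => exact memLp_size hq1 p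
  | some j => exact memLp_occ hq1 (π j).1 p

theorem memLp_linTerm (hq1 : q < 1) (π : BlockPattern (d + 1)) (n k p : ℕ) :
    MemLp (linTerm q π n k) p (mallowsBlock q) :=
  memLp_finsetSum _ fun a _ => (memLp_sub_integral (memLp_blockStat hq1 π a) p).const_mul _

theorem integral_linTerm (hq1 : q < 1) (π : BlockPattern (d + 1)) (n k : ℕ) :
    ∫ B, linTerm q π n k B ∂(mallowsBlock q) = 0 := by
  unfold linTerm
  rw [integral_finsetSum _ fun a _ => ((memLp_sub_integral (memLp_blockStat hq1 π a) 1).const_mul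
    _).integrable (by simp)]
  refine Finset.sum_eq_zero fun a _ => ?_
  rw [integral_const_mul, integral_sub_integral (memLp_blockStat hq1 π a), mul_zero]

theorem integral_linTerm_mul (hq1 : q < 1) (π ρ : BlockPattern (d + 1)) (n k : ℕ) :
    ∫ B, linTerm q π n k B * linTerm q ρ n k B ∂(mallowsBlock q) =
      ∑ a, ∑ c, statWeight q π a * statWeight q ρ c *
        cov[blockStat π a, blockStat ρ c; mallowsBlock q] *
          (statCoef q d n k a * statCoef q d n k c) := by
  have h1 : ∀ B, linTerm q π n k B * linTerm q ρ n k B = ∑ a, ∑ c,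
      (statWeight q π a * statWeight q ρ c * (statCoef q d n k a * statCoef q d n k c)) *
        ((blockStat π a B - ∫ B, blockStat π a B ∂(mallowsBlock q)) *
          (blockStat ρ c B - ∫ B, blockStat ρ c B ∂(mallowsBlock q))) := by
    intro B
    rw [linTerm, linTerm, Finset.sum_mul_sum]
    exact Finset.sum_congr rfl fun a _ => Finset.sum_congr rfl fun c _ => by ring
  have h2 : ∀ a c, Integrable (fun B => (blockStat π a B - ∫ B, blockStat π a B ∂(mallowsBlock q)) *
      (blockStat ρ c B - ∫ B, blockStat ρ c B ∂(mallowsBlock q))) (mallowsBlock q) := fun a c =>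
    (memLp_mul_all (memLp_sub_integral (memLp_blockStat hq1 π a))
      (memLp_sub_integral (memLp_blockStat hq1 ρ c)) 1).integrable (by simp)
  simp_rw [h1]
  rw [integral_finsetSum _ fun a _ => integrable_finsetSum _ fun c _ => (h2 a c).const_mul _]
  refine Finset.sum_congr rfl fun a _ => ?_
  rw [integral_finsetSum _ fun c _ => (h2 a c).const_mul _]
  refine Finset.sum_congr rfl fun c _ => ?_
  rw [integral_const_mul, covariance]
  ring

/-- The limits of the normalized sums of products of coefficients, up to the power of the mean
block size. -/
def statLimit (d : ℕ) (a c : Option (Fin (d + 1))) : ℝ :=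
  a.elim (c.elim 1 fun _ => 1 / ((d + 1).factorial : ℝ)) fun i =>
    c.elim (1 / ((d + 1).factorial : ℝ)) fun j =>
      (((i : ℕ) + j).choose i : ℝ) * (((d - i) + (d - j)).choose (d - i) : ℝ) /
        (2 * d + 1).factorial

theorem tendsto_blockIndex_div (hq1 : q < 1) :
    Tendsto (fun n : ℕ => (blockIndex (mallowsBlock q) n : ℝ) / n) atTop (𝓝 (meanSize q)⁻¹) := by
  have h0 : 0 ≤ (meanSize q)⁻¹ := inv_nonneg.2 (zero_le_one.trans (one_le_meanSize hq1))
  have := (tendsto_nat_floor_mul_div_atTop h0).comp (tendsto_natCast_atTop_atTop (R := ℝ))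
  refine this.congr fun n => ?_
  simp only [Function.comp_apply, blockIndex]
  rw [mul_comm, ← div_eq_mul_inv]
  rfl

theorem tendsto_blockIndex_atTop (hq1 : q < 1) :
    Tendsto (fun n : ℕ => blockIndex (mallowsBlock q) n) atTop atTop := by
  have h0 : 0 < meanSize q := zero_lt_one.trans_le (one_le_meanSize hq1)
  exact tendsto_nat_floor_atTop.comp
    ((tendsto_natCast_atTop_atTop (R := ℝ)).atTop_div_const h0)

theorem tendsto_sum_statCoef (hq1 : q < 1) (a c : Option (Fin (d + 1))) :
    Tendsto (fun n : ℕ => (∑ k ∈ Finset.range (blockIndex (mallowsBlock q) n),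
      statCoef q d n k a * statCoef q d n k c) / (n : ℝ) ^ (2 * d + 1)) atTop
      (𝓝 (((meanSize q)⁻¹) ^ (2 * d + 1) * statLimit d a c)) := by
  have hK := tendsto_blockIndex_div hq1
  have hKt := tendsto_blockIndex_atTop hq1
  have hm : meanSize q ≠ 0 := by have := one_le_meanSize hq1; linarith
  have hone : ∀ j : Fin (d + 1), Tendsto (fun n : ℕ => ((n : ℝ) / meanSize q) ^ d *
      (∑ k ∈ Finset.range (blockIndex (mallowsBlock q) n),
        chooseCoef d (blockIndex (mallowsBlock q) n) k j) / (n : ℝ) ^ (2 * d + 1)) atTop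
      (𝓝 (((meanSize q)⁻¹) ^ (2 * d + 1) * (1 / ((d + 1).factorial : ℝ)))) := by
    intro j
    have h1 := ((hK.pow (d + 1)).mul ((tendsto_choose_div_pow (d + 1)).comp hKt)).const_mul
      ((meanSize q)⁻¹ ^ d)
    have e1 : (meanSize q)⁻¹ ^ d * ((meanSize q)⁻¹ ^ (d + 1) * (1 / ((d + 1).factorial : ℝ))) =
        (meanSize q)⁻¹ ^ (2 * d + 1) * (1 / ((d + 1).factorial : ℝ)) := by ring
    rw [e1] at h1
    refine h1.congr' ?_
    filter_upwards [eventually_gt_atTop 0, hKt.eventually_gt_atTop 0] with n hn hk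
    have hn' : (n : ℝ) ≠ 0 := by positivity
    have hk' : (blockIndex (mallowsBlock q) n : ℝ) ≠ 0 := by positivity
    rw [sum_chooseCoef (Nat.lt_succ_iff.1 j.2)]
    simp only [Function.comp_apply, div_pow, inv_pow]
    field_simp
    ring
  cases a with
  | none =>
    cases c with
    | none =>
      have h1 := hK.const_mul ((meanSize q)⁻¹ ^ (2 * d))
      simp only [statLimit, Option.elim_none, mul_one, pow_succ]
      refine h1.congr' ?_
      filter_upwards [eventually_gt_atTop 0] with n hn
      have hn' : (n : ℝ) ≠ 0 := by positivity
      simp only [statCoef, Option.elim_none, Finset.sum_const, Finset.card_range, nsmul_eq_mul]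
      rw [div_pow, inv_pow]
      field_simp
      ring
    | some j =>
      simp only [statCoef, statLimit, Option.elim_none, Option.elim_some, ← Finset.mul_sum]
      exact hone j
  | some i =>
    cases c with
    | none =>
      simp only [statCoef, statLimit, Option.elim_none, Option.elim_some, ← Finset.sum_mul]
      simp_rw [mul_comm (∑ k ∈ Finset.range _, _)]
      exact hone i
    | some j =>
      have h1 := (hK.pow (2 * d + 1)).mul ((tendsto_sum_chooseCoef_mul
        (Nat.lt_succ_iff.1 i.2) (Nat.lt_succ_iff.1 j.2)).comp hKt)
      refine h1.congr' ?_
      filter_upwards [eventually_gt_atTop 0, hKt.eventually_gt_atTop 0] with n hn hk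
      have hn' : (n : ℝ) ≠ 0 := by positivity
      have hk' : (blockIndex (mallowsBlock q) n : ℝ) ≠ 0 := by positivity
      simp only [statCoef, Option.elim_some, Function.comp_apply, div_pow]
      field_simp

/-- The bilinear expansion over statistics: two occurrence counts give the first line of `Gam`, the
size with an occurrence count gives the negative middle term, and the size with itself gives the
variance term. -/
theorem Gam_eq_sum (hq0 : 0 < q) (hq1 : q < 1) (π ρ : BlockPattern (d + 1)) :
    Gam q (d + 1) π ρ = ∑ a, ∑ c, statWeight q π a * statWeight q ρ c *
      cov[blockStat π a, blockStat ρ c; mallowsBlock q] *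
        (((meanSize q)⁻¹) ^ (2 * d + 1) * statLimit d a c) := by
  have hm : meanSize q ≠ 0 := by have := one_le_meanSize hq1; linarith
  have hπ : ∀ j, meanOcc q (π j).1 ≠ 0 := fun j => (meanOcc_pos hq0 hq1 (π j)).ne'
  have hρ : ∀ j, meanOcc q (ρ j).1 ≠ 0 := fun j => (meanOcc_pos hq0 hq1 (ρ j)).ne'
  have heπ : ∀ π : BlockPattern (d + 1), eConst q π =
      (∏ l, meanOcc q (π l).1) / meanSize q ^ (d + 1) := fun π => by
    rw [eConst, Finset.prod_div_distrib, Finset.prod_const, Finset.card_univ, Fintype.card_fin]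
  have hvar : Var[fun B : FinPerm => (B.1 : ℝ); mallowsBlock q] =
      cov[fun B : FinPerm => (B.1 : ℝ), fun B : FinPerm => (B.1 : ℝ); mallowsBlock q] :=
    (covariance_self (Measurable.of_discrete).aemeasurable).symm
  have hd1 : d + 1 - 1 = d := rfl
  have hd2 : 2 * (d + 1) - 1 = 2 * d + 1 := by omega
  have hexp : ∀ i j : Fin (d + 1), 2 * (d + 1) - 2 - (i : ℕ) - j = (d - j) + (d - i) := by
    intro i j
    have := i.2
    have := j.2
    omega
  simp only [Fintype.sum_option, statWeight, statLimit, blockStat, Option.elim_none,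
    Option.elim_some, Gam, heπ, hvar, hd1, hd2, hexp]
  set M := meanSize q
  set p := ∏ l, meanOcc q (π l).1
  set r := ∏ l, meanOcc q (ρ l).1
  -- The prefactor of `Gam` is rewritten with the power of the mean size that comes from the limits
  -- of the coefficient sums.
  have h1 : M * (p / M ^ (d + 1)) * (r / M ^ (d + 1)) = p * r * M⁻¹ ^ (2 * d + 1) := by
    rw [inv_pow, show 2 * d + 1 = (d + 1) + d by ring, pow_add]
    field_simp
    ring
  set Q := M⁻¹ ^ (2 * d + 1)
  have hsize : ∀ f : FinPerm → ℝ, cov[f, fun B : FinPerm => (B.1 : ℝ); mallowsBlock q] =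
      cov[fun B : FinPerm => (B.1 : ℝ), f; mallowsBlock q] := fun f => covariance_comm _ _
  have hdf : (d.factorial : ℝ) ≠ 0 := by positivity
  have hdf1 : ((d + 1).factorial : ℝ) ≠ 0 := by positivity
  have hdf2 : ((2 * d + 1).factorial : ℝ) ≠ 0 := by positivity
  have hA : ∑ j : Fin (d + 1), ∑ i : Fin (d + 1), p / meanOcc q (π j).1 * (r / meanOcc q (ρ i).1) *
      cov[occFun π j, occFun ρ i; mallowsBlock q] * (Q * ((((j : ℕ) + i).choose j : ℝ) *
        (((d - j) + (d - i)).choose (d - j) : ℝ) / (2 * d + 1).factorial)) =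
      p * r * Q * (1 / ((2 * d + 1).factorial : ℝ) * ∑ i : Fin (d + 1), ∑ j : Fin (d + 1),
        (((i : ℕ) + j).choose i : ℝ) * (((d - j) + (d - i)).choose (d - i) : ℝ) *
          (cov[occFun π j, occFun ρ i; mallowsBlock q] /
            (meanOcc q (π j).1 * meanOcc q (ρ i).1))) := by
    rw [Finset.sum_comm, Finset.mul_sum, Finset.mul_sum]
    refine Finset.sum_congr rfl fun i _ => ?_
    rw [Finset.mul_sum, Finset.mul_sum]
    refine Finset.sum_congr rfl fun j _ => ?_
    rw [Nat.choose_symm_add (a := d - j), add_comm (j : ℕ) i, Nat.choose_symm_add (a := (i : ℕ))]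
    have := hπ j
    have := hρ i
    field_simp
  have hB : ∀ (x y : ℝ) (σ : BlockPattern (d + 1)), (∀ j, meanOcc q (σ j).1 ≠ 0) →
      ∑ j : Fin (d + 1), -(x / (d.factorial * M)) * (y / meanOcc q (σ j).1) *
        cov[fun B : FinPerm => (B.1 : ℝ), occFun σ j; mallowsBlock q] *
          (Q * (1 / ((d + 1).factorial : ℝ))) =
      -(x * y * Q * (1 / ((d.factorial : ℝ) * (d + 1).factorial) * ∑ j : Fin (d + 1),
        cov[fun B : FinPerm => (B.1 : ℝ), occFun σ j; mallowsBlock q] /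
          (M * meanOcc q (σ j).1))) := by
    intro x y σ hσ
    rw [Finset.mul_sum, Finset.mul_sum, ← Finset.sum_neg_distrib]
    refine Finset.sum_congr rfl fun j _ => ?_
    have := hσ j
    field_simp
  rw [h1, Finset.sum_add_distrib, Finset.sum_add_distrib, hA, hB p r ρ hρ]
  have hB' := hB r p π hπ
  have hB2 : ∑ j : Fin (d + 1), p / meanOcc q (π j).1 * -(r / (d.factorial * M)) *
      cov[occFun π j, fun B : FinPerm => (B.1 : ℝ); mallowsBlock q] *
        (Q * (1 / ((d + 1).factorial : ℝ))) =
      ∑ j : Fin (d + 1), -(r / (d.factorial * M)) * (p / meanOcc q (π j).1) *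
        cov[fun B : FinPerm => (B.1 : ℝ), occFun π j; mallowsBlock q] *
          (Q * (1 / ((d + 1).factorial : ℝ))) := by
    refine Finset.sum_congr rfl fun j _ => ?_
    rw [hsize]
    ring
  rw [hB2, hB']
  have hfun : ∀ (σ : BlockPattern (d + 1)) (j : Fin (d + 1)),
      (fun B : FinPerm => (occ (σ j).1 B : ℝ)) = occFun σ j := fun _ _ => rfl
  simp only [hfun]
  field_simp
  ring

theorem tendsto_sum_integral_linTerm_mul (hq0 : 0 < q) (hq1 : q < 1) (π ρ : BlockPattern (d + 1)) :
    Tendsto (fun n : ℕ => (∑ k ∈ Finset.range (blockIndex (mallowsBlock q) n),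
      ∫ B, linTerm q π n k B * linTerm q ρ n k B ∂(mallowsBlock q)) / (n : ℝ) ^ (2 * d + 1)) atTop
      (𝓝 (Gam q (d + 1) π ρ)) := by
  rw [Gam_eq_sum hq0 hq1]
  have h1 : ∀ n : ℕ, (∑ k ∈ Finset.range (blockIndex (mallowsBlock q) n),
      ∫ B, linTerm q π n k B * linTerm q ρ n k B ∂(mallowsBlock q)) / (n : ℝ) ^ (2 * d + 1) =
      ∑ a, ∑ c, statWeight q π a * statWeight q ρ c *
        cov[blockStat π a, blockStat ρ c; mallowsBlock q] *
          ((∑ k ∈ Finset.range (blockIndex (mallowsBlock q) n),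
            statCoef q d n k a * statCoef q d n k c) / (n : ℝ) ^ (2 * d + 1)) := by
    intro n
    simp_rw [integral_linTerm_mul hq1]
    rw [Finset.sum_comm, Finset.sum_div]
    refine Finset.sum_congr rfl fun a _ => ?_
    rw [Finset.sum_comm, Finset.sum_div]
    refine Finset.sum_congr rfl fun c _ => ?_
    rw [← Finset.mul_sum, mul_div_assoc]
  simp_rw [h1]
  exact tendsto_finsetSum _ fun a _ => tendsto_finsetSum _ fun c _ =>
    (tendsto_sum_statCoef hq1 a c).const_mul _

/-- The contribution of the `k`-th block to a normalized linear combination of approximations. -/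
def linComb (q : unitInterval) {S : Finset (BlockPattern (d + 1))} (u : S → ℝ) (n k : ℕ)
    (B : FinPerm) : ℝ :=
  (∑ π : S, u π * linTerm q π.1 n k B) / ((n : ℝ) ^ d * √n)

theorem tendsto_sum_integral_linComb_sq (hq0 : 0 < q) (hq1 : q < 1)
    {S : Finset (BlockPattern (d + 1))} (u : S → ℝ) :
    Tendsto (fun n : ℕ => ∑ k ∈ Finset.range (blockIndex (mallowsBlock q) n),
      ∫ B, linComb q u n k B ^ 2 ∂(mallowsBlock q)) atTop
      (𝓝 (∑ π : S, ∑ ρ : S, u π * u ρ * Gam q (d + 1) π.1 ρ.1)) := by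
  have h1 : ∀ n : ℕ, ∑ k ∈ Finset.range (blockIndex (mallowsBlock q) n),
      ∫ B, linComb q u n k B ^ 2 ∂(mallowsBlock q) = ∑ π : S, ∑ ρ : S, u π * u ρ *
        ((∑ k ∈ Finset.range (blockIndex (mallowsBlock q) n),
          ∫ B, linTerm q π.1 n k B * linTerm q ρ.1 n k B ∂(mallowsBlock q)) /
            (n : ℝ) ^ (2 * d + 1)) := by
    intro n
    have hnorm : ((n : ℝ) ^ d * √n) ^ 2 = (n : ℝ) ^ (2 * d + 1) := by
      rw [mul_pow, Real.sq_sqrt (Nat.cast_nonneg n), ← pow_mul, mul_comm d 2, pow_succ]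
    have h2 : ∀ k, ∫ B, linComb q u n k B ^ 2 ∂(mallowsBlock q) = ∑ π : S, ∑ ρ : S,
        u π * u ρ / (n : ℝ) ^ (2 * d + 1) *
          ∫ B, linTerm q π.1 n k B * linTerm q ρ.1 n k B ∂(mallowsBlock q) := by
      intro k
      have h3 : ∀ B, linComb q u n k B ^ 2 = ∑ π : S, ∑ ρ : S,
          u π * u ρ / (n : ℝ) ^ (2 * d + 1) * (linTerm q π.1 n k B * linTerm q ρ.1 n k B) := by
        intro B
        rw [linComb, div_pow, hnorm, sq, Finset.sum_mul_sum, Finset.sum_div]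
        refine Finset.sum_congr rfl fun π _ => ?_
        rw [Finset.sum_div]
        exact Finset.sum_congr rfl fun ρ _ => by ring
      have h4 : ∀ π ρ : S, Integrable (fun B => linTerm q π.1 n k B * linTerm q ρ.1 n k B)
          (mallowsBlock q) := fun π ρ =>
        (memLp_mul_all (memLp_linTerm hq1 π.1 n k) (memLp_linTerm hq1 ρ.1 n k) 1).integrable
          (by simp)
      simp_rw [h3]
      rw [integral_finsetSum _ fun π _ => integrable_finsetSum _ fun ρ _ =>
        (h4 π ρ).const_mul _]
      refine Finset.sum_congr rfl fun π _ => ?_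
      rw [integral_finsetSum _ fun ρ _ => (h4 π ρ).const_mul _]
      exact Finset.sum_congr rfl fun ρ _ => integral_const_mul _ _
    simp_rw [h2]
    rw [Finset.sum_comm]
    refine Finset.sum_congr rfl fun π _ => ?_
    rw [Finset.sum_comm]
    refine Finset.sum_congr rfl fun ρ _ => ?_
    rw [← Finset.mul_sum]
    ring
  simp_rw [h1]
  exact tendsto_finsetSum _ fun π _ => tendsto_finsetSum _ fun ρ _ =>
    (tendsto_sum_integral_linTerm_mul hq0 hq1 π.1 ρ.1).const_mul _

/-- Symmetry is read off from the limit, where it is the commutativity of a product, rather than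
from the formula. -/
theorem Gam_comm (hq0 : 0 < q) (hq1 : q < 1) (π ρ : BlockPattern (d + 1)) :
    Gam q (d + 1) π ρ = Gam q (d + 1) ρ π := by
  refine tendsto_nhds_unique (tendsto_sum_integral_linTerm_mul hq0 hq1 π ρ) ?_
  simp_rw [mul_comm (linTerm q π _ _ _)]
  exact tendsto_sum_integral_linTerm_mul hq0 hq1 ρ π

theorem sum_mul_Gam_nonneg (hq0 : 0 < q) (hq1 : q < 1)
    {S : Finset (BlockPattern (d + 1))} (u : S → ℝ) :
    0 ≤ ∑ π : S, ∑ ρ : S, u π * u ρ * Gam q (d + 1) π.1 ρ.1 :=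
  ge_of_tendsto' (tendsto_sum_integral_linComb_sq hq0 hq1 u) fun _ =>
    Finset.sum_nonneg fun _ _ => integral_nonneg fun _ => sq_nonneg _

theorem posSemidef_Gam (hq0 : 0 < q) (hq1 : q < 1) : (Gam q (d + 1)).PosSemidef := by
  refine ⟨Matrix.IsHermitian.ext fun π ρ => ?_, fun x => ?_⟩
  · rw [star_trivial, Gam_comm hq0 hq1]
  · have h := sum_mul_Gam_nonneg hq0 hq1 (S := x.support) fun π => x π.1
    rw [Finsupp.sum]
    refine h.trans (le_of_eq ?_)
    rw [← Finset.sum_coe_sort x.support]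
    refine Finset.sum_congr rfl fun π _ => ?_
    rw [Finsupp.sum, ← Finset.sum_coe_sort x.support]
    refine Finset.sum_congr rfl fun ρ _ => ?_
    simp only [star_trivial]
    ring

end covariance

/-! ### Convergence of characteristic functions -/

namespace LpBigO

variable {Ω : Type*} [MeasurableSpace Ω] {P : Measure Ω} [IsProbabilityMeasure P]
  {ι κ : Type*} {Y : ι → Ω → ℝ} {a : ι → ℝ}

theorem div (h : LpBigO P Y a) {c : ι → ℝ} (hc : ∀ i, 0 ≤ c i) :
    LpBigO P (fun i ω => Y i ω / c i) fun i => a i / c i := by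
  have h1 := (const (P := P) fun i => 1 / c i).mul h fun i => abs_nonneg _
  refine (h1.mono_rate fun i => le_of_eq ?_).of_le (fun i => ?_) fun i => ?_
  · rw [abs_of_nonneg (one_div_nonneg.2 (hc i)), one_div_mul_eq_div]
  · exact ((h.1 i).aemeasurable.div_const _).aestronglyMeasurable
  · exact Eventually.of_forall fun ω => by rw [one_div_mul_eq_div]

theorem finset_sum (s : Finset κ) {W : κ → ι → Ω → ℝ} (ha : ∀ i, 0 ≤ a i)
    (h : ∀ k, LpBigO P (W k) a) : LpBigO P (fun i ω => ∑ k ∈ s, W k i ω) a := by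
  classical
  induction s using Finset.induction_on with
  | empty =>
    simpa using (const (P := P) fun _ : ι => (0 : ℝ)).mono_rate (b := a) fun i => by simpa using ha i
  | insert k s hk ih => simpa only [Finset.sum_insert hk] using (h k).add ih ha

theorem finset_prod (s : Finset κ) {W : κ → ι → Ω → ℝ}
    (h : ∀ k, LpBigO P (W k) fun _ => 1) : LpBigO P (fun i ω => ∏ k ∈ s, W k i ω) fun _ => 1 := by
  classical
  induction s using Finset.induction_on with
  | empty => simpa using const (P := P) fun _ : ι => (1 : ℝ)
  | insert k s hk ih =>
    simpa only [Finset.prod_insert hk, mul_one] using (h k).mul ih fun _ => zero_le_one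

omit [IsProbabilityMeasure P] in
theorem integral_abs_le (h : LpBigO P Y a) (ha : ∀ i, 0 ≤ a i) :
    ∃ C : ℝ, 0 ≤ C ∧ ∀ i, Integrable (Y i) P ∧ ∫ ω, |Y i ω| ∂P ≤ C * a i := by
  obtain ⟨C, hC, hb⟩ := h.2 1
  refine ⟨C, hC, fun i => ⟨?_, ?_⟩⟩
  · exact memLp_one_iff_integrable.1 ⟨h.1 i, by simpa using (hb i).trans_lt ENNReal.ofReal_lt_top⟩
  · have h1 := integral_norm_eq_lintegral_enorm (h.1 i)
    have h2 := hb i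
    rw [Nat.cast_one, eLpNorm_one_eq_lintegral_enorm] at h2
    simp only [Real.norm_eq_abs] at h1
    rw [h1]
    exact ENNReal.toReal_le_of_le_ofReal (mul_nonneg hC (ha i)) h2

end LpBigO

section

variable {q : unitInterval} {d : ℕ}

theorem one_div_pow_mul_sqrt_le (d n : ℕ) : 1 / ((n : ℝ) ^ d * √n) ≤
    2 ^ (d + 1) / (((n : ℝ) + 1) ^ d * √((n : ℝ) + 1)) := by
  -- At `n = 0` the left side is `1 / 0 = 0`, by the convention for division.
  rcases Nat.eq_zero_or_pos n with rfl | hn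
  · simp
  have hn1 : (1 : ℝ) ≤ n := by exact_mod_cast hn
  rw [div_le_div_iff₀ (by positivity) (by positivity), one_mul]
  have h1 : ((n : ℝ) + 1) ^ d ≤ (2 * n) ^ d := by gcongr; linarith
  have h2 : √((n : ℝ) + 1) ≤ 2 * √n := by
    rw [Real.sqrt_le_left (by positivity), mul_pow, Real.sq_sqrt (by positivity)]
    linarith
  calc ((n : ℝ) + 1) ^ d * √((n : ℝ) + 1) ≤ (2 * n) ^ d * (2 * √n) := by gcongr
    _ = 2 ^ (d + 1) * ((n : ℝ) ^ d * √n) := by ring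

theorem rpow_natCast_succ_sub_half (d n : ℕ) :
    (n : ℝ) ^ (((d + 1 : ℕ) : ℝ) - 1 / 2) = (n : ℝ) ^ d * √n := by
  rw [Real.sqrt_eq_rpow, ← Real.rpow_natCast, ← Real.rpow_add_of_nonneg (Nat.cast_nonneg n)
    (Nat.cast_nonneg d) (by norm_num)]
  congr 1
  push_cast
  ring

theorem fluct_eq_occAt (π : BlockPattern (d + 1)) (n : ℕ) (r : ℕ → ℕ) :
    fluct q n (pat (Finset.range n) (permOfCounts r)) π =
      (occAt π.toPerm n r - (n.choose (d + 1) : ℝ) * eConst q π) / ((n : ℝ) ^ d * √n) := by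
  rw [fluct, rpow_natCast_succ_sub_half, occAt]

theorem lpBigO_fluct (hq1 : q < 1) (π : BlockPattern (d + 1)) :
    LpBigO (countsMeasure q) (fun (n : ℕ) r => fluct q n (pat (Finset.range n) (permOfCounts r)) π)
      fun _ => 1 := by
  simp only [fluct_eq_occAt]
  refine LpBigO.of_rate_mul (c := 2 ^ (d + 1)) (by positivity)
    (((lpBigO_occAt hq1 π).div fun n => by positivity).mono_rate fun n => ?_)
  rw [div_eq_mul_one_div, mul_one]
  refine (mul_le_mul_of_nonneg_left (one_div_pow_mul_sqrt_le d n) (by positivity)).trans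
    (le_of_eq ?_)
  field_simp

/-- The linearization error carries a factor `n ^ (3/8)` where the normalization has `n ^ (1/2)`,
leaving `n ^ (-1/8)`. -/
theorem lpBigO_fluct_sub (hq1 : q < 1) (π : BlockPattern (d + 1)) :
    LpBigO (countsMeasure q) (fun (n : ℕ) r => fluct q n (pat (Finset.range n) (permOfCounts r)) π -
        linApprox (mallowsBlock q) (occFun π) n (blockSeq r) / ((n : ℝ) ^ d * √n))
      fun n : ℕ => 1 / √√√((n : ℝ) + 1) := by
  have h1 := (lpBigO_occAt_sub hq1 π).mono_rate
    (b := fun n : ℕ => √√√((n : ℝ) + 1) * √√((n : ℝ) + 1) * ((n : ℝ) + 1) ^ d) fun n => by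
      have : 1 ≤ √√√((n : ℝ) + 1) := by
        simp only [Real.one_le_sqrt]
        linarith [(Nat.cast_nonneg n : (0 : ℝ) ≤ n)]
      refine mul_le_mul_of_nonneg_right ?_ (by positivity)
      exact le_mul_of_one_le_left (by positivity) this
  have h2 := (lpBigO_centredSum_sub_linApprox (blockLaw_mallowsBlock hq1)
    (f := occFun π) fun j => memLp_occ hq1 (π j).1).comp_blockSeq hq1
  have h3 := (h1.add h2 fun n => by positivity).div (c := fun n : ℕ => (n : ℝ) ^ d * √n)
    fun n => by positivity
  refine LpBigO.of_rate_mul (c := 2 ^ (d + 1)) (by positivity) ?_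
  have h4 : ∀ (n : ℕ) r, fluct q n (pat (Finset.range n) (permOfCounts r)) π -
      linApprox (mallowsBlock q) (occFun π) n (blockSeq r) / ((n : ℝ) ^ d * √n) =
      (occAt π.toPerm n r - (n.choose (d + 1) : ℝ) * eConst q π -
        centredSum (mallowsBlock q) (occFun π) n (blockSeq r) +
        (centredSum (mallowsBlock q) (occFun π) n (blockSeq r) -
          linApprox (mallowsBlock q) (occFun π) n (blockSeq r))) / ((n : ℝ) ^ d * √n) := by
    intro n r
    rw [fluct_eq_occAt]
    ring
  simp only [h4]
  refine h3.mono_rate fun n => ?_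
  rw [div_eq_mul_one_div]
  refine (mul_le_mul_of_nonneg_left (one_div_pow_mul_sqrt_le d n) (by positivity)).trans
    (le_of_eq ?_)
  set y := √√√((n : ℝ) + 1) with hy
  have hy2 : √√((n : ℝ) + 1) = y ^ 2 := (Real.sq_sqrt (by positivity)).symm
  have hy4 : √((n : ℝ) + 1) = y ^ 4 := by
    rw [← Real.sq_sqrt (by positivity : 0 ≤ √((n : ℝ) + 1)), hy2]; ring
  have hy0 : 0 < y := by positivity
  rw [hy2, hy4]
  field_simp

theorem tendsto_sqrt_sqrt_sqrt_atTop :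
    Tendsto (fun n : ℕ => 1 / √√√((n : ℝ) + 1)) atTop (𝓝 0) := by
  simp only [one_div]
  exact tendsto_inv_atTop_zero.comp (Real.tendsto_sqrt_atTop.comp (Real.tendsto_sqrt_atTop.comp
    (Real.tendsto_sqrt_atTop.comp (tendsto_atTop_add_const_right _ _ tendsto_natCast_atTop_atTop))))

variable {S : Finset (BlockPattern (d + 1))}

theorem sum_linComb (hq0 : 0 < q) (hq1 : q < 1) (u : S → ℝ) (n : ℕ) (b : ℕ → FinPerm) :
    ∑ k ∈ Finset.range (blockIndex (mallowsBlock q) n), linComb q u n k (b k) =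
      ∑ π : S, u π * (linApprox (mallowsBlock q) (occFun π.1) n b / ((n : ℝ) ^ d * √n)) := by
  simp only [linComb, linApprox_eq_sum hq0 hq1, ← Finset.sum_div, ← mul_div_assoc, Finset.mul_sum]
  rw [Finset.sum_comm]

/-- All coefficients are at most `n ^ d`, so the individual terms are dominated uniformly in `k` by
a variable with all moments, divided by `√n`. -/
theorem abs_linComb_le (hq1 : q < 1) (u : S → ℝ) {n k : ℕ} (hn : 1 ≤ n)
    (hk : k < blockIndex (mallowsBlock q) n) (B : FinPerm) :
    |linComb q u n k B| ≤ (∑ π : S, |u π| * ∑ a, |statWeight q π.1 a| *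
      |blockStat π.1 a B - ∫ B, blockStat π.1 a B ∂(mallowsBlock q)|) / √n := by
  have hn0 : (0 : ℝ) < n := by exact_mod_cast hn
  have hm := one_le_meanSize hq1
  have hc : ∀ a, |statCoef q d n k a| ≤ (n : ℝ) ^ d := by
    intro a
    cases a with
    | none =>
      change |((n : ℝ) / meanSize q) ^ d| ≤ _
      rw [abs_of_nonneg (by positivity)]
      gcongr
      exact div_le_self hn0.le hm
    | some j =>
      change |chooseCoef d _ k j| ≤ _
      rw [abs_of_nonneg (chooseCoef_nonneg _ _ _ _)]
      exact chooseCoef_le (Nat.lt_succ_iff.1 j.2) hk (by exact_mod_cast blockIndex_le hm n)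
  have h1 : ∀ π : S, |linTerm q π.1 n k B| ≤ (n : ℝ) ^ d * ∑ a, |statWeight q π.1 a| *
      |blockStat π.1 a B - ∫ B, blockStat π.1 a B ∂(mallowsBlock q)| := by
    intro π
    rw [Finset.mul_sum]
    refine (Finset.abs_sum_le_sum_abs _ _).trans (Finset.sum_le_sum fun a _ => ?_)
    rw [abs_mul, abs_mul, mul_assoc, mul_left_comm]
    exact mul_le_mul_of_nonneg_right (hc a) (by positivity)
  rw [linComb, abs_div, abs_of_nonneg (by positivity : 0 ≤ (n : ℝ) ^ d * √n),
    div_le_div_iff₀ (by positivity) (by positivity)]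
  have h2 : |∑ π : S, u π * linTerm q π.1 n k B| ≤ (n : ℝ) ^ d * ∑ π : S, |u π| *
      ∑ a, |statWeight q π.1 a| *
        |blockStat π.1 a B - ∫ B, blockStat π.1 a B ∂(mallowsBlock q)| := by
    rw [Finset.mul_sum]
    refine (Finset.abs_sum_le_sum_abs _ _).trans (Finset.sum_le_sum fun π _ => ?_)
    rw [abs_mul, mul_left_comm]
    exact mul_le_mul_of_nonneg_left (h1 π) (abs_nonneg _)
  calc _ ≤ _ := mul_le_mul_of_nonneg_right h2 (Real.sqrt_nonneg _)
    _ = _ := by ring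

theorem integral_linComb (hq1 : q < 1) (u : S → ℝ) (n k : ℕ) :
    ∫ B, linComb q u n k B ∂(mallowsBlock q) = 0 := by
  simp only [linComb, integral_div]
  rw [integral_finsetSum _ fun π _ =>
    ((memLp_linTerm hq1 π.1 n k 1).integrable (by simp)).const_mul _]
  simp only [integral_const_mul, integral_linTerm hq1, mul_zero, Finset.sum_const_zero, zero_div]

theorem tendsto_integral_cexp_linApprox (hq0 : 0 < q) (hq1 : q < 1) (u : S → ℝ) :
    Tendsto (fun n : ℕ => ∫ b, Complex.exp ((∑ π : S, u π *
      (linApprox (mallowsBlock q) (occFun π.1) n b / ((n : ℝ) ^ d * √n)) : ℝ) * Complex.I)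
        ∂iidLaw (mallowsBlock q)) atTop
      (𝓝 (Complex.exp (-((∑ π : S, ∑ ρ : S, u π * u ρ * Gam q (d + 1) π.1 ρ.1) / 2 : ℝ)))) := by
  have h := tendsto_integral_cexp_sum (ν := mallowsBlock q) (ξ := fun n k => linComb q u n k)
    (K := blockIndex (mallowsBlock q)) (fun n => blockIndex_le (one_le_meanSize hq1) n)
    (G := fun B => ∑ π : S, |u π| * ∑ a, |statWeight q π.1 a| *
      |blockStat π.1 a B - ∫ B, blockStat π.1 a B ∂(mallowsBlock q)|)
    (fun p => memLp_finsetSum _ fun π _ => (memLp_finsetSum _ fun a _ =>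
      ((memLp_sub_integral (memLp_blockStat hq1 π.1 a) p).abs.const_mul _)).const_mul _)
    (integral_linComb hq1 u) (fun n hn k hk B => abs_linComb_le hq1 u hn hk B)
    (tendsto_sum_integral_linComb_sq hq0 hq1 u)
  simpa only [sum_linComb hq0 hq1] using h

theorem norm_cexp_sub_cexp_le (x y : ℝ) :
    ‖Complex.exp (x * Complex.I) - Complex.exp (y * Complex.I)‖ ≤ |x - y| := by
  have h1 : Complex.exp (x * Complex.I) - Complex.exp (y * Complex.I) =
      Complex.exp (y * Complex.I) * (Complex.exp (Complex.I * ((x - y : ℝ) : ℂ)) - 1) := by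
    rw [mul_sub, ← Complex.exp_add, mul_one]
    congr 2
    push_cast
    ring
  rw [h1, norm_mul, Complex.norm_exp_ofReal_mul_I, one_mul]
  exact Real.norm_exp_I_mul_ofReal_sub_one_le

theorem integrable_cexp {Ω : Type*} [MeasurableSpace Ω] {P : Measure Ω} [IsFiniteMeasure P]
    {f : Ω → ℝ} (hf : AEStronglyMeasurable f P) :
    Integrable (fun ω => Complex.exp (f ω * Complex.I)) P := by
  refine Integrable.of_bound (C := 1) ?_ (Eventually.of_forall fun ω =>
    (Complex.norm_exp_ofReal_mul_I _).le)
  have : Continuous fun x : ℝ => Complex.exp (x * Complex.I) := by fun_prop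
  exact this.comp_aestronglyMeasurable hf

/-- Since `exp (ix)` is 1-Lipschitz, the characteristic functions of the fluctuation and of its
linear approximation differ by at most the mean absolute error. -/
theorem tendsto_integral_cexp_fluct (hq0 : 0 < q) (hq1 : q < 1) (u : S → ℝ) :
    Tendsto (fun n : ℕ => ∫ r, Complex.exp ((∑ π : S, u π *
      fluct q n (pat (Finset.range n) (permOfCounts r)) π.1 : ℝ) * Complex.I) ∂countsMeasure q) atTop
      (𝓝 (Complex.exp (-((∑ π : S, ∑ ρ : S, u π * u ρ * Gam q (d + 1) π.1 ρ.1) / 2 : ℝ)))) := by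
  set X : ℕ → (ℕ → ℕ) → ℝ := fun n r => ∑ π : S, u π *
    fluct q n (pat (Finset.range n) (permOfCounts r)) π.1 with hX
  set L : ℕ → (ℕ → FinPerm) → ℝ := fun n b => ∑ π : S, u π *
    (linApprox (mallowsBlock q) (occFun π.1) n b / ((n : ℝ) ^ d * √n)) with hL
  have hXm : ∀ n, AEStronglyMeasurable (X n) (countsMeasure q) := fun n =>
    (LpBigO.finset_sum (a := fun _ => 1) Finset.univ (fun _ => zero_le_one) fun π : S =>
      (lpBigO_fluct hq1 π.1).const_mul (u π)).1 n
  have hLm : ∀ n, Measurable (L n) := fun n => Finset.measurable_fun_sum _ fun π _ =>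
    ((measurable_linApprox _ n).div_const _).const_mul _
  have hD : LpBigO (countsMeasure q) (fun (n : ℕ) r => X n r - L n (blockSeq r))
      fun n : ℕ => 1 / √√√((n : ℝ) + 1) := by
    have := LpBigO.finset_sum (P := countsMeasure q) (a := fun n : ℕ => 1 / √√√((n : ℝ) + 1))
      Finset.univ (fun n => by positivity) fun π : S => (lpBigO_fluct_sub hq1 π.1).const_mul (u π)
    simpa only [mul_sub, Finset.sum_sub_distrib] using this
  obtain ⟨C, hC, hb⟩ := hD.integral_abs_le fun n => by positivity
  have h1 := tendsto_integral_cexp_linApprox hq0 hq1 u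
  have h2 : ∀ n : ℕ, ∫ b, Complex.exp ((L n b : ℝ) * Complex.I) ∂iidLaw (mallowsBlock q) =
      ∫ r, Complex.exp ((L n (blockSeq r) : ℝ) * Complex.I) ∂countsMeasure q := by
    intro n
    rw [← (measurePreserving_blockSeq hq1).map_eq, integral_map
      (measurePreserving_blockSeq hq1).measurable.aemeasurable]
    have : Continuous fun x : ℝ => Complex.exp (x * Complex.I) := by fun_prop
    exact (this.measurable.comp (hLm n)).aestronglyMeasurable
  have h3 : Tendsto (fun n => ∫ r, Complex.exp ((X n r : ℝ) * Complex.I) ∂countsMeasure q -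
      ∫ b, Complex.exp ((L n b : ℝ) * Complex.I) ∂iidLaw (mallowsBlock q)) atTop (𝓝 0) := by
    refine squeeze_zero_norm (a := fun n : ℕ => C * (1 / √√√((n : ℝ) + 1))) (fun n => ?_) ?_
    · rw [h2, ← integral_sub (integrable_cexp (hXm n)) (integrable_cexp (f := fun r => L n (blockSeq r))
        ((hLm n).comp measurable_blockSeq).aestronglyMeasurable)]
      refine (norm_integral_le_integral_norm _).trans (le_trans ?_ (hb n).2)
      exact integral_mono_of_nonneg (Eventually.of_forall fun _ => norm_nonneg _) (hb n).1.abs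
        (Eventually.of_forall fun r => norm_cexp_sub_cexp_le _ _)
    · simpa using tendsto_sqrt_sqrt_sqrt_atTop.const_mul C
  have h4 := h3.add h1
  rw [zero_add] at h4
  exact h4.congr fun n => sub_add_cancel _ _

end

/-! ### Convergence in distribution and of moments -/

section truncation

/-- Truncation of a real number to the interval `[-M, M]`. -/
def truncate (M x : ℝ) : ℝ := max (-M) (min x M)

theorem continuous_truncate (M : ℝ) : Continuous (truncate M) := by
  unfold truncate; fun_prop

theorem abs_truncate_le {M : ℝ} (hM : 0 ≤ M) (x : ℝ) : |truncate M x| ≤ M :=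
  abs_le.2 ⟨le_max_left _ _, max_le (by linarith) (min_le_right _ _)⟩

theorem abs_sub_truncate_le {M : ℝ} (hM : 0 < M) (x : ℝ) : |x - truncate M x| ≤ x ^ 2 / M := by
  rw [le_div_iff₀ hM, truncate]
  rcases le_total x M with h1 | h1
  · rw [min_eq_left h1]
    rcases le_total (-M) x with h2 | h2
    · rw [max_eq_right h2, sub_self, abs_zero, zero_mul]
      positivity
    · rw [max_eq_left h2, abs_of_nonpos (by linarith)]
      nlinarith
  · rw [min_eq_right h1, max_eq_right (by linarith), abs_of_nonneg (by linarith)]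
    nlinarith

variable {E : Type*} [TopologicalSpace E] [MeasurableSpace E] [OpensMeasurableSpace E]

theorem abs_integral_sub_integral_truncate_le {μ : Measure E} [IsProbabilityMeasure μ] {F : E → ℝ}
    (hF : Continuous F) {C M : ℝ} (hM : 0 < M) (hi : MemLp F 2 μ)
    (hC : ∫ x, F x ^ 2 ∂μ ≤ C) :
    |∫ x, F x ∂μ - ∫ x, truncate M (F x) ∂μ| ≤ C / M := by
  have h1 : Integrable F μ := hi.integrable (by norm_num)
  have h2 : Integrable (fun x => truncate M (F x)) μ :=
    Integrable.of_bound (C := M) ((continuous_truncate M).measurable.comp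
      hF.measurable).aestronglyMeasurable (Eventually.of_forall fun x => abs_truncate_le hM.le _)
  rw [← integral_sub h1 h2]
  refine (abs_integral_le_integral_abs).trans ?_
  calc ∫ x, |F x - truncate M (F x)| ∂μ ≤ ∫ x, F x ^ 2 / M ∂μ :=
        integral_mono (h1.sub h2).abs (hi.integrable_sq.div_const M)
          fun x => abs_sub_truncate_le hM _
    _ ≤ C / M := by
        rw [integral_div]
        gcongr

/-- Weak convergence, together with bounded second moments, implies convergence of means. -/
theorem tendsto_integral_of_sq_bounded {μs : ℕ → ProbabilityMeasure E} {μ : ProbabilityMeasure E}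
    (h : Tendsto μs atTop (𝓝 μ)) {F : E → ℝ} (hF : Continuous F)
    (hi : ∀ n, MemLp F 2 (μs n : Measure E)) (hi' : MemLp F 2 (μ : Measure E)) {C : ℝ}
    (hC : ∀ n, ∫ x, F x ^ 2 ∂(μs n : Measure E) ≤ C) :
    Tendsto (fun n => ∫ x, F x ∂(μs n : Measure E)) atTop (𝓝 (∫ x, F x ∂(μ : Measure E))) := by
  set D := max C (∫ x, F x ^ 2 ∂(μ : Measure E)) with hD
  have hD0 : 0 ≤ D := (integral_nonneg fun x => sq_nonneg _).trans (le_max_right _ _)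
  rw [Metric.tendsto_atTop]
  intro ε hε
  -- At this level, truncation changes each mean by at most `D / M < ε / 3`; the last third comes
  -- from weak convergence of the truncated function.
  set M := 3 * (D + 1) / ε with hM
  have hM0 : 0 < M := by positivity
  have hDM : D / M < ε / 3 := by
    rw [hM, div_lt_iff₀ hM0, hM]
    field_simp
    linarith
  let T : BoundedContinuousFunction E ℝ := BoundedContinuousFunction.ofNormedAddCommGroup
    (fun x => truncate M (F x)) ((continuous_truncate M).comp hF) M
    fun x => abs_truncate_le hM0.le _
  have h1 := (ProbabilityMeasure.tendsto_iff_forall_integral_tendsto.1 h) T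
  obtain ⟨N, hN⟩ := Metric.tendsto_atTop.1 h1 (ε / 3) (by positivity)
  refine ⟨N, fun n hn => ?_⟩
  have h2 := hN n hn
  have h3 := abs_integral_sub_integral_truncate_le hF hM0 (hi n) ((hC n).trans (le_max_left C (∫ x, F x ^ 2 ∂(μ : Measure E))))
  have h4 := abs_integral_sub_integral_truncate_le hF hM0 hi' (le_max_right C _)
  rw [Real.dist_eq] at h2 ⊢
  change |∫ x, truncate M (F x) ∂(μs n : Measure E) - ∫ x, truncate M (F x) ∂(μ : Measure E)| < _
    at h2
  rw [← hD] at h3 h4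
  rw [abs_le] at h3 h4
  rw [abs_lt] at h2 ⊢
  constructor <;> linarith

end truncation

theorem memLp_prod_all {Ω κ : Type*} [MeasurableSpace Ω] {P : Measure Ω} [IsProbabilityMeasure P]
    (s : Finset κ) {f : κ → Ω → ℝ} (hf : ∀ k (p : ℕ), MemLp (f k) p P) (p : ℕ) :
    MemLp (fun ω => ∏ k ∈ s, f k ω) p P := by
  classical
  induction s using Finset.induction_on generalizing p with
  | empty => simpa using memLp_const (1 : ℝ)
  | insert k s hk ih => simpa only [Finset.prod_insert hk] using memLp_mul_all (hf k) ih p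

section

variable {q : unitInterval} {d : ℕ}

/-- The vector of the normalized fluctuations of the initial segment of length `n`. -/
def fluctVec (q : unitInterval) (S : Finset (BlockPattern d)) (n : ℕ) (σ : Equiv.Perm ℕ) :
    EuclideanSpace ℝ S :=
  WithLp.toLp 2 fun π : S => fluct q n (pat (Finset.range n) σ) π.1

theorem measurable_fluctVec (q : unitInterval) (S : Finset (BlockPattern d)) (n : ℕ) :
    Measurable (fluctVec q S n) :=
  (Measurable.of_discrete (f := fun τ : FinPerm =>
    (WithLp.toLp 2 fun π : S => fluct q n τ π.1 : EuclideanSpace ℝ S))).comp (measurable_pat _)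

/-- The law of the vector of normalized fluctuations. -/
def fluctLaw (q : unitInterval) (S : Finset (BlockPattern d)) (n : ℕ) :
    ProbabilityMeasure (EuclideanSpace ℝ S) :=
  ⟨(countsMeasure q).map fun r => fluctVec q S n (permOfCounts r),
    Measure.isProbabilityMeasure_map
      ((measurable_fluctVec q S n).comp measurable_permOfCounts).aemeasurable⟩

/-- The limiting Gaussian law. -/
def gaussianLimit (q : unitInterval) (S : Finset (BlockPattern d)) :
    ProbabilityMeasure (EuclideanSpace ℝ S) :=
  ⟨multivariateGaussian 0 ((Gam q d).submatrix Subtype.val Subtype.val), inferInstance⟩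

theorem integral_fluctLaw {F : Type*} [NormedAddCommGroup F] [NormedSpace ℝ F]
    (S : Finset (BlockPattern d)) (n : ℕ) {f : EuclideanSpace ℝ S → F}
    (hf : Continuous f) :
    ∫ x, f x ∂(fluctLaw q S n : Measure (EuclideanSpace ℝ S)) =
      ∫ r, f (fluctVec q S n (permOfCounts r)) ∂countsMeasure q :=
  integral_map ((measurable_fluctVec q S n).comp measurable_permOfCounts).aemeasurable
    hf.aestronglyMeasurable

/-- Lévy's continuity theorem: the one-dimensional characteristic functions of all linear
combinations converge. Positive semidefiniteness of `Gam` is needed for the Gaussian formula. -/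
theorem tendsto_fluctLaw (hq0 : 0 < q) (hq1 : q < 1) (S : Finset (BlockPattern (d + 1))) :
    Tendsto (fluctLaw q S) atTop (𝓝 (gaussianLimit q S)) := by
  refine ProbabilityMeasure.tendsto_iff_tendsto_charFun.2 fun t => ?_
  have h1 := tendsto_integral_cexp_fluct hq0 hq1 fun π : S => t π
  have h2 : charFun (gaussianLimit q S : Measure (EuclideanSpace ℝ S)) t =
      Complex.exp (-((∑ π : S, ∑ ρ : S, t π * t ρ * Gam q (d + 1) π.1 ρ.1) / 2 : ℝ)) := by
    change charFun (multivariateGaussian 0 _) t = _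
    rw [charFun_multivariateGaussian ((posSemidef_Gam hq0 hq1).submatrix _)]
    congr 1
    have : dotProduct t.ofLp (((Gam q (d + 1)).submatrix Subtype.val Subtype.val).mulVec t.ofLp) =
        ∑ π : S, ∑ ρ : S, t π * t ρ * Gam q (d + 1) π.1 ρ.1 := by
      simp only [dotProduct, Matrix.mulVec, Matrix.submatrix_apply, Finset.mul_sum]
      exact Finset.sum_congr rfl fun π _ => Finset.sum_congr rfl fun ρ _ => by ring
    rw [this]
    simp
  rw [h2]
  refine h1.congr fun n => ?_
  rw [charFun_apply, integral_fluctLaw S n (by fun_prop)]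
  refine integral_congr_ae (Eventually.of_forall fun r => ?_)
  simp only [fluctVec, PiLp.inner_apply]
  rfl

theorem memLp_gaussianLimit_monomial (S : Finset (BlockPattern d)) (k : S → ℕ) (p : ℕ) :
    MemLp (fun x : EuclideanSpace ℝ S => ∏ π : S, x π ^ k π) p
      (gaussianLimit q S : Measure (EuclideanSpace ℝ S)) := by
  refine memLp_prod_all _ (fun π => memLp_pow_all (fun p => ?_) (k π)) p
  have h := IsGaussian.memLp_id (multivariateGaussian 0 ((Gam q d).submatrix
    (Subtype.val : S → _) (Subtype.val : S → _))) p (ENNReal.natCast_ne_top p)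
  exact (EuclideanSpace.proj π : EuclideanSpace ℝ S →L[ℝ] ℝ).comp_memLp' h

/-- By Hölder, products and powers of uniformly bounded families are again bounded in every `L^p`;
its second-moment case gives the uniform bound needed for convergence of moments. -/
theorem lpBigO_fluct_monomial (hq1 : q < 1) (S : Finset (BlockPattern (d + 1))) (k : S → ℕ) :
    LpBigO (countsMeasure q) (fun (n : ℕ) r => ∏ π : S, fluctVec q S n (permOfCounts r) π ^ k π)
      fun _ => 1 :=
  LpBigO.finset_prod Finset.univ fun π : S => by
    have := (lpBigO_fluct hq1 π.1).pow (fun _ => zero_le_one) (k π)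
    simp only [one_pow] at this
    exact this

theorem continuous_monomial (S : Finset (BlockPattern d)) (k : S → ℕ) :
    Continuous fun x : EuclideanSpace ℝ S => ∏ π : S, x π ^ k π := by fun_prop

theorem memLp_fluctLaw_monomial (hq1 : q < 1) (S : Finset (BlockPattern (d + 1))) (k : S → ℕ)
    (n p : ℕ) : MemLp (fun x : EuclideanSpace ℝ S => ∏ π : S, x π ^ k π) p
      (fluctLaw q S n : Measure (EuclideanSpace ℝ S)) :=
  (memLp_map_measure_iff (continuous_monomial S k).aestronglyMeasurable
    ((measurable_fluctVec q S n).comp measurable_permOfCounts).aemeasurable).2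
    ((lpBigO_fluct_monomial hq1 S k).memLp n p)

theorem tendsto_integral_fluctLaw_monomial (hq0 : 0 < q) (hq1 : q < 1)
    (S : Finset (BlockPattern (d + 1))) (k : S → ℕ) :
    Tendsto (fun n : ℕ => ∫ x, ∏ π : S, x π ^ k π ∂(fluctLaw q S n : Measure (EuclideanSpace ℝ S)))
      atTop (𝓝 (∫ x, ∏ π : S, x π ^ k π ∂(gaussianLimit q S : Measure (EuclideanSpace ℝ S)))) := by
  obtain ⟨C, hC, hb⟩ := (lpBigO_fluct_monomial hq1 S k).integral_pow_le (fun _ => zero_le_one)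
    even_two one_le_two
  refine tendsto_integral_of_sq_bounded (tendsto_fluctLaw hq0 hq1 S) (continuous_monomial S k)
    (fun n => by exact_mod_cast memLp_fluctLaw_monomial hq1 S k n 2)
    (by exact_mod_cast memLp_gaussianLimit_monomial S k 2) (C := C * 1 ^ 2) fun n => ?_
  refine (integral_fluctLaw S n ((continuous_monomial S k).pow 2)).trans_le ?_
  exact (hb n).2

variable {Ω : Type*} [MeasurableSpace Ω] {P : Measure Ω} {Sig : Ω → Equiv.Perm ℕ}

theorem map_fluctVec (hSig : HasLaw Sig (mallowsInfinite q) P) (S : Finset (BlockPattern d)) (n : ℕ) :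
    P.map (fun ω => fluctVec q S n (Sig ω)) = fluctLaw q S n := by
  have h1 := AEMeasurable.map_map_of_aemeasurable (μ := P) (f := Sig)
    (measurable_fluctVec q S n).aemeasurable hSig.aemeasurable
  have h2 := Measure.map_map (μ := countsMeasure q) (measurable_fluctVec q S n)
    measurable_permOfCounts
  rw [hSig.map_eq] at h1
  exact h1.symm.trans h2

end

end

/-! ### Transfer from the sequence of counts to an arbitrary realization of the infinite Mallows
permutation -/

theorem mainTheorem1 {Ω : Type*} [MeasurableSpace Ω] (P : Measure Ω) [IsProbabilityMeasure P]
    (q : unitInterval) (hq0 : 0 < q) (hq1 : q < 1) (d : ℕ) (hd : 1 ≤ d)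
    (Sig : Ω → Equiv.Perm ℕ) (hSig : HasLaw Sig (mallowsInfinite q) P)
    (τ : ℕ → Ω → FinPerm) (hτ : ∀ n ω, τ n ω = pat (Finset.range n) (Sig ω)) :
    -- the constants are well defined
    (MemLp (fun B : FinPerm => (B.1 : ℝ)) 2 (mallowsBlock q) ∧ 0 < meanSize q ∧
      ∀ β : Block, MemLp (fun B : FinPerm => (occ β.1 B : ℝ)) 2 (mallowsBlock q) ∧
        0 < meanOcc q β.1) ∧
    -- the permutation `τ n` is a Mallows permutation of size `n`
    (∀ (n : ℕ) (σ : Equiv.Perm (Fin n)),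
      P.real {ω | τ n ω = ⟨n, σ⟩} =
        (q : ℝ) ^ inv σ / ∑ ρ : Equiv.Perm (Fin n), (q : ℝ) ^ inv ρ) ∧
    -- law of large numbers
    (∀ π : BlockPattern d, ∀ᵐ ω ∂P,
      Tendsto (fun n : ℕ => (occ π.toPerm (τ n ω) : ℝ) / (n : ℝ) ^ d) atTop
        (𝓝 (eConst q π / (d.factorial : ℝ)))) ∧
    -- joint central limit theorem
    (Gam q d).PosSemidef ∧
    (∀ S : Finset (BlockPattern d),
      TendstoInDistribution
        (fun (n : ℕ) (ω : Ω) => WithLp.toLp 2 fun π : S => fluct q n (τ n ω) π.1)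
        atTop (id : EuclideanSpace ℝ S → EuclideanSpace ℝ S) (fun _ => P)
        (multivariateGaussian 0 ((Gam q d).submatrix Subtype.val Subtype.val))) ∧
    -- convergence of all joint moments
    (∀ (S : Finset (BlockPattern d)) (k : S → ℕ),
      (∀ n : ℕ, Integrable (fun ω => ∏ π : S, fluct q n (τ n ω) π.1 ^ k π) P) ∧
      Integrable (fun x : EuclideanSpace ℝ S => ∏ π : S, x π ^ k π)
        (multivariateGaussian 0 ((Gam q d).submatrix Subtype.val Subtype.val)) ∧
      Tendsto (fun n : ℕ => ∫ ω, ∏ π : S, fluct q n (τ n ω) π.1 ^ k π ∂P) atTop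
        (𝓝 (∫ x : EuclideanSpace ℝ S, ∏ π : S, x π ^ k π
          ∂(multivariateGaussian 0 ((Gam q d).submatrix Subtype.val Subtype.val))))) := by

  obtain ⟨d, rfl⟩ := Nat.exists_eq_add_of_le' hd
  have hτ' : ∀ n, τ n = fun ω => pat (Finset.range n) (Sig ω) := fun n => funext (hτ n)
  have hvec : ∀ (S : Finset (BlockPattern (d + 1))) (n : ℕ), AEMeasurable
      (fun ω => fluctVec q S n (Sig ω)) P := fun S n =>
    (measurable_fluctVec q S n).comp_aemeasurable hSig.aemeasurable
  refine ⟨⟨by exact_mod_cast memLp_size hq1 2, zero_lt_one.trans_le (one_le_meanSize hq1), fun β =>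
    ⟨by exact_mod_cast memLp_occ hq1 β 2, meanOcc_pos hq0 hq1 β⟩⟩, fun n σ => ?_, fun π => ?_,
    posSemidef_Gam hq0 hq1, fun S => ?_, fun S k => ⟨fun n => ?_, ?_, ?_⟩⟩
  · have hm : MeasurableSet {s : Equiv.Perm ℕ | pat (Finset.range n) s = ⟨n, σ⟩} :=
      measurable_pat _ (measurableSet_singleton _)
    rw [← measure_pat_range hq0 hq1 n σ, hτ', hSig.measureReal_eq hm]
    exact map_measureReal_apply measurable_permOfCounts hm
  · have h1 : ∀ᵐ s ∂(mallowsInfinite q), Tendsto (fun n : ℕ =>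
        (occ π.toPerm (pat (Finset.range n) s) : ℝ) / (n : ℝ) ^ (d + 1)) atTop
        -- The almost sure limit is first stated for the law of the permutation itself; convergence
        -- is a measurable event there, so it transfers from the counts.
        (𝓝 (eConst q π / ((d + 1).factorial : ℝ))) := by
      refine (ae_map_iff measurable_permOfCounts.aemeasurable ?_).2 (ae_tendsto_occAt hq1 π)
      refine measurableSet_tendsto _ fun n => ?_
      exact (Measurable.of_discrete (f := fun τ : FinPerm =>
        (occ π.toPerm τ : ℝ) / (n : ℝ) ^ (d + 1))).comp (measurable_pat _)
    simp only [hτ]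
    rw [← hSig.map_eq] at h1
    exact ae_of_ae_map hSig.aemeasurable h1
  · simp only [hτ]
    refine ⟨hvec S, by fun_prop, ?_⟩
    have h := tendsto_fluctLaw hq0 hq1 S
    refine (h.congr fun n => Subtype.ext (map_fluctVec hSig S n).symm).trans_eq ?_
    -- The limit in distribution is the image of the Gaussian law under the identity, hence that law
    -- itself.
    exact congrArg 𝓝 (Subtype.ext Measure.map_id.symm)
  · simp only [hτ]
    have h := (memLp_fluctLaw_monomial hq1 S k n 1).integrable (by simp)
    rw [← map_fluctVec hSig S n] at h
    exact h.comp_aemeasurable (hvec S n)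
  · exact (memLp_gaussianLimit_monomial S k 1).integrable (by simp)
  · simp only [hτ]
    refine (tendsto_integral_fluctLaw_monomial hq0 hq1 S k).congr fun n => ?_
    rw [← map_fluctVec hSig S n]
    exact integral_map (hvec S n) (continuous_monomial S k).aestronglyMeasurable
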